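/- For a graph $G=(V,E)$, a configuration is a permutation $f$ of $V$ (the token on vertex $u$ is $f(u)$); applying a swap $e=\{u,v\}\in E$ gives the configuration $fe$ that exchanges the tokens on $u$ and $v$. A solution for $f$ is a finite sequence of swaps turning $f$ into the identity, and $\mathsf{ts}(G,f)$ is the minimum length of a solution. For $m,n\ge 0$ the star-path graph $Q_{m,n}$ has vertex set $\{-m,\dots,-1,0,1,\dots,n\}$ and edges $\{i,0\}$ for $i<0$ and $\{i,i+1\}$ for $0\le i<n$. For a configuration $f$ on $Q_{m,n}$ let $\mathrm{Inv}(f,j)=|\{i: i<j,\ f^{-1}(i)>f^{-1}(j)\}|$; for $0\le j\le n$ let $\pi(f,j)=j+1$ if $f^{-1}(j)<0$ and $\pi(f,j)=\min(j+1,\mathrm{Inv}(f,j))$ otherwise; and let $\pi(f)=\sum_{j=0}^n\pi(f,j)$. Let $N_f=\{f(i): f(i)<0,\ f(i)\ne i\}$, let $\Delta_f$ be the set of those orbits $[i]_f=\{f^r(i): r\in\mathbb N\}$ with $i<0$ that are contained in $N_f$, and let $\mu(f)=|N_f|+|\Delta_f|$. Let $\delta(f)=\delta(\langle f(-1),\dots,f(-m)\rangle;\langle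 f(0),\dots,f(n)\rangle)$, where for sequences $\vec i=\langle i_1,\dots,i_m\rangle$ and $\vec j=\langle j_1,\dots,j_k\rangle$ of distinct tokens in which all of $-1,\dots,-m$ occur, with $c=\max(\vec i)$ ($=-\infty$ if $m=0$) and $[a/b]$ denoting the replacement of $b$ by $a$, $$\delta(\vec i;\vec j)=\begin{cases}0&\text{if } c<0,\\ \delta(\vec i;\langle j_2,\dots,j_k\rangle)&\text{if } j_1>c\ge 0,\\ \delta(\vec i[j_1/c];\langle j_2,\dots,j_k\rangle)&\text{if } c>j_1\ge 0,\\ \delta(\vec i[j_1/i_{-j_1}];\vec j[i_{-j_1}/j_1])-1&\text{if } j_1<0 \text{ and } i_{-j_1}=c,\\ \delta(\vec i[j_1/i_{-j_1}];\vec j[i_{-j_1}/j_1])&\text{otherwise.}\end{cases}$$ Put $\Psi(f)=\pi(f)+\mu(f)+\delta(f)$. Consider the following algorithm on input $f$: for $k=n,\dots,1,0,-1,\dots,-m$ in this order, first, while the token on the vertex $0$ is negative, move that token along the path to its goal vertex; then move the token $k$ along the path to the vertex $k$. **Theorem.** 1. Token Swapping on star-path graphs is solvable in polynomial time: there is a Turing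 machine that, given $m$, $n$, a configuration $f$ on $Q_{m,n}$ (as the list of its values) and $k\in\mathbb N$, all numbers in binary, decides in time polynomial in the length of the input whether $\mathsf{ts}(Q_{m,n},f)\le k$. 2. For all $m,n\ge 0$ and every configuration $f$ on $Q_{m,n}$: $\mathsf{ts}(Q_{m,n},f)=\Psi(f)$; $|\Psi(fe)-\Psi(f)|=1$ for every edge $e$ of $Q_{m,n}$; and the algorithm terminates on $f$, its swaps form a solution for $f$ of minimum length $\mathsf{ts}(Q_{m,n},f)$, and each of them lowers $\Psi$ by exactly one. -/

import Mathlib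

/-! ### Token swapping on arbitrary graphs -/

namespace TokenSwapping

variable {V : Type*} [DecidableEq V]

/-- The configuration `fe` obtained from the configuration `f` by applying the swap `e = {u, v}`:
`fe(u) = f(v)`, `fe(v) = f(u)` and `fe(w) = f(w)` for every other `w`.
The token on the vertex `u` in `f` is `f u`. -/
def applySwap (f : Equiv.Perm V) (e : Sym2 V) : Equiv.Perm V :=
  Sym2.lift ⟨fun u v => f * Equiv.swap u v, fun u v => by simp only [Equiv.swap_comm]⟩ e

/-- The configuration obtained from `f` by applying a sequence of swaps, first one first. -/
def applySwaps (f : Equiv.Perm V) (es : List (Sym2 V)) : Equiv.Perm V :=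
  es.foldl applySwap f

/-- `TS(G, f)`: the sequences of swaps on `G` that turn `f` into the identity. -/
def solutions (G : SimpleGraph V) (f : Equiv.Perm V) : Set (List (Sym2 V)) :=
  {es | (∀ e ∈ es, e ∈ G.edgeSet) ∧ applySwaps f es = 1}

/-- `ts(G, f)`: the length of a shortest solution. -/
noncomputable def ts (G : SimpleGraph V) (f : Equiv.Perm V) : ℕ :=
  sInf (List.length '' solutions G f)

/-- The orbit `[u]_f = {fⁱ(u) | i ∈ ℕ}`. -/
def orbit (f : Equiv.Perm V) (u : V) : Set V :=
  {v | ∃ i : ℕ, (f ^ i) u = v}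

end TokenSwapping

/-! ### Star-path graphs and the evaluation function -/

namespace StarPath

open TokenSwapping

/-- The vertex set `{-m, …, -1, 0, 1, …, n}`. -/
abbrev Vtx (m n : ℕ) : Type := Set.Icc (-(m : ℤ)) (n : ℤ)

/-- The vertex `0`. -/
def origin (m n : ℕ) : Vtx m n := ⟨0, by simp⟩

/-- The vertex `-(p + 1)`, for `p < m`. -/
def leaf {m n : ℕ} (p : Fin m) : Vtx m n :=
  ⟨-((p : ℤ) + 1), by have := p.isLt; constructor <;> omega⟩

/-- The vertex `q`, for `q ≤ n`. -/
def pathVtx {m n : ℕ} (q : Fin (n + 1)) : Vtx m n :=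
  ⟨(q : ℤ), by have := q.isLt; constructor <;> omega⟩

/-- The star-path graph `Q_{m,n}`: its edges are `{i, 0}` for `i < 0` and `{i, i + 1}` for
`i ≥ 0`. -/
def graph (m n : ℕ) : SimpleGraph (Vtx m n) where
  Adj u v :=
    (u.1 < 0 ∧ v.1 = 0) ∨ (v.1 < 0 ∧ u.1 = 0) ∨
      (0 ≤ u.1 ∧ v.1 = u.1 + 1) ∨ (0 ≤ v.1 ∧ u.1 = v.1 + 1)
  symm := ⟨fun u v h => by omega⟩
  loopless := ⟨fun u h => by omega⟩

/-- `Inv(f, j)`: the number of tokens `i < j` lying to the right of the token `j`. -/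
noncomputable def inv {m n : ℕ} (f : Equiv.Perm (Vtx m n)) (j : Vtx m n) : ℕ :=
  {i : Vtx m n | i < j ∧ f.symm i > f.symm j}.ncard

/-- `π(f, j)`, for a token `j ≥ 0`. -/
noncomputable def piTok {m n : ℕ} (f : Equiv.Perm (Vtx m n)) (j : Fin (n + 1)) : ℕ :=
  if (f.symm (pathVtx j)).1 < 0 then (j : ℕ) + 1 else min ((j : ℕ) + 1) (inv f (pathVtx j))

/-- `π(f) = ∑_{j = 0}^{n} π(f, j)`. -/
noncomputable def piFun {m n : ℕ} (f : Equiv.Perm (Vtx m n)) : ℕ :=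
  ∑ j : Fin (n + 1), piTok f j

/-- `N_f`: the misplaced negative tokens. -/
def misplacedNeg {m n : ℕ} (f : Equiv.Perm (Vtx m n)) : Set (Vtx m n) :=
  {t | ∃ i, f i = t ∧ t.1 < 0 ∧ f i ≠ i}

/-- `Δ_f`: the orbits `[i]_f`, `i < 0`, that are contained in `N_f`. -/
def negOrbits {m n : ℕ} (f : Equiv.Perm (Vtx m n)) : Set (Set (Vtx m n)) :=
  {O | ∃ i : Vtx m n, i.1 < 0 ∧ O = orbit f i ∧ O ⊆ misplacedNeg f}

/-- `μ(f) = |N_f| + |Δ_f|`. -/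
noncomputable def muFun {m n : ℕ} (f : Equiv.Perm (Vtx m n)) : ℕ :=
  (misplacedNeg f).ncard + (negOrbits f).ncard

/-- The largest token on the negative vertices, `⊥` if there is no negative vertex. -/
noncomputable def maxTok {m : ℕ} (i : Fin m → ℤ) : WithBot ℤ :=
  Finset.univ.sup fun p => (i p : WithBot ℤ)

/-- The sequence `i[a/c]`, in which `a` replaces `c`. -/
noncomputable def replaceTok {m : ℕ} (i : Fin m → ℤ) (a : ℤ) (c : WithBot ℤ) : Fin m → ℤ :=
  fun p => if (i p : WithBot ℤ) = c then a else i p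

/-- The number of misplaced tokens in `i`, whose entry `i p` is the token on the vertex
`-(p + 1)`. -/
def misplaced {m : ℕ} (i : Fin m → ℤ) : ℕ :=
  (Finset.univ.filter fun p : Fin m => i p ≠ -((p : ℤ) + 1)).card

theorem misplaced_update_lt {m : ℕ} (i : Fin m → ℤ) (p : Fin m) (a : ℤ)
    (ha : a = -((p : ℤ) + 1)) (hi : i p ≠ a) :
    misplaced (Function.update i p a) < misplaced i := by
  apply Finset.card_lt_card
  rw [Finset.ssubset_iff_of_subset]
  · refine ⟨p, ?_, ?_⟩
    · simpa only [Finset.mem_filter, Finset.mem_univ, true_and, ← ha] using hi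
    · simp only [Finset.mem_filter, Finset.mem_univ, true_and, ← ha, Function.update_self]
      exact fun h => h rfl
  · intro q hq
    by_cases hqp : q = p
    · subst hqp
      simp [ha] at hq
    · simpa [Function.update_of_ne hqp] using hq

theorem misplaced_replaceTok_le {m : ℕ} (i : Fin m → ℤ) (a : ℤ) (c : WithBot ℤ)
    (hc : ¬ c < 0) : misplaced (replaceTok i a c) ≤ misplaced i := by
  apply Finset.card_le_card
  intro q hq
  simp only [Finset.mem_filter, Finset.mem_univ, true_and] at hq ⊢
  by_cases hqc : (i q : WithBot ℤ) = c
  · intro h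
    apply hc
    rw [← hqc, h]
    have : -((q : ℤ) + 1) < 0 := by omega
    exact_mod_cast this
  · simpa [replaceTok, hqc] using hq

/-- The discount `δ(i; j)` of a sequence pair. Here `i p` is the token on the vertex `-(p + 1)`,
and `j` lists the tokens on the vertices `0, 1, …, k`. With `c = max i`, it is
* `0` if `c < 0`,
* `δ(i; j₂, …)` if `j₁ > c ≥ 0`,
* `δ(i[j₁/c]; j₂, …)` if `c > j₁ ≥ 0`,
* `δ(i'; i_{-j₁}, j₂, …) - 1` if `j₁ < 0` and `i_{-j₁} = c`,
* `δ(i'; i_{-j₁}, j₂, …)` otherwise,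

where `i'` is `i` with the entry on the vertex `j₁` replaced by `j₁`. The branches with value `0`
other than the first do not occur when `(i; j)` is an injective sequence in which all the tokens
`-m, …, -1` occur and none below `-m`. -/
noncomputable def discount {m : ℕ} (i : Fin m → ℤ) : List ℤ → ℤ
  | [] => 0
  | a :: j =>
    if _hc : maxTok i < 0 then 0
    else if 0 ≤ a then
      if maxTok i < a then discount i j
      else discount (replaceTok i a (maxTok i)) j
    else if hp : (-a - 1).toNat < m then
      if _hi : i ⟨(-a - 1).toNat, hp⟩ = a then 0
      else if (i ⟨(-a - 1).toNat, hp⟩ : WithBot ℤ) = maxTok i then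
        discount (Function.update i ⟨(-a - 1).toNat, hp⟩ a)
          (i ⟨(-a - 1).toNat, hp⟩ :: j) - 1
      else
        discount (Function.update i ⟨(-a - 1).toNat, hp⟩ a)
          (i ⟨(-a - 1).toNat, hp⟩ :: j)
    else 0
termination_by j => misplaced i + j.length
decreasing_by
  · simp
  · have := misplaced_replaceTok_le i a (maxTok i) _hc
    simp only [List.length_cons]
    omega
  · have := misplaced_update_lt i ⟨(-a - 1).toNat, hp⟩ a (by simp only; omega) _hi
    simp only [List.length_cons]
    omega
  · have := misplaced_update_lt i ⟨(-a - 1).toNat, hp⟩ a (by simp only; omega) _hi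
    simp only [List.length_cons]
    omega

/-- `⟨f(-1), …, f(-m)⟩`. -/
def leafTokens {m n : ℕ} (f : Equiv.Perm (Vtx m n)) : Fin m → ℤ :=
  fun p => (f (leaf p)).1

/-- `⟨f(0), …, f(n)⟩`. -/
def pathTokens {m n : ℕ} (f : Equiv.Perm (Vtx m n)) : List ℤ :=
  List.ofFn fun q : Fin (n + 1) => (f (pathVtx q)).1

/-- `δ(f)`. -/
noncomputable def deltaFun {m n : ℕ} (f : Equiv.Perm (Vtx m n)) : ℤ :=
  discount (leafTokens f) (pathTokens f)

/-- `Ψ(f) = π(f) + μ(f) + δ(f)`. -/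
noncomputable def psiFun {m n : ℕ} (f : Equiv.Perm (Vtx m n)) : ℤ :=
  (piFun f : ℤ) + (muFun f : ℤ) + deltaFun f

/-! ### The algorithm, as a big-step relation -/

/-- `Moves k f es g`: moving the token `k` directly (along a simple path) to the vertex `k` turns
`f` into `g` by the swaps `es`. -/
def Moves {m n : ℕ} (k : Vtx m n) (f : Equiv.Perm (Vtx m n)) (es : List (Sym2 (Vtx m n)))
    (g : Equiv.Perm (Vtx m n)) : Prop :=
  (∃ p : (graph m n).Walk (f.symm k) k, p.IsPath ∧ p.edges = es) ∧ g = applySwaps f es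

/-- The loop "while the token on the vertex `0` is negative, move it to its goal vertex". -/
inductive WhileRun {m n : ℕ} :
    Equiv.Perm (Vtx m n) → List (Sym2 (Vtx m n)) → Equiv.Perm (Vtx m n) → Prop
  | done (f : Equiv.Perm (Vtx m n)) (h : 0 ≤ (f (origin m n)).1) : WhileRun f [] f
  | step (f g g' : Equiv.Perm (Vtx m n)) (es es' : List (Sym2 (Vtx m n)))
      (h : (f (origin m n)).1 < 0) (hm : Moves (f (origin m n)) f es g)
      (hw : WhileRun g es' g') : WhileRun f (es ++ es') g'

/-- The loop "for every `k` in the list, run the while loop and then move the token `k` to the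
vertex `k`". -/
inductive ForRun {m n : ℕ} :
    List (Vtx m n) → Equiv.Perm (Vtx m n) → List (Sym2 (Vtx m n)) →
      Equiv.Perm (Vtx m n) → Prop
  | nil (f : Equiv.Perm (Vtx m n)) : ForRun [] f [] f
  | cons (k : Vtx m n) (ks : List (Vtx m n)) (f g g' g'' : Equiv.Perm (Vtx m n))
      (es es' es'' : List (Sym2 (Vtx m n))) (hw : WhileRun f es g) (hm : Moves k g es' g')
      (hf : ForRun ks g' es'' g'') : ForRun (k :: ks) f (es ++ es' ++ es'') g''

/-- The list of vertices `n, …, 1, 0, -1, …, -m`. -/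
def descending (m n : ℕ) : List (Vtx m n) :=
  (List.ofFn fun q : Fin (n + 1) => (pathVtx q : Vtx m n)).reverse ++
    List.ofFn fun p : Fin m => (leaf p : Vtx m n)

/-- `AlgorithmRun f es`: on input `f`, the algorithm terminates and performs the swaps `es`. -/
def AlgorithmRun {m n : ℕ} (f : Equiv.Perm (Vtx m n)) (es : List (Sym2 (Vtx m n))) : Prop :=
  ∃ g, ForRun (descending m n) f es g

/-! ### Instances and their encoding -/

/-- An instance of Token Swapping on star-path graphs: a star-path graph `Q_{m,n}`, a
configuration on it and a natural number. -/
structure Instance where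
  m : ℕ
  n : ℕ
  f : Equiv.Perm (Vtx m n)
  k : ℕ

open Computability in
/-- A natural number in binary, followed by a comma. -/
def encodeNatWord (a : ℕ) : List Γ' :=
  (encodeNat a).map Γ'.bit ++ [Γ'.comma]

open Computability in
/-- An integer as its sign (`true` for negative) and its absolute value in binary, followed by a
comma. -/
def encodeIntWord (a : ℤ) : List Γ' :=
  Γ'.bit (decide (a < 0)) :: encodeNatWord a.natAbs

open Computability in
/-- An instance as the word `m,n,k,[f(-1),…,f(-m),][f(0),…,f(n),]`, with all numbers in binary. -/
def Instance.encode (x : Instance) : List Γ' :=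
  encodeNatWord x.m ++ encodeNatWord x.n ++ encodeNatWord x.k ++
    ([Γ'.bra] ++ (List.ofFn (leafTokens x.f)).flatMap encodeIntWord ++ [Γ'.ket]) ++
    ([Γ'.bra] ++ (pathTokens x.f).flatMap encodeIntWord ++ [Γ'.ket])

/-- The question of an instance: is `ts(Q_{m,n}, f) ≤ k`? -/
noncomputable def Instance.answer (x : Instance) : Bool :=
  decide (ts (graph x.m x.n) x.f ≤ x.k)

end StarPath

/-! ### A priority process on flagged values -/

/-! The optimum is squeezed between two bounds. Every swap of the algorithm lowers Ψ by exactly one,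
and the algorithm ends in the identity, where Ψ vanishes (`AlgorithmRun.spec`, `psiFun_one`); so
Ψ(f) is the length of an actual solution. Conversely, no swap lowers Ψ by more than one, so no
solution is shorter. For this it is enough to bound the change of Ψ by two
(`abs_psiFun_applySwap_sub_le`): since Ψ(f) is the length of a solution, its parity is the sign of
the permutation f, which every swap reverses, so the change is odd (`abs_psiFun_applySwap_sub`).

The obstacle is the recursive term δ, which is hard to follow under a swap. It is replaced by a
process on a list. A token resolves to the first nonnegative token that is met on passing from each
negative token to the token on its goal leaf. List the values to which the tokens on the path
resolve, flagged where the token itself is negative. In the process each arriving value competes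
with the later flagged values; the largest is discarded and the arrival takes its place. Then -δ is
the number of flagged arrivals that are discarded on arrival (`discount_eq_neg_discards`,
`deltaFun_eq`): the clauses of δ for a nonnegative head are one arrival, while those for a negative
head leave the resolved values alone and at most take away the flag of the head. The count is
stable: exchanging two flagged values, or two adjacent arrivals, changes it by at most one
(`abs_discards_exchangeFlagged_le`, `abs_discards_swap_le`).

A swap on the path exchanges two adjacent arrivals, changes π by at most one and does not affect μ.
At a leaf, π and δ may jump simultaneously, but these jumps cancel: π plus the indicator of
`HeadMax` is invariant (`piFun_leafSwap`), and the same indicator is what the count gains if the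
head of the list is flagged artificially (`discards_head`). With this normalisation a leaf swap at
most exchanges two flagged values (`resolvesList_swap`), and what remains is the change of μ
(`muFun_leafSwap`). The swaps of the algorithm are of four kinds, each of which lowers Ψ by one for
its own reason: a negative token goes home (`psiFun_home`), the largest leaf token goes to the
vertex 0 (`psiFun_out`), the largest misplaced token moves right (`psiFun_right`), a cycle of
negative tokens is broken up (`psiFun_extract`).

For the complexity, a small language of stack programs is compiled to Turing machines
(`Exec.iterate_step`). The program writes tokens in unary, plays the strategy of the algorithm on
stacks and counts swaps. Its correctness does not refer to runs of the algorithm: the invariant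
`Represents` ties the stacks to a configuration, and Ψ of this configuration plus the number of
counted swaps stays constant. Unary notation is affordable because the input lists a value for every
vertex; only the bound k may be huge, and it stays in binary. -/

namespace StarPath

/-- The flagged values of a list. -/
def flagged (l : List (ℤ × Bool)) : List ℤ := (l.filter fun x => x.2).map fun x => x.1

/-- The largest flagged value, `-1` if there is none. -/
def maxFlagged (l : List (ℤ × Bool)) : ℤ := (flagged l).foldr max (-1)

/-- Applies a function to the flagged values. -/
def mapFlagged (φ : ℤ → ℤ) (l : List (ℤ × Bool)) : List (ℤ × Bool) :=
  l.map fun x => if x.2 then (φ x.1, true) else x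

/-- Replaces the flagged value `c` by `v`. -/
def replaceFlagged (c v : ℤ) (l : List (ℤ × Bool)) : List (ℤ × Bool) :=
  mapFlagged (fun x => if x = c then v else x) l

@[simp] theorem length_mapFlagged (φ : ℤ → ℤ) (l : List (ℤ × Bool)) :
    (mapFlagged φ l).length = l.length := by simp [mapFlagged]

@[simp] theorem length_replaceFlagged (c v : ℤ) (l : List (ℤ × Bool)) :
    (replaceFlagged c v l).length = l.length := by simp [replaceFlagged]

/-- Values arrive from left to right; the maximum of the arriving value and the later flagged
values is discarded, the arriving value taking its place. Counts how often a flagged arrival is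
discarded itself. -/
def discards : List (ℤ × Bool) → ℕ
  | [] => 0
  | x :: l =>
    if maxFlagged l < x.1 then x.2.toNat + discards l
    else discards (replaceFlagged (maxFlagged l) x.1 l)
termination_by l => l.length

@[simp] theorem flagged_nil : flagged [] = [] := rfl

@[simp] theorem flagged_cons_true (v : ℤ) (l : List (ℤ × Bool)) :
    flagged ((v, true) :: l) = v :: flagged l := by simp [flagged]

@[simp] theorem flagged_cons_false (v : ℤ) (l : List (ℤ × Bool)) :
    flagged ((v, false) :: l) = flagged l := by simp [flagged]

@[simp] theorem flagged_append (l l' : List (ℤ × Bool)) :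
    flagged (l ++ l') = flagged l ++ flagged l' := by simp [flagged]

theorem mem_flagged {v : ℤ} {l : List (ℤ × Bool)} : v ∈ flagged l ↔ (v, true) ∈ l := by
  simp [flagged]

theorem mem_values_of_mem_flagged {v : ℤ} {l : List (ℤ × Bool)} (h : v ∈ flagged l) :
    v ∈ l.map Prod.fst :=
  List.mem_map.2 ⟨_, mem_flagged.1 h, rfl⟩

@[simp] theorem flagged_mapFlagged (φ : ℤ → ℤ) (l : List (ℤ × Bool)) :
    flagged (mapFlagged φ l) = (flagged l).map φ := by
  induction l with
  | nil => rfl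
  | cons x l ih =>
    obtain ⟨v, b⟩ := x
    cases b
    · simpa [mapFlagged] using ih
    · simpa [mapFlagged] using ih

theorem le_maxFlagged {v : ℤ} {l : List (ℤ × Bool)} (h : v ∈ flagged l) : v ≤ maxFlagged l := by
  unfold maxFlagged
  generalize flagged l = l at h
  induction l with
  | nil => simp at h
  | cons a l ih =>
    rcases List.mem_cons.1 h with rfl | h
    · simp
    · simp [ih h]

theorem maxFlagged_le {c : ℤ} {l : List (ℤ × Bool)} (hc : -1 ≤ c) (h : ∀ v ∈ flagged l, v ≤ c) :
    maxFlagged l ≤ c := by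
  unfold maxFlagged
  generalize flagged l = l at h
  induction l with
  | nil => simpa
  | cons a l ih =>
    simp only [List.foldr_cons, max_le_iff]
    exact ⟨h a (by simp), ih fun v hv => h v (by simp [hv])⟩

theorem neg_one_le_maxFlagged (l : List (ℤ × Bool)) : -1 ≤ maxFlagged l := by
  unfold maxFlagged
  induction flagged l with
  | nil => simp
  | cons a l ih => simp [ih]

theorem maxFlagged_mem {l : List (ℤ × Bool)} (h : maxFlagged l ≠ -1) :
    maxFlagged l ∈ flagged l := by
  unfold maxFlagged at h ⊢
  generalize flagged l = l at h
  induction l with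
  | nil => simp at h
  | cons a l ih =>
    simp only [List.foldr_cons] at h ⊢
    rcases max_choice a (l.foldr max (-1)) with h1 | h1
    · simp [h1]
    · rw [h1] at h ⊢
      simp [ih h]

theorem maxFlagged_eq {c : ℤ} {l : List (ℤ × Bool)} (hc : -1 ≤ c) (h : ∀ v ∈ flagged l, v ≤ c)
    (h' : c = -1 ∨ c ∈ flagged l) : maxFlagged l = c := by
  refine le_antisymm (maxFlagged_le hc h) ?_
  rcases h' with rfl | h'
  · exact neg_one_le_maxFlagged l
  · exact le_maxFlagged h'

theorem maxFlagged_cons_true (v : ℤ) (l : List (ℤ × Bool)) :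
    maxFlagged ((v, true) :: l) = max v (maxFlagged l) := by simp [maxFlagged]

theorem maxFlagged_cons_false (v : ℤ) (l : List (ℤ × Bool)) :
    maxFlagged ((v, false) :: l) = maxFlagged l := by simp [maxFlagged]

theorem mapFlagged_congr {φ ψ : ℤ → ℤ} {l : List (ℤ × Bool)} (h : ∀ v ∈ flagged l, φ v = ψ v) :
    mapFlagged φ l = mapFlagged ψ l := by
  apply List.map_congr_left
  rintro ⟨v, b⟩ hx
  cases b
  · rfl
  · simp [h v (mem_flagged.2 hx)]

theorem mapFlagged_mapFlagged (φ ψ : ℤ → ℤ) (l : List (ℤ × Bool)) :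
    mapFlagged φ (mapFlagged ψ l) = mapFlagged (φ ∘ ψ) l := by
  simp only [mapFlagged, List.map_map]
  apply List.map_congr_left
  rintro ⟨v, b⟩ -
  cases b <;> simp

theorem mapFlagged_id (l : List (ℤ × Bool)) : mapFlagged id l = l := by
  conv_rhs => rw [← List.map_id l]
  apply List.map_congr_left
  rintro ⟨v, b⟩ -
  cases b <;> simp

@[simp] theorem mapFlagged_cons_true (φ : ℤ → ℤ) (v : ℤ) (l : List (ℤ × Bool)) :
    mapFlagged φ ((v, true) :: l) = (φ v, true) :: mapFlagged φ l := rfl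

@[simp] theorem mapFlagged_cons_false (φ : ℤ → ℤ) (v : ℤ) (l : List (ℤ × Bool)) :
    mapFlagged φ ((v, false) :: l) = (v, false) :: mapFlagged φ l := rfl

theorem mapFlagged_append (φ : ℤ → ℤ) (l l' : List (ℤ × Bool)) :
    mapFlagged φ (l ++ l') = mapFlagged φ l ++ mapFlagged φ l' := List.map_append ..

theorem replaceFlagged_of_notMem {c v : ℤ} {l : List (ℤ × Bool)} (h : c ∉ flagged l) :
    replaceFlagged c v l = l := by
  conv_rhs => rw [← mapFlagged_id l]
  exact mapFlagged_congr fun x hx => if_neg fun e : x = c => h (e ▸ hx)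

/-- The values are distinct and nonnegative. -/
def Valid (l : List (ℤ × Bool)) : Prop := (l.map Prod.fst).Nodup ∧ ∀ v ∈ l.map Prod.fst, 0 ≤ v

theorem valid_cons {v : ℤ} {b : Bool} {l : List (ℤ × Bool)} :
    Valid ((v, b) :: l) ↔ 0 ≤ v ∧ v ∉ l.map Prod.fst ∧ Valid l := by
  simp only [Valid, List.map_cons, List.nodup_cons, List.forall_mem_cons]
  tauto

theorem mem_values_replaceFlagged {c v x : ℤ} {l : List (ℤ × Bool)}
    (h : x ∈ (replaceFlagged c v l).map Prod.fst) : x ∈ l.map Prod.fst ∨ x = v := by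
  simp only [replaceFlagged, mapFlagged, List.map_map, List.mem_map] at h ⊢
  obtain ⟨⟨w, b⟩, hw, rfl⟩ := h
  cases b
  · exact Or.inl ⟨_, hw, rfl⟩
  · by_cases hc : w = c
    · simp [hc]
    · exact Or.inl ⟨_, hw, by simp [hc]⟩

theorem Valid.replaceFlagged {c v : ℤ} {l : List (ℤ × Bool)} (h : Valid l) (h0 : 0 ≤ v)
    (hv : v ∉ l.map Prod.fst) : Valid (replaceFlagged c v l) := by
  induction l with
  | nil => exact h
  | cons x l ih =>
    obtain ⟨w, b⟩ := x
    obtain ⟨hw, hwl, hl⟩ := valid_cons.1 h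
    simp only [List.map_cons, List.mem_cons, not_or] at hv
    have key : b = false ∨ w ≠ c → StarPath.replaceFlagged c v ((w, b) :: l)
        = (w, b) :: StarPath.replaceFlagged c v l := by
      rintro (rfl | hne)
      · rfl
      · cases b
        · rfl
        · exact congrArg (fun x => (x, true) :: StarPath.replaceFlagged c v l) (if_neg hne)
    by_cases hc : b = false ∨ w ≠ c
    · rw [key hc, valid_cons]
      refine ⟨hw, fun hm => ?_, ih hl hv.2⟩
      rcases mem_values_replaceFlagged hm with hm | hm
      · exact hwl hm
      · exact hv.1 hm.symm
    · simp only [not_or, Bool.not_eq_false, not_not] at hc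
      obtain ⟨rfl, rfl⟩ := hc
      have : StarPath.replaceFlagged w v ((w, true) :: l) = (v, true) :: l := by
        have := replaceFlagged_of_notMem (c := w) (v := v)
          (fun h => hwl (mem_values_of_mem_flagged h))
        simp only [StarPath.replaceFlagged] at this ⊢
        simp [this]
      rw [this, valid_cons]
      exact ⟨h0, hv.2, hl⟩

/-- The effect of an arriving unflagged value. -/
def arrive (v : ℤ) (l : List (ℤ × Bool)) : List (ℤ × Bool) :=
  if maxFlagged l < v then l else replaceFlagged (maxFlagged l) v l

/-- The flag of the arriving value matters for the count alone; what the arrival does to the later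
values is the same with and without it. -/
theorem discards_cons (v : ℤ) (b : Bool) (l : List (ℤ × Bool)) :
    discards ((v, b) :: l) =
      (if maxFlagged l < v then b.toNat else 0) + discards (arrive v l) := by
  rw [discards, arrive]
  split_ifs <;> simp

theorem discards_nil : discards [] = 0 := by rw [discards]

/-- Here `d` is the runner-up among the flagged values, or the default `-1`. It is what decides the
second of two consecutive arrivals. -/
theorem exists_maxFlagged_replaceFlagged {l : List (ℤ × Bool)} (hc : 0 ≤ maxFlagged l) :
    ∃ d, -1 ≤ d ∧ d < maxFlagged l ∧ (∀ x ∈ flagged l, x = maxFlagged l ∨ x ≤ d) ∧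
      (d = -1 ∨ d ∈ flagged l) ∧
      ∀ v, -1 ≤ v → maxFlagged (replaceFlagged (maxFlagged l) v l) = max v d := by
  have hmem : maxFlagged l ∈ flagged l := maxFlagged_mem (by omega)
  set c := maxFlagged l with hcdef
  let l' := l.filter fun x => decide (x.1 ≠ c)
  have hfl : ∀ x, x ∈ flagged l' ↔ x ∈ flagged l ∧ x ≠ c := by
    intro x; simp [mem_flagged, l']
  have hd : ∀ x ∈ flagged l, x = c ∨ x ≤ maxFlagged l' := by
    intro x hx
    by_cases h : x = c
    · exact Or.inl h
    · exact Or.inr (le_maxFlagged ((hfl x).2 ⟨hx, h⟩))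
  have hd' : maxFlagged l' = -1 ∨ maxFlagged l' ∈ flagged l ∧ maxFlagged l' ≠ c := by
    by_cases h : maxFlagged l' = -1
    · exact Or.inl h
    · exact Or.inr ((hfl _).1 (maxFlagged_mem h))
  have hlt : maxFlagged l' < c := by
    rcases hd' with h | ⟨h1, h2⟩
    · omega
    · exact lt_of_le_of_ne (le_maxFlagged h1) h2
  refine ⟨maxFlagged l', neg_one_le_maxFlagged _, hlt, hd, hd'.imp id (·.1), fun v hv => ?_⟩
  apply maxFlagged_eq
  · exact le_max_of_le_left hv
  · intro x hx
    simp only [replaceFlagged, flagged_mapFlagged, List.mem_map] at hx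
    obtain ⟨y, hy, rfl⟩ := hx
    split_ifs with h
    · exact le_max_left _ _
    · exact le_max_of_le_right ((hd y hy).resolve_left h)
  · right
    simp only [replaceFlagged, flagged_mapFlagged, List.mem_map]
    by_cases hvd : maxFlagged l' ≤ v
    · exact ⟨c, hmem, by simp [hvd]⟩
    · rcases hd' with h | ⟨h1, h2⟩
      · omega
      · exact ⟨_, h1, by rw [if_neg h2, max_eq_right (by omega)]⟩

/-- Exchanges the flagged values `a` and `b`. -/
def exchangeFlagged (a b : ℤ) (l : List (ℤ × Bool)) : List (ℤ × Bool) :=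
  mapFlagged (Equiv.swap a b) l

theorem exchangeFlagged_comm (a b : ℤ) : exchangeFlagged a b = exchangeFlagged b a := by
  funext l; rw [exchangeFlagged, exchangeFlagged, Equiv.swap_comm]

theorem maxFlagged_exchangeFlagged {a b : ℤ} {l : List (ℤ × Bool)} (ha : a ∈ flagged l)
    (hb : b ∈ flagged l) : maxFlagged (exchangeFlagged a b l) = maxFlagged l := by
  apply maxFlagged_eq (neg_one_le_maxFlagged l)
  · intro v hv
    simp only [exchangeFlagged, flagged_mapFlagged, List.mem_map] at hv
    obtain ⟨w, hw, rfl⟩ := hv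
    by_cases h1 : w = a
    · subst h1; rw [Equiv.swap_apply_left]; exact le_maxFlagged hb
    · by_cases h2 : w = b
      · subst h2; rw [Equiv.swap_apply_right]; exact le_maxFlagged ha
      · rw [Equiv.swap_apply_of_ne_of_ne h1 h2]; exact le_maxFlagged hw
  · by_cases h : maxFlagged l = -1
    · exact Or.inl h
    · right
      have hm := maxFlagged_mem h
      simp only [exchangeFlagged, flagged_mapFlagged, List.mem_map]
      refine ⟨Equiv.swap a b (maxFlagged l), ?_, Equiv.swap_apply_self ..⟩
      by_cases h1 : maxFlagged l = a
      · rw [h1, Equiv.swap_apply_left]; exact hb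
      · by_cases h2 : maxFlagged l = b
        · rw [h2, Equiv.swap_apply_right]; exact ha
        · rw [Equiv.swap_apply_of_ne_of_ne h1 h2]; exact hm

/-- If both `a` and `b` are below the maximum of `l`, either head discards this maximum and the
exchange survives in a list as short as `l`, to which `ih` applies. In every other case the two
lists coincide after one arrival, and the counts differ at most by the contribution of the head. -/
theorem discards_exchange_head {a b : ℤ} {l : List (ℤ × Bool)} (hl : Valid l) (h0 : 0 ≤ a)
    (ha : a ∉ l.map Prod.fst) (hb : b ∈ flagged l)
    (ih : ∀ l' a' b', l'.length = l.length → Valid l' → a' ∈ flagged l' → b' ∈ flagged l' →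
      |(discards l' : ℤ) - discards (exchangeFlagged a' b' l')| ≤ 1) :
    |(discards ((a, true) :: l) : ℤ) - discards (exchangeFlagged a b ((a, true) :: l))| ≤ 1 := by
  have haf : a ∉ flagged l := fun h => ha (mem_values_of_mem_flagged h)
  have hne : a ≠ b := fun h => haf (h ▸ hb)
  have hbc := le_maxFlagged hb
  have hb0 : 0 ≤ b := hl.2 b (mem_values_of_mem_flagged hb)
  have hrepl : exchangeFlagged a b l = replaceFlagged b a l := by
    apply mapFlagged_congr
    intro v hv
    have : v ≠ a := fun h => haf (h ▸ hv)
    split_ifs with h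
    · rw [h, Equiv.swap_apply_right]
    · exact Equiv.swap_apply_of_ne_of_ne this h
  have hex : exchangeFlagged a b ((a, true) :: l) = (b, true) :: replaceFlagged b a l := by
    rw [← hrepl]; simp [exchangeFlagged]
  obtain ⟨d, hd1, hdc, hd2, hd3, hd⟩ := exists_maxFlagged_replaceFlagged (l := l) (by omega)
  have hcmem : maxFlagged l ∈ flagged l := maxFlagged_mem (by omega)
  have hac : a ≠ maxFlagged l := fun h => haf (h ▸ hcmem)
  rw [hex, discards_cons, discards_cons]
  by_cases hbc' : b = maxFlagged l
  · -- `b` is the maximum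
    have hm : maxFlagged (replaceFlagged b a l) = max a d := by rw [hbc']; exact hd a (by omega)
    by_cases h : a < b
    · have h1 : maxFlagged (replaceFlagged b a l) < b := by rw [hm]; simp; omega
      rw [if_neg (by omega), if_pos h1, arrive, arrive, if_neg (by omega), if_pos h1, ← hbc']
      simp
    · have h1 : ¬ maxFlagged (replaceFlagged b a l) < b := by rw [hm]; simp; omega
      have h2 : max a d = a := by omega
      rw [if_pos (by omega), if_neg h1, arrive, arrive, if_pos (by omega), if_neg h1, hm, h2]
      have : replaceFlagged a b (replaceFlagged b a l) = l := by
        simp only [replaceFlagged]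
        rw [mapFlagged_mapFlagged]
        conv_rhs => rw [← mapFlagged_id l]
        apply mapFlagged_congr
        intro v hv
        have : v ≠ a := fun h => haf (h ▸ hv)
        simp only [Function.comp_apply, id]
        split_ifs with h1 h2 <;> simp_all
      rw [this]; simp
  · have hbc2 : b < maxFlagged l := lt_of_le_of_ne hbc hbc'
    by_cases h : a < maxFlagged l
    · have hm : maxFlagged (replaceFlagged b a l) = maxFlagged l := by
        apply maxFlagged_eq (by omega)
        · intro v hv
          simp only [replaceFlagged, flagged_mapFlagged, List.mem_map] at hv
          obtain ⟨w, hw, rfl⟩ := hv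
          split_ifs
          · omega
          · exact le_maxFlagged hw
        · right
          simp only [replaceFlagged, flagged_mapFlagged, List.mem_map]
          exact ⟨_, hcmem, if_neg (by omega)⟩
      rw [if_neg (by omega), if_neg (by omega), arrive, arrive, if_neg (by omega),
        if_neg (by omega), hm]
      have hx : replaceFlagged (maxFlagged l) b (replaceFlagged b a l) =
          exchangeFlagged a b (replaceFlagged (maxFlagged l) a l) := by
        simp only [replaceFlagged, exchangeFlagged]
        rw [mapFlagged_mapFlagged, mapFlagged_mapFlagged]
        apply mapFlagged_congr
        intro v hv
        have : v ≠ a := fun h => haf (h ▸ hv)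
        simp only [Function.comp_apply]
        by_cases h1 : v = b
        · subst h1
          rw [if_pos rfl, if_neg (by omega), if_neg (by omega), Equiv.swap_apply_right]
        · rw [if_neg h1]
          by_cases h2 : v = maxFlagged l
          · rw [if_pos h2, if_pos h2, Equiv.swap_apply_left]
          · rw [if_neg h2, if_neg h2, Equiv.swap_apply_of_ne_of_ne this h1]
      rw [hx]
      have := ih (replaceFlagged (maxFlagged l) a l) a b (by simp) (hl.replaceFlagged h0 ha)
        (by
          simp only [replaceFlagged, flagged_mapFlagged, List.mem_map]
          exact ⟨_, hcmem, if_pos rfl⟩)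
        (by
          simp only [replaceFlagged, flagged_mapFlagged, List.mem_map]
          exact ⟨_, hb, if_neg (by omega)⟩)
      simpa using this
    · have hm : maxFlagged (replaceFlagged b a l) = a := by
        apply maxFlagged_eq (by omega)
        · intro v hv
          simp only [replaceFlagged, flagged_mapFlagged, List.mem_map] at hv
          obtain ⟨w, hw, rfl⟩ := hv
          have := le_maxFlagged hw
          split_ifs
          · omega
          · omega
        · right
          simp only [replaceFlagged, flagged_mapFlagged, List.mem_map]
          exact ⟨_, hb, if_pos rfl⟩
      rw [if_pos (by omega), if_neg (by omega), arrive, arrive, if_pos (by omega),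
        if_neg (by omega), hm]
      have : replaceFlagged a b (replaceFlagged b a l) = l := by
        simp only [replaceFlagged]
        rw [mapFlagged_mapFlagged]
        conv_rhs => rw [← mapFlagged_id l]
        apply mapFlagged_congr
        intro v hv
        have : v ≠ a := fun h => haf (h ▸ hv)
        simp only [Function.comp_apply, id]
        split_ifs with h1 h2 <;> simp_all
      rw [this]; simp

/-- Exchanging two flagged values changes the number of discards by at most one. -/
theorem abs_discards_exchangeFlagged_le (l : List (ℤ × Bool)) (a b : ℤ) (hl : Valid l)
    (ha : a ∈ flagged l) (hb : b ∈ flagged l) :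
    |(discards l : ℤ) - discards (exchangeFlagged a b l)| ≤ 1 := by
  induction hn : l.length generalizing l a b with
  | zero => simp [List.length_eq_zero_iff.1 hn] at ha
  | succ n ih =>
    by_cases hab : a = b
    · subst hab
      have : exchangeFlagged a a l = l := by
        rw [exchangeFlagged, Equiv.swap_self]; exact mapFlagged_id l
      simp [this]
    obtain _ | ⟨⟨v, t⟩, l⟩ := l
    · simp at ha
    simp only [List.length_cons, Nat.add_right_cancel_iff] at hn
    obtain ⟨h0, hv, hl'⟩ := valid_cons.1 hl
    have hvf : v ∉ flagged l := fun h => hv (mem_values_of_mem_flagged h)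
    by_cases hva : t = true ∧ v = a
    · obtain ⟨rfl, rfl⟩ := hva
      have hb' : b ∈ flagged l := by
        simp only [flagged_cons_true, List.mem_cons] at hb
        exact hb.resolve_left (Ne.symm hab)
      exact discards_exchange_head hl' h0 hv hb' fun l' a' b' h h1 h2 h3 =>
        ih l' a' b' h1 h2 h3 (h.trans hn)
    by_cases hvb : t = true ∧ v = b
    · obtain ⟨rfl, rfl⟩ := hvb
      have ha' : a ∈ flagged l := by
        simp only [flagged_cons_true, List.mem_cons] at ha
        exact ha.resolve_left hab
      rw [exchangeFlagged_comm]
      exact discards_exchange_head hl' h0 hv ha' fun l' a' b' h h1 h2 h3 =>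
        ih l' a' b' h1 h2 h3 (h.trans hn)
    have ha' : a ∈ flagged l := by
      cases t
      · simpa using ha
      · simp only [flagged_cons_true, List.mem_cons] at ha
        exact ha.resolve_left fun h => hva ⟨rfl, h.symm⟩
    have hb' : b ∈ flagged l := by
      cases t
      · simpa using hb
      · simp only [flagged_cons_true, List.mem_cons] at hb
        exact hb.resolve_left fun h => hvb ⟨rfl, h.symm⟩
    have hva' : v ≠ a := fun h => hvf (h ▸ ha')
    have hvb' : v ≠ b := fun h => hvf (h ▸ hb')
    have hex : exchangeFlagged a b ((v, t) :: l) = (v, t) :: exchangeFlagged a b l := by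
      cases t
      · rfl
      · simp [exchangeFlagged, Equiv.swap_apply_of_ne_of_ne hva' hvb']
    have hm := maxFlagged_exchangeFlagged ha' hb'
    rw [hex, discards_cons, discards_cons, arrive, arrive, hm]
    by_cases h : maxFlagged l < v
    · simpa [h] using ih l a b hl' ha' hb' hn
    · simp only [if_neg h]
      set c := maxFlagged l with hc
      -- If the discarded maximum `c` is itself one of the exchanged values, then `v` inherits its
      -- role in the exchange.
      have hx : replaceFlagged c v (exchangeFlagged a b l) =
          exchangeFlagged (if a = c then v else a) (if b = c then v else b)
            (replaceFlagged c v l) := by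
        simp only [replaceFlagged, exchangeFlagged]
        rw [mapFlagged_mapFlagged, mapFlagged_mapFlagged]
        apply mapFlagged_congr
        intro w hw
        have hwv : w ≠ v := fun h => hvf (h ▸ hw)
        simp only [Function.comp_apply, Equiv.swap_apply_def]
        grind
      rw [hx]
      simpa using ih (replaceFlagged c v l) _ _ (hl'.replaceFlagged h0 hv)
        (by
          simp only [replaceFlagged, flagged_mapFlagged, List.mem_map]
          exact ⟨a, ha', rfl⟩)
        (by
          simp only [replaceFlagged, flagged_mapFlagged, List.mem_map]
          exact ⟨b, hb', rfl⟩) (by simpa using hn)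

end StarPath

/-! ### Exchanging adjacent arrivals. -/

namespace StarPath

theorem replaceFlagged_replaceFlagged_self {a c w : ℤ} {l : List (ℤ × Bool)}
    (ha : a ∉ flagged l) :
    replaceFlagged a w (replaceFlagged c a l) = replaceFlagged c w l := by
  simp only [replaceFlagged, mapFlagged_mapFlagged]
  apply mapFlagged_congr
  intro v hv
  have : v ≠ a := fun h => ha (h ▸ hv)
  simp only [Function.comp_apply]
  split_ifs <;> simp_all

/-- The newcomers `a` and `b` occupy the places of `c` and `d` on both sides; only the assignment of
places differs. -/
theorem replaceFlagged_twice_eq_exchange {a b c d : ℤ} {l : List (ℤ × Bool)}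
    (ha : a ∉ flagged l) (hb : b ∉ flagged l) (had : a ≠ d) (hbd : b ≠ d) :
    replaceFlagged d a (replaceFlagged c b l) =
      exchangeFlagged a b (replaceFlagged d b (replaceFlagged c a l)) := by
  simp only [replaceFlagged, exchangeFlagged, mapFlagged_mapFlagged]
  apply mapFlagged_congr
  intro v hv
  have h1 : v ≠ a := fun h => ha (h ▸ hv)
  have h2 : v ≠ b := fun h => hb (h ▸ hv)
  simp only [Function.comp_apply, Equiv.swap_apply_def]
  grind

theorem mem_flagged_replaceFlagged {c v x : ℤ} {l : List (ℤ × Bool)} :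
    x ∈ flagged (replaceFlagged c v l) ↔ (x = v ∧ c ∈ flagged l) ∨ (x ∈ flagged l ∧ x ≠ c) := by
  simp only [replaceFlagged, flagged_mapFlagged, List.mem_map]
  constructor
  · rintro ⟨y, hy, rfl⟩
    split_ifs with h
    · exact Or.inl ⟨rfl, h ▸ hy⟩
    · exact Or.inr ⟨hy, h⟩
  · rintro (⟨rfl, h⟩ | ⟨h, h'⟩)
    · exact ⟨c, h, if_pos rfl⟩
    · exact ⟨x, h, if_neg h'⟩

/-- Two replacements of the maximum by `a` and `b`, in either order, give the same list or lists
that differ by an exchange. -/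
theorem abs_discards_arrive_arrive_le {a b : ℤ} {l : List (ℤ × Bool)} (hl : Valid l)
    (ha0 : 0 ≤ a) (hb0 : 0 ≤ b) (hab : a < b) (ha : a ∉ l.map Prod.fst)
    (hb : b ∉ l.map Prod.fst) :
    |(discards (arrive a (arrive b l)) : ℤ) - discards (arrive b (arrive a l))| ≤ 1 ∧
      (maxFlagged l < b ∨ maxFlagged (arrive a l) < b →
        arrive a (arrive b l) = arrive b (arrive a l)) := by
  have haf : a ∉ flagged l := fun h => ha (mem_values_of_mem_flagged h)
  have hbf : b ∉ flagged l := fun h => hb (mem_values_of_mem_flagged h)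
  by_cases hc : maxFlagged l < b
  · have h1 : arrive b l = l := if_pos hc
    have h2 : arrive b (arrive a l) = arrive a l := by
      refine if_pos ?_
      unfold arrive
      split_ifs with h
      · exact hc
      · obtain ⟨d, hd1, hdc, -, -, hd⟩ := exists_maxFlagged_replaceFlagged (l := l) (by omega)
        rw [hd a (by omega)]
        omega
    rw [h1, h2]
    simp
  obtain ⟨d, hd1, hdc, hdle, hdm, hd⟩ := exists_maxFlagged_replaceFlagged (l := l) (by omega)
  have hcm : maxFlagged l ∈ flagged l := maxFlagged_mem (by omega)
  have hbc : b ≠ maxFlagged l := fun h => hbf (h ▸ hcm)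
  have h1 : arrive b l = replaceFlagged (maxFlagged l) b l := if_neg (by omega)
  have h2 : arrive a l = replaceFlagged (maxFlagged l) a l := if_neg (by omega)
  have hda := hd a (by omega)
  have hdb := hd b (by omega)
  have h3 : arrive a (arrive b l) =
      replaceFlagged (max b d) a (replaceFlagged (maxFlagged l) b l) := by
    rw [h1, arrive, if_neg (by omega), hdb]
  -- If the runner-up is below `b`, then `b` is either discarded again by `a` or discarded on
  -- arrival, so both orders just put `a` in place of the maximum. Otherwise `a` and `b` take the
  -- places of the maximum and of the runner-up, in opposite ways.
  by_cases hbd : d < b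
  · have h4 : arrive b (arrive a l) = replaceFlagged (maxFlagged l) a l := by
      rw [h2, arrive, if_pos (by omega)]
    rw [h3, h4, max_eq_left hbd.le, replaceFlagged_replaceFlagged_self hbf]
    simp
  · have hdf : d ∈ flagged l := hdm.resolve_left (by omega)
    have hne : b ≠ d := fun h => hbf (h ▸ hdf)
    have h4 : arrive b (arrive a l) =
        replaceFlagged d b (replaceFlagged (maxFlagged l) a l) := by
      rw [h2, arrive, if_neg (by omega), hda, max_eq_right (by omega)]
    rw [h3, h4, max_eq_right (by omega),
      replaceFlagged_twice_eq_exchange haf hbf (by omega) hne]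
    refine ⟨?_, by rw [h2, hda]; omega⟩
    rw [abs_sub_comm]
    have hv1 : Valid (replaceFlagged (maxFlagged l) a l) := hl.replaceFlagged ha0 ha
    have hv2 : Valid (replaceFlagged d b (replaceFlagged (maxFlagged l) a l)) := by
      apply hv1.replaceFlagged hb0
      intro h
      rcases mem_values_replaceFlagged h with h | h
      · exact hb h
      · omega
    apply abs_discards_exchangeFlagged_le _ _ _ hv2
    · rw [mem_flagged_replaceFlagged]
      right
      exact ⟨by rw [mem_flagged_replaceFlagged]; exact Or.inl ⟨rfl, hcm⟩, by omega⟩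
    · rw [mem_flagged_replaceFlagged]
      left
      exact ⟨rfl, by rw [mem_flagged_replaceFlagged]; exact Or.inr ⟨hdf, hdc.ne⟩⟩

theorem maxFlagged_replaceFlagged_of_lt {l : List (ℤ × Bool)} {v b : ℤ} (h : maxFlagged l < b)
    (h' : ¬ maxFlagged l < v) (h0 : 0 ≤ v) :
    maxFlagged (replaceFlagged (maxFlagged l) v l) < b := by
  obtain ⟨d, hd1, hdc, -, -, hd⟩ := exists_maxFlagged_replaceFlagged (l := l) (by omega)
  rw [hd v (by omega)]
  omega

/-- If the unflagged `a` arrives first, it sees `b` among the later flagged values and may take its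
place before `b` arrives. The contribution of `b` and the list that remains never differ
simultaneously; in the one critical case this is the second clause of
`abs_discards_arrive_arrive_le`. -/
theorem discards_swap_unflagged_flagged {a b : ℤ} {l : List (ℤ × Bool)} (hl : Valid l)
    (ha0 : 0 ≤ a) (hb0 : 0 ≤ b) (hab : a ≠ b) (ha : a ∉ l.map Prod.fst)
    (hb : b ∉ l.map Prod.fst) :
    |(discards ((a, false) :: (b, true) :: l) : ℤ) -
      discards ((b, true) :: (a, false) :: l)| ≤ 1 := by
  have haf : a ∉ flagged l := fun h => ha (mem_values_of_mem_flagged h)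
  have hbf : b ∉ flagged l := fun h => hb (mem_values_of_mem_flagged h)
  have hf : ∀ v l, discards ((v, false) :: l) = discards (arrive v l) := by
    intro v l; rw [discards_cons]; simp
  rw [hf a, discards_cons b true, maxFlagged_cons_false]
  by_cases hbc : maxFlagged l < b
  · -- `b` is discarded on arrival in the second list
    have e2 : arrive b ((a, false) :: l) = (a, false) :: l := by
      rw [arrive, maxFlagged_cons_false, if_pos hbc]
    rw [e2, hf a, if_pos hbc]
    by_cases hba : b < a
    · have e1 : arrive a ((b, true) :: l) = (b, true) :: l := by
        rw [arrive, maxFlagged_cons_true, if_pos (by omega)]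
      rw [e1, discards_cons, if_pos hbc, arrive, arrive, if_pos hbc, if_pos (by omega)]
      simp
    · have e1 : arrive a ((b, true) :: l) = (a, true) :: l := by
        rw [arrive, maxFlagged_cons_true, if_neg (by omega), max_eq_left hbc.le]
        have := replaceFlagged_of_notMem (v := a) hbf
        simp only [replaceFlagged] at this ⊢
        simp [this]
      rw [e1, discards_cons]
      split_ifs <;> simp
  · have hcm : maxFlagged l ∈ flagged l := maxFlagged_mem (by omega)
    have hbc' : b ≠ maxFlagged l := fun h => hbf (h ▸ hcm)
    have hac' : a ≠ maxFlagged l := fun h => haf (h ▸ hcm)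
    have e2 : arrive b ((a, false) :: l) = (a, false) :: arrive b l := by
      rw [arrive, maxFlagged_cons_false, if_neg hbc, arrive, if_neg hbc]
      rfl
    rw [e2, hf a, if_neg hbc]
    by_cases hac : maxFlagged l < a
    · have e1 : arrive a ((b, true) :: l) = (b, true) :: l := by
        rw [arrive, maxFlagged_cons_true, if_pos (by omega)]
      have e3 : arrive a (arrive b l) = arrive b l := by
        refine if_pos ?_
        rw [arrive, if_neg hbc]
        exact maxFlagged_replaceFlagged_of_lt hac hbc hb0
      rw [e1, discards_cons, if_neg hbc, e3]
      simp
    · have e1 : arrive a ((b, true) :: l) = (b, true) :: arrive a l := by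
        rw [arrive, maxFlagged_cons_true, if_neg (by omega), max_eq_right (by omega), arrive,
          if_neg hac]
        simp [replaceFlagged, hbc']
      rw [e1, discards_cons]
      rcases lt_or_gt_of_ne hab with h | h
      · obtain ⟨k1, k2⟩ := abs_discards_arrive_arrive_le hl ha0 hb0 h ha hb
        split_ifs with h3
        · rw [k2 (Or.inr h3)]; simp
        · rw [abs_sub_comm]; simpa using k1
      · obtain ⟨k1, k2⟩ := abs_discards_arrive_arrive_le hl hb0 ha0 h hb ha
        have h3 : ¬ maxFlagged (arrive a l) < b := by
          obtain ⟨d, hd1, hdc, -, -, hd⟩ :=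
            exists_maxFlagged_replaceFlagged (l := l) (by omega)
          rw [arrive, if_neg hac, hd a (by omega)]
          omega
        rw [if_neg h3]
        simpa using k1

/-- Exchanging two adjacent arrivals changes the number of discards by at most one. -/
theorem abs_discards_swap_le (pre : List (ℤ × Bool)) (x y : ℤ × Bool) (post : List (ℤ × Bool))
    (hl : Valid (pre ++ x :: y :: post)) :
    |(discards (pre ++ x :: y :: post) : ℤ) - discards (pre ++ y :: x :: post)| ≤ 1 := by
  induction hn : pre.length generalizing pre x y post with
  | zero =>
    obtain rfl := List.length_eq_zero_iff.1 hn
    obtain ⟨a, s⟩ := x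
    obtain ⟨b, t⟩ := y
    simp only [List.nil_append] at hl ⊢
    obtain ⟨ha0, ha, hl'⟩ := valid_cons.1 hl
    obtain ⟨hb0, hb, hl''⟩ := valid_cons.1 hl'
    simp only [List.map_cons, List.mem_cons, not_or] at ha
    have hf : ∀ v l, discards ((v, false) :: l) = discards (arrive v l) := by
      intro v l; rw [discards_cons]; simp
    cases s <;> cases t
    · rw [hf a, hf b]
      have e : ∀ u w, arrive u ((w, false) :: post) = (w, false) :: arrive u post := by
        intro u w
        rw [arrive, maxFlagged_cons_false, arrive]
        split_ifs <;> rfl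
      rw [e, e, hf, hf]
      rcases lt_or_gt_of_ne ha.1 with h | h
      · rw [abs_sub_comm]
        exact (abs_discards_arrive_arrive_le hl'' ha0 hb0 h ha.2 hb).1
      · exact (abs_discards_arrive_arrive_le hl'' hb0 ha0 h hb ha.2).1
    · exact discards_swap_unflagged_flagged hl'' ha0 hb0 ha.1 ha.2 hb
    · rw [abs_sub_comm]
      exact discards_swap_unflagged_flagged hl'' hb0 ha0 (Ne.symm ha.1) hb ha.2
    · have hx : (b, true) :: (a, true) :: post =
          exchangeFlagged a b ((a, true) :: (b, true) :: post) := by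
        have : exchangeFlagged a b post = post := by
          conv_rhs => rw [← mapFlagged_id post]
          apply mapFlagged_congr
          intro v hv
          exact Equiv.swap_apply_of_ne_of_ne
            (fun h => ha.2 (h ▸ mem_values_of_mem_flagged hv))
            (fun h => hb (h ▸ mem_values_of_mem_flagged hv))
        rw [exchangeFlagged] at this ⊢
        simp [this]
      rw [hx]
      exact abs_discards_exchangeFlagged_le _ a b hl (by simp) (by simp)
  | succ n ih =>
    obtain _ | ⟨⟨v, s⟩, pre⟩ := pre
    · simp at hn
    simp only [List.length_cons, Nat.add_right_cancel_iff] at hn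
    simp only [List.cons_append] at hl ⊢
    obtain ⟨h0, hv, hl'⟩ := valid_cons.1 hl
    have hm : maxFlagged (pre ++ y :: x :: post) = maxFlagged (pre ++ x :: y :: post) := by
      have hmem : ∀ w, w ∈ flagged (pre ++ y :: x :: post) ↔
          w ∈ flagged (pre ++ x :: y :: post) := by
        intro w; simp only [mem_flagged, List.mem_append, List.mem_cons]; tauto
      apply maxFlagged_eq (neg_one_le_maxFlagged _)
      · intro w hw
        exact le_maxFlagged ((hmem w).1 hw)
      · by_cases h : maxFlagged (pre ++ x :: y :: post) = -1
        · exact Or.inl h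
        · exact Or.inr ((hmem _).2 (maxFlagged_mem h))
    rw [discards_cons, discards_cons, arrive, arrive, hm]
    split_ifs with h
    · simpa using ih pre x y post hl' hn
    · have hr := hl'.replaceFlagged (c := maxFlagged (pre ++ x :: y :: post)) h0 hv
      simp only [replaceFlagged, mapFlagged, List.map_append, List.map_cons] at hr ⊢
      simpa using ih _ _ _ _ hr (by simpa using hn)

/-- An unflagged arrival that exceeds all earlier values and all flagged values is irrelevant. -/
theorem discards_erase (k : ℤ) (pre post : List (ℤ × Bool)) (hk : 0 ≤ k)
    (hpre : ∀ v ∈ pre.map Prod.fst, v < k) (hpost : ∀ v ∈ flagged post, v < k) :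
    discards (pre ++ (k, false) :: post) = discards (pre ++ post) := by
  induction hn : pre.length generalizing pre post with
  | zero =>
    obtain rfl := List.length_eq_zero_iff.1 hn
    have : maxFlagged post < k := by
      have := maxFlagged_le (c := k - 1) (by omega) fun v hv => by have := hpost v hv; omega
      omega
    simp only [List.nil_append]
    rw [discards_cons, arrive, if_pos this, if_pos this]
    simp
  | succ n ih =>
    obtain _ | ⟨⟨v, s⟩, pre⟩ := pre
    · simp at hn
    simp only [List.length_cons, Nat.add_right_cancel_iff] at hn
    simp only [List.map_cons, List.forall_mem_cons] at hpre
    simp only [List.cons_append]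
    have hm : maxFlagged (pre ++ (k, false) :: post) = maxFlagged (pre ++ post) := by
      simp [maxFlagged]
    rw [discards_cons, discards_cons, arrive, arrive, hm]
    split_ifs with h
    · rw [ih pre post hpre.2 hpost hn]
    · simp only [replaceFlagged, mapFlagged_append, mapFlagged_cons_false]
      rw [ih]
      · intro w hw
        rcases mem_values_replaceFlagged (l := pre) hw with h | h
        · exact hpre.2 w h
        · exact h ▸ hpre.1
      · intro w hw
        rcases mem_flagged_replaceFlagged.1 hw with h | h
        · exact h.1 ▸ hpre.1
        · exact hpost w h.1
      · simpa using hn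

end StarPath

namespace StarPath

/-! ### Resolving tokens along the leaves -/

/-- The token `z` resolves to the nonnegative token `y`: starting with `z`, and passing from a
negative token to the token on its goal vertex, `y` is the first nonnegative token. -/
inductive Resolves {m : ℕ} (L : Fin m → ℤ) : ℤ → ℤ → Prop
  | nonneg (z : ℤ) (h : 0 ≤ z) : Resolves L z z
  | step (p : Fin m) (y : ℤ) (h : Resolves L (L p) y) : Resolves L (-((p : ℤ) + 1)) y

/-- `l` lists the values to which the tokens in `j` resolve, flagged if the token is negative. -/
def ResolvesList {m : ℕ} (L : Fin m → ℤ) (j : List ℤ) (l : List (ℤ × Bool)) : Prop :=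
  List.Forall₂ (fun z x => x.2 = decide (z < 0) ∧ Resolves L z x.1) j l

variable {m : ℕ} {L : Fin m → ℤ}

theorem Resolves.le {z y : ℤ} (h : Resolves L z y) : 0 ≤ y := by
  induction h with
  | nonneg z h => exact h
  | step p y h ih => exact ih

theorem Resolves.eq_of_nonneg {z y : ℤ} (h : Resolves L z y) (hz : 0 ≤ z) : y = z := by
  cases h with
  | nonneg z h => rfl
  | step p y h => omega

theorem Resolves.of_leaf {p : Fin m} {y : ℤ} (h : Resolves L (-((p : ℤ) + 1)) y) :
    Resolves L (L p) y := by
  generalize hz : -((p : ℤ) + 1) = z at h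
  cases h with
  | nonneg z h => omega
  | step q y h =>
    have : p = q := by apply Fin.ext; omega
    exact this ▸ h

theorem Resolves.exists_leaf {z y : ℤ} (h : Resolves L z y) (hz : z < 0) :
    ∃ p : Fin m, z = -((p : ℤ) + 1) ∧ Resolves L (L p) y := by
  cases h with
  | nonneg z h => omega
  | step p y h => exact ⟨p, rfl, h⟩

theorem Resolves.unique {z y y' : ℤ} (h : Resolves L z y) (h' : Resolves L z y') : y = y' := by
  induction h with
  | nonneg z h => exact (h'.eq_of_nonneg h).symm
  | step p y h ih => exact ih h'.of_leaf

theorem Resolves.mem_range {z y : ℤ} (h : Resolves L z y) (hz : z < 0) : ∃ p, L p = y := by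
  induction h with
  | nonneg z h => omega
  | step p y h ih =>
    by_cases h0 : L p < 0
    · exact ih h0
    · exact ⟨p, (h.eq_of_nonneg (by omega)).symm⟩

/-- Distinct tokens off the leaves resolve to distinct tokens. -/
theorem Resolves.injective (hL : Function.Injective L) {z z' y : ℤ} (h : Resolves L z y)
    (h' : Resolves L z' y) (hz : ∀ p, L p ≠ z) (hz' : ∀ p, L p ≠ z') : z = z' := by
  -- The two resolutions are unrolled into explicit chains. Since `L` is injective, chains with a
  -- common end can be compared backwards, entry by entry.
  have key : ∀ {z y : ℤ}, Resolves L z y → ∃ k : ℕ, ∃ u : ℕ → ℤ, u 0 = z ∧ u k = y ∧ 0 ≤ y ∧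
      ∀ i < k, ∃ p : Fin m, u i = -((p : ℤ) + 1) ∧ L p = u (i + 1) := by
    intro z y h
    induction h with
    | nonneg z h => exact ⟨0, fun _ => z, rfl, rfl, h, by simp⟩
    | step p y h ih =>
      obtain ⟨k, u, h0, hk, hy, hu⟩ := ih
      refine ⟨k + 1, fun i => if i = 0 then -((p : ℤ) + 1) else u (i - 1), by simp, by simpa,
        hy, fun i hi => ?_⟩
      rcases i with _ | i
      · exact ⟨p, by simp, by simp [h0]⟩
      · simpa using hu i (by omega)
  obtain ⟨k, u, h0, hk, hy, hu⟩ := key h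
  obtain ⟨k', u', h0', hk', hy', hu'⟩ := key h'
  clear h h'
  wlog hle : k ≤ k' generalizing z z' k k' u u'
  · exact (this hz' hz k' u' h0' hk' hu' k u h0 hk hu (by omega)).symm
  have hback : ∀ i ≤ k, u (k - i) = u' (k' - i) := by
    intro i hi
    induction i with
    | zero => simpa using hk.trans hk'.symm
    | succ i ih =>
      obtain ⟨p, hp, hp2⟩ := hu (k - (i + 1)) (by omega)
      obtain ⟨q, hq, hq2⟩ := hu' (k' - (i + 1)) (by omega)
      rw [show k - (i + 1) + 1 = k - i by omega] at hp2
      rw [show k' - (i + 1) + 1 = k' - i by omega] at hq2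
      have : p = q := hL (by rw [hp2, hq2, ih (by omega)])
      rw [hp, hq, this]
  have hb := hback k le_rfl
  rw [Nat.sub_self, h0] at hb
  rcases Nat.eq_or_lt_of_le hle with rfl | hlt
  · rw [hb, Nat.sub_self, h0']
  -- Going back along the longer chain beyond the start of the shorter one would find `z` on a leaf.
  · exfalso
    obtain ⟨q, hq, hq2⟩ := hu' (k' - k - 1) (by omega)
    rw [show k' - k - 1 + 1 = k' - k by omega, ← hb] at hq2
    exact hz q hq2

/-- A chain can only use the leaf `p` after meeting the token `-(p + 1)`, which is neither its start
nor on a leaf. -/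
theorem Resolves.update_self {p : Fin m} {w y : ℤ} (h : Resolves L w y) (hw : w ≠ -((p : ℤ) + 1))
    (hL : ∀ q, L q ≠ -((p : ℤ) + 1)) (a : ℤ) : Resolves (Function.update L p a) w y := by
  induction h with
  | nonneg z h => exact .nonneg z h
  | step q y h ih =>
    have hqp : q ≠ p := fun h => hw (by rw [h])
    have := ih (hL q)
    rw [← Function.update_of_ne hqp a L] at this
    exact .step q y this

/-- Both `a` and `c` are nonnegative, so only the end of a chain can be affected. -/
theorem Resolves.replaceTok {w y a : ℤ} {c : ℤ} (h : Resolves L w y) (hw : w < 0) (ha : 0 ≤ a)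
    (hc : 0 ≤ c) : Resolves (replaceTok L a c) w (if y = c then a else y) := by
  induction h with
  | nonneg z h => omega
  | step p y h ih =>
    apply Resolves.step
    by_cases h0 : L p < 0
    · have : StarPath.replaceTok L a c p = L p := by
        rw [StarPath.replaceTok, if_neg]
        exact fun h => by have := WithBot.coe_inj.1 h; omega
      rw [this]
      exact ih h0
    · obtain rfl := h.eq_of_nonneg (by omega)
      have : StarPath.replaceTok L a c p = if L p = c then a else L p := by
        simp only [StarPath.replaceTok, WithBot.coe_inj]
      rw [this]
      apply Resolves.nonneg
      split_ifs
      · exact ha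
      · omega

theorem coe_le_maxTok (L : Fin m → ℤ) (p : Fin m) : (L p : WithBot ℤ) ≤ maxTok L :=
  Finset.le_sup (f := fun p => (L p : WithBot ℤ)) (Finset.mem_univ p)

theorem maxTok_lt_zero_iff : maxTok L < 0 ↔ ∀ p, L p < 0 := by
  rw [maxTok, Finset.sup_lt_iff (by exact WithBot.bot_lt_coe 0)]
  simp only [Finset.mem_univ, true_imp_iff]
  exact forall_congr' fun p => by exact_mod_cast Iff.rfl

theorem maxTok_lt_iff {a : ℤ} : maxTok L < a ↔ ∀ p, L p < a := by
  rw [maxTok, Finset.sup_lt_iff (WithBot.bot_lt_coe a)]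
  simp

theorem maxTok_eq {c : ℤ} (h : ∀ p, L p ≤ c) (h' : ∃ p, L p = c) : maxTok L = c := by
  obtain ⟨p, rfl⟩ := h'
  refine le_antisymm (Finset.sup_le fun q _ => WithBot.coe_le_coe.2 (h q)) (coe_le_maxTok L p)

/-- The nonnegative tokens on the leaves are the flagged values of `l`. -/
def Covers (L : Fin m → ℤ) (l : List (ℤ × Bool)) : Prop := ∀ p, 0 ≤ L p → L p ∈ flagged l

theorem ResolvesList.of_mem_flagged {j : List ℤ} {l : List (ℤ × Bool)} (h : ResolvesList L j l)
    {v : ℤ} (hv : v ∈ flagged l) : ∃ z ∈ j, z < 0 ∧ Resolves L z v := by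
  rw [mem_flagged] at hv
  obtain ⟨z, hz, h1, h2⟩ : ∃ z ∈ j, true = decide (z < 0) ∧ Resolves L z v := by
    induction h with
    | nil => simp at hv
    | cons h1 h2 ih =>
      rcases List.mem_cons.1 hv with h | h
      · subst h; exact ⟨_, by simp, h1⟩
      · obtain ⟨z, hz, h⟩ := ih h
        exact ⟨z, by simp [hz], h⟩
  exact ⟨z, hz, by simpa using h1, h2⟩

/-- Flagged values lie on leaves because a negative token resolves to a token on a leaf; with
`Covers`, the two maxima range over the same nonnegative tokens. -/
theorem maxTok_eq_maxFlagged {j : List ℤ} {l : List (ℤ × Bool)} (h : ResolvesList L j l)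
    (hc : Covers L l) (h0 : ¬ maxTok L < 0) : 0 ≤ maxFlagged l ∧ maxTok L = maxFlagged l := by
  rw [maxTok_lt_zero_iff] at h0
  push Not at h0
  obtain ⟨p, hp⟩ := h0
  have h1 : 0 ≤ maxFlagged l := hp.trans (le_maxFlagged (hc p hp))
  refine ⟨h1, maxTok_eq (fun q => ?_) ?_⟩
  · by_cases hq : 0 ≤ L q
    · exact le_maxFlagged (hc q hq)
    · omega
  · obtain ⟨z, -, hz, hr⟩ := h.of_mem_flagged (maxFlagged_mem (l := l) (by omega))
    exact hr.mem_range hz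

theorem discards_eq_zero {l : List (ℤ × Bool)} (h : flagged l = []) : discards l = 0 := by
  induction l with
  | nil => exact discards_nil
  | cons x l ih =>
    obtain ⟨v, b⟩ := x
    cases b
    · simp only [flagged_cons_false] at h
      rw [discards_cons, arrive]
      split_ifs
      · simp [ih h]
      · rw [replaceFlagged_of_notMem (by simp [h])]
        simp [ih h]
    · simp at h

theorem discount_of_neg (h : maxTok L < 0) (j : List ℤ) : discount L j = 0 := by
  cases j with
  | nil => rw [discount]
  | cons a j => rw [discount, dif_pos h]

/-- The effect of sending the first token to its goal vertex. -/
theorem resolvesList_home {p : Fin m} {v : ℤ} {j : List ℤ} {l : List (ℤ × Bool)}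
    (hL : Function.Injective L) (hj : (-((p : ℤ) + 1) :: j).Nodup)
    (hd : ∀ z ∈ -((p : ℤ) + 1) :: j, ∀ q, L q ≠ z)
    (h : ResolvesList L (-((p : ℤ) + 1) :: j) ((v, true) :: l))
    (hc : Covers L ((v, true) :: l)) :
    Function.Injective (Function.update L p (-((p : ℤ) + 1))) ∧ (L p :: j).Nodup ∧
      (∀ z ∈ L p :: j, ∀ q, Function.update L p (-((p : ℤ) + 1)) q ≠ z) ∧
      ResolvesList (Function.update L p (-((p : ℤ) + 1))) (L p :: j)
        ((v, decide (L p < 0)) :: l) ∧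
      Covers (Function.update L p (-((p : ℤ) + 1))) ((v, decide (L p < 0)) :: l) := by
  have hpL : ∀ q, L q ≠ -((p : ℤ) + 1) := hd _ (by simp)
  obtain ⟨hpj, hj'⟩ := List.nodup_cons.1 hj
  obtain _ | ⟨⟨-, hr⟩, h'⟩ := h
  replace hr : Resolves L (L p) v := hr.of_leaf
  refine ⟨?_, ?_, ?_, ?_, ?_⟩
  · intro q r hqr
    by_cases hq : q = p <;> by_cases hr : r = p
    · rw [hq, hr]
    · rw [hq, Function.update_self, Function.update_of_ne hr] at hqr
      exact absurd hqr.symm (hpL r)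
    · rw [hr, Function.update_self, Function.update_of_ne hq] at hqr
      exact absurd hqr (hpL q)
    · rw [Function.update_of_ne hr, Function.update_of_ne hq] at hqr
      exact hL hqr
  · exact List.nodup_cons.2 ⟨fun hm => hd (L p) (by simp [hm]) p rfl, hj'⟩
  · intro z hz q
    by_cases hq : q = p
    · subst hq
      rw [Function.update_self]
      rintro rfl
      rcases List.mem_cons.1 hz with h | h
      · exact hpL q h.symm
      · exact hpj h
    · rw [Function.update_of_ne hq]
      rcases List.mem_cons.1 hz with h | h
      · rw [h]
        exact fun h => hq (hL h)
      · exact hd z (by simp [h]) q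
  · refine .cons ⟨rfl, hr.update_self (hpL p) hpL _⟩ ?_
    refine List.forall₂_iff_get.2 ⟨h'.length_eq, fun i h1 h2 => ?_⟩
    have := (List.forall₂_iff_get.1 h').2 i h1 h2
    refine ⟨this.1, this.2.update_self ?_ hpL _⟩
    exact fun he => hpj (he ▸ List.get_mem ..)
  · intro q hq
    have hqp : q ≠ p := by
      rintro rfl
      rw [Function.update_self] at hq
      omega
    rw [Function.update_of_ne hqp] at hq ⊢
    have := hc q hq
    rw [flagged_cons_true, List.mem_cons] at this
    by_cases h0 : L p < 0
    · simpa [h0] using this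
    -- A nonnegative token that leaves the leaf `p` is the value `v` itself. It is no longer on a
    -- leaf, which matches the loss of the flag.
    · have : L q ≠ v := by
        rw [hr.eq_of_nonneg (by omega)]
        exact fun h => hqp (hL h)
      simp only [h0, decide_false, flagged_cons_false]
      tauto

/-- The two recursions run side by side. A nonnegative head is an unflagged arrival. For a negative
head, the list keeps its values, and the head keeps its flag until a nonnegative token comes off a
leaf. The flag is lost at this moment, and it would have counted exactly if that token was the
maximum on the leaves, which is when δ subtracts one. -/
theorem discount_eq_neg_discards (L : Fin m → ℤ) (j : List ℤ) (l : List (ℤ × Bool))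
    (hL : Function.Injective L) (hj : j.Nodup) (hd : ∀ z ∈ j, ∀ p, L p ≠ z)
    (h : ResolvesList L j l) (hv : Valid l) (hc : Covers L l) :
    discount L j = -(discards l : ℤ) := by
  induction L, j using discount.induct generalizing l with
  | case1 L =>
    cases h
    rw [discount, discards_nil]
    rfl
  | case2 L a j h0 =>
    rw [discount_of_neg h0, discards_eq_zero]
    · rfl
    · rw [List.eq_nil_iff_forall_not_mem]
      intro v hv'
      obtain ⟨z, -, hz, hr⟩ := h.of_mem_flagged hv'
      obtain ⟨p, rfl⟩ := hr.mem_range hz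
      have := maxTok_lt_zero_iff.1 h0 p
      have := hr.le
      omega
  | case3 L a j h0 ha hlt ih =>
    rw [discount, dif_neg h0, if_pos ha, if_pos hlt]
    obtain _ | @⟨_, ⟨v, b⟩, _, l, ⟨hb, hr⟩, h⟩ := h
    simp only [not_lt.2 ha, decide_false] at hb
    subst hb
    obtain rfl := hr.eq_of_nonneg ha
    obtain ⟨hv0, hvl, hv⟩ := valid_cons.1 hv
    have hc' : Covers L l := fun p hp => by simpa using hc p hp
    obtain ⟨h1, h2⟩ := maxTok_eq_maxFlagged h hc' h0
    rw [h2] at hlt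
    have hlt' : maxFlagged l < v := WithBot.coe_lt_coe.1 hlt
    rw [discards_cons, arrive, if_pos hlt', if_pos hlt']
    rw [ih l hL hj.of_cons (fun z hz => hd z (by simp [hz])) h hv hc']
    simp
  | case4 L a j h0 ha hlt ih =>
    rw [discount, dif_neg h0, if_pos ha, if_neg hlt]
    obtain _ | @⟨_, ⟨v, b⟩, _, l, ⟨hb, hr⟩, h⟩ := h
    simp only [not_lt.2 ha, decide_false] at hb
    subst hb
    obtain rfl := hr.eq_of_nonneg ha
    obtain ⟨hv0, hvl, hv⟩ := valid_cons.1 hv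
    have hc' : Covers L l := fun p hp => by simpa using hc p hp
    obtain ⟨h1, h2⟩ := maxTok_eq_maxFlagged h hc' h0
    rw [h2] at hlt ih ⊢
    have hlt' : ¬ maxFlagged l < v := fun h => hlt (WithBot.coe_lt_coe.2 h)
    rw [discards_cons, arrive, if_neg hlt', if_neg hlt']
    have hval : ∀ p, replaceTok L v (maxFlagged l) p = if L p = maxFlagged l then v else L p := by
      intro p; simp only [replaceTok, WithBot.coe_inj]
    have hd0 : ∀ p, L p ≠ v := hd v (by simp)
    rw [ih (replaceFlagged (maxFlagged l) v l)]
    · simp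
    · intro p q hpq
      rw [hval, hval] at hpq
      have := hd0 p
      have := hd0 q
      apply hL
      split_ifs at hpq <;> omega
    · exact hj.of_cons
    · intro z hz p
      rw [hval]
      split_ifs
      · rintro rfl
        exact (List.nodup_cons.1 hj).1 hz
      · exact hd z (by simp [hz]) p
    · rw [ResolvesList, replaceFlagged, mapFlagged, List.forall₂_map_right_iff]
      refine List.Forall₂.imp ?_ h
      rintro z ⟨w, b⟩ ⟨hb, hr⟩
      simp only at hb hr ⊢
      by_cases hz : z < 0
      · simp only [hz, decide_true] at hb
        subst hb
        simp only [if_true, hz, decide_true, true_and]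
        exact hr.replaceTok hz ha h1
      · simp only [hz, decide_false] at hb
        subst hb
        simp only [hz, decide_false, Bool.false_eq_true, if_false, true_and]
        obtain rfl := hr.eq_of_nonneg (by omega)
        exact .nonneg _ (by omega)
    · exact hv.replaceFlagged hv0 hvl
    · intro p hp
      rw [hval] at hp ⊢
      rw [mem_flagged_replaceFlagged]
      split_ifs at hp ⊢ with hpc
      · exact Or.inl ⟨rfl, maxFlagged_mem (by omega)⟩
      · exact Or.inr ⟨hc' p hp, hpc⟩
  | case5 L a j h0 ha hp hi =>
    exact absurd hi (hd a (by simp) _)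
  | case6 L a j h0 ha hp hi hmax ih =>
    rw [discount, dif_neg h0, if_neg ha, dif_pos hp, dif_neg hi, if_pos hmax]
    set p : Fin m := ⟨(-a - 1).toNat, hp⟩ with hpdef
    have hap : a = -((p : ℤ) + 1) := by simp only [hpdef]; omega
    clear_value p
    subst hap
    obtain _ | ⟨x, l⟩ := l
    · cases h
    obtain ⟨v, b⟩ := x
    obtain rfl : b = true := by
      obtain _ | ⟨⟨hb, -⟩, -⟩ := h
      simpa only [not_le.1 ha, decide_true] using hb
    obtain ⟨h1, h2, h3, h4, h5⟩ := resolvesList_home hL hj hd h hc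
    obtain ⟨hv0, hvl, hv'⟩ := valid_cons.1 hv
    rw [ih _ h1 h2 h3 h4 (valid_cons.2 ⟨hv0, hvl, hv'⟩) h5, discards_cons, discards_cons]
    obtain ⟨hm0, hm⟩ := maxTok_eq_maxFlagged h hc h0
    rw [hm, WithBot.coe_inj] at hmax
    obtain _ | ⟨⟨-, hr⟩, -⟩ := h
    obtain rfl := hr.of_leaf.eq_of_nonneg (by omega)
    rw [maxFlagged_cons_true] at hmax
    -- Equality would mean that the value of the head occurs a second time in the list.
    have hlt : maxFlagged l < L p := by
      refine lt_of_le_of_ne (by omega) fun he => ?_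
      exact hvl (mem_values_of_mem_flagged (he ▸ maxFlagged_mem (by omega)))
    have : decide (L p < 0) = false := by simp; omega
    rw [if_pos hlt, if_pos hlt, this]
    push_cast [Bool.toNat_true, Bool.toNat_false]
    ring
  | case7 L a j h0 ha hp hi hmax ih =>
    rw [discount, dif_neg h0, if_neg ha, dif_pos hp, dif_neg hi, if_neg hmax]
    set p : Fin m := ⟨(-a - 1).toNat, hp⟩ with hpdef
    have hap : a = -((p : ℤ) + 1) := by simp only [hpdef]; omega
    clear_value p
    subst hap
    obtain _ | ⟨x, l⟩ := l
    · cases h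
    obtain ⟨v, b⟩ := x
    obtain rfl : b = true := by
      obtain _ | ⟨⟨hb, -⟩, -⟩ := h
      simpa only [not_le.1 ha, decide_true] using hb
    obtain ⟨h1, h2, h3, h4, h5⟩ := resolvesList_home hL hj hd h hc
    obtain ⟨hv0, hvl, hv'⟩ := valid_cons.1 hv
    rw [ih _ h1 h2 h3 h4 (valid_cons.2 ⟨hv0, hvl, hv'⟩) h5, discards_cons, discards_cons]
    obtain ⟨hm0, hm⟩ := maxTok_eq_maxFlagged h hc h0
    rw [hm, WithBot.coe_inj] at hmax
    by_cases hn : L p < 0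
    · simp [hn]
    · obtain _ | ⟨⟨-, hr⟩, -⟩ := h
      obtain rfl := hr.of_leaf.eq_of_nonneg (by omega)
      rw [maxFlagged_cons_true] at hmax
      have hlt : ¬ maxFlagged l < L p := by omega
      rw [if_neg hlt, if_neg hlt]
  | case8 L a j h0 ha hp =>
    exfalso
    obtain _ | @⟨_, ⟨v, b⟩, _, l, ⟨hb, hr⟩, h'⟩ := h
    obtain ⟨p, hp', -⟩ := hr.exists_leaf (by omega)
    apply hp
    rw [hp']
    have := p.2
    omega

end StarPath

/-! ### Resolution under a leaf swap, and the list of a configuration. -/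

namespace StarPath

theorem ResolvesList.unique {m : ℕ} {L : Fin m → ℤ} {j : List ℤ} {l l' : List (ℤ × Bool)}
    (h : ResolvesList L j l) (h' : ResolvesList L j l') : l = l' := by
  induction h generalizing l' with
  | nil => cases h'; rfl
  | @cons z x j l h1 h2 ih =>
    obtain _ | @⟨_, x', _, l', h1', h2'⟩ := h'
    rw [ih h2', Prod.ext (h1.2.unique h1'.2) (h1.1.trans h1'.1.symm)]

theorem ResolvesList.of_mem_values {m : ℕ} {L : Fin m → ℤ} {j : List ℤ} {l : List (ℤ × Bool)}
    (h : ResolvesList L j l) {v : ℤ} (hv : v ∈ l.map Prod.fst) : ∃ z ∈ j, Resolves L z v := by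
  induction h with
  | nil => simp at hv
  | cons h1 h2 ih =>
    rcases List.mem_cons.1 hv with rfl | h
    · exact ⟨_, by simp, h1.2⟩
    · obtain ⟨z, hz, h⟩ := ih h
      exact ⟨z, by simp [hz], h⟩

theorem ResolvesList.valid {m : ℕ} {L : Fin m → ℤ} {j : List ℤ} {l : List (ℤ × Bool)}
    (h : ResolvesList L j l) (hL : Function.Injective L) (hj : j.Nodup)
    (hd : ∀ z ∈ j, ∀ p, L p ≠ z) : Valid l := by
  induction h with
  | nil => exact ⟨List.nodup_nil, by simp⟩
  | @cons z x j l h1 h2 ih =>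
    obtain ⟨hzj, hj⟩ := List.nodup_cons.1 hj
    refine valid_cons.2 ⟨h1.2.le, fun hm => ?_, ih hj fun z hz => hd z (by simp [hz])⟩
    obtain ⟨w, hw, hr⟩ := ResolvesList.of_mem_values h2 hm
    have : z = w := h1.2.injective hL hr (hd z (by simp)) (hd w (by simp [hw]))
    exact hzj (this ▸ hw)

/-- A chain that avoids the leaf `p` survives the update. A chain through `p` has the same end as
the chain of the old token `L p`, and after the update it continues with `a` instead. -/
theorem Resolves.update_or {m : ℕ} {L : Fin m → ℤ} {z y : ℤ} (h : Resolves L z y) (p : Fin m)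
    (a : ℤ) : Resolves (Function.update L p a) z y ∨ (Resolves L (L p) y ∧
      ∀ y', Resolves (Function.update L p a) a y' → Resolves (Function.update L p a) z y') := by
  induction h with
  | nonneg z h => exact Or.inl (.nonneg z h)
  | step q y h ih =>
    by_cases hq : q = p
    · subst hq
      refine Or.inr ⟨h, fun y' h' => .step q y' ?_⟩
      rwa [Function.update_self]
    · have e : L q = Function.update L p a q := (Function.update_of_ne hq a L).symm
      rcases ih with h1 | ⟨h1, h2⟩
      · exact Or.inl (.step q y (e ▸ h1))
      · exact Or.inr ⟨h1, fun y' h' => .step q y' (e ▸ h2 y' h')⟩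

/-- Returns to the leaf `p` can be cut off: the part of the chain behind its last passage through
`p` starts at `L p` and does not see the update. -/
theorem Resolves.update_apply {m : ℕ} {L : Fin m → ℤ} {p : Fin m} {y : ℤ}
    (h : Resolves L (L p) y) (a : ℤ) : Resolves (Function.update L p a) (L p) y := by
  have key : ∀ z x, Resolves L z x → Resolves (Function.update L p a) z x ∨
      Resolves (Function.update L p a) (L p) x := by
    intro z x hz
    induction hz with
    | nonneg z h => exact Or.inl (.nonneg z h)
    | step q y h ih =>
      by_cases hq : q = p
      · subst hq
        exact Or.inr (ih.elim id id)
      · exact ih.imp (fun h1 => .step q y ((Function.update_of_ne hq a L).symm ▸ h1)) id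
  exact (key _ _ h).elim id id

/-- The tokens of a configuration form an injective sequence. -/
structure Distinct {m : ℕ} (L : Fin m → ℤ) (j : List ℤ) : Prop where
  leaves : Function.Injective L
  path : j.Nodup
  disjoint : ∀ z ∈ j, ∀ p, L p ≠ z

/-- No resolving chain passes the leaf `p`, since from there on it would resolve `L p`. The new
chain of `L p`, on the other hand, must run into the leaf `p`, where it now finds `a`. -/
theorem resolvesList_swap_of_not_resolves {m : ℕ} {L : Fin m → ℤ} {p : Fin m} {a y y' : ℤ}
    {d d' : Bool} {j : List ℤ} {r r' : List (ℤ × Bool)}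
    (h : ResolvesList L (a :: j) ((y, d) :: r))
    (h' : ResolvesList (Function.update L p a) (L p :: j) ((y', d') :: r'))
    (hn : ∀ x, ¬ Resolves L (L p) x) : y' = y ∧ r' = r := by
  obtain _ | ⟨⟨-, h1⟩, h2⟩ := h
  obtain _ | ⟨⟨-, h1'⟩, h2'⟩ := h'
  have key : ∀ {z x}, Resolves L z x → Resolves (Function.update L p a) z x := fun hz =>
    (hz.update_or p a).resolve_right fun h => hn _ h.1
  constructor
  · rcases h1'.update_or p (L p) with h | ⟨h, -⟩
    · rw [Function.update_idem, Function.update_eq_self] at h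
      exact absurd h (hn _)
    · rw [Function.update_self] at h
      exact h.unique (key h1)
  · exact ResolvesList.unique h2' (List.Forall₂.imp (fun z x hx => ⟨hx.1, key hx.2⟩) h2)

/-- The effect on the resolved values of exchanging the tokens on a leaf and on the vertex `0`. -/
theorem resolvesList_swap {m : ℕ} {L : Fin m → ℤ} {p : Fin m} {a y y' : ℤ}
    {d d' : Bool} {j : List ℤ} {r r' : List (ℤ × Bool)} (hD : Distinct L (a :: j))
    (hD' : Distinct (Function.update L p a) (L p :: j))
    (h : ResolvesList L (a :: j) ((y, d) :: r))
    (h' : ResolvesList (Function.update L p a) (L p :: j) ((y', d') :: r'))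
    (hc : Covers L ((y, d) :: r)) :
    (y' = y ∧ r' = r) ∨ (y' ∈ flagged r ∧ r' = exchangeFlagged y y' r) := by
  by_cases hn : ∀ x, ¬ Resolves L (L p) x
  · exact Or.inl (resolvesList_swap_of_not_resolves h h' hn)
  push Not at hn
  obtain ⟨x, hx⟩ := hn
  have hv := valid_cons.1 (h.valid hD.leaves hD.path hD.disjoint)
  obtain _ | ⟨⟨hd, h1⟩, h2⟩ := h
  obtain _ | ⟨⟨hd', h1'⟩, h2'⟩ := h'
  simp only at h1 h1'
  have hxy : x = y' := (hx.update_apply a).unique h1'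
  subst hxy
  -- If `L p` and `a` have the same value, this value belongs to the head alone, so no other chain
  -- of the list goes through the leaf `p`.
  by_cases hxy : x = y
  · left
    subst hxy
    refine ⟨rfl, ?_⟩
    apply ResolvesList.unique h2'
    refine List.forall₂_iff_get.2 ⟨h2.length_eq, fun i hi1 hi2 => ?_⟩
    have := (List.forall₂_iff_get.1 h2).2 i hi1 hi2
    refine ⟨this.1, (this.2.update_or p a).resolve_right fun h => ?_⟩
    have := h.1.unique hx
    exact hv.2.1 (this ▸ List.mem_map_of_mem (List.get_mem ..))
  · right
    have hmem : ∃ q, L q = x := by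
      by_cases h0 : L p < 0
      · exact hx.mem_range h0
      · exact ⟨p, (hx.eq_of_nonneg (by omega)).symm⟩
    have hxr : x ∈ flagged r := by
      obtain ⟨q, rfl⟩ := hmem
      have := hc q hx.le
      cases d
      · simpa using this
      · simp only [flagged_cons_true, List.mem_cons] at this
        exact this.resolve_left hxy
    refine ⟨hxr, ?_⟩
    apply ResolvesList.unique h2'
    rw [ResolvesList, exchangeFlagged, mapFlagged, List.forall₂_map_right_iff]
    refine List.forall₂_iff_get.2 ⟨h2.length_eq, fun i hi1 hi2 => ?_⟩
    obtain ⟨hg1, hg2⟩ := (List.forall₂_iff_get.1 h2).2 i hi1 hi2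
    have hzj : j.get ⟨i, hi1⟩ ∈ j := List.get_mem ..
    have hwr : (r.get ⟨i, hi2⟩).1 ∈ r.map Prod.fst := List.mem_map_of_mem (List.get_mem ..)
    generalize j.get ⟨i, hi1⟩ = z at *
    generalize r.get ⟨i, hi2⟩ = w at *
    obtain ⟨w, b⟩ := w
    simp only at hg1 hg2 hwr ⊢
    have hwy : w ≠ y := fun h => hv.2.1 (h ▸ hwr)
    -- Only a chain with value `x` can have gone through the leaf `p`. It must have done so, as it
    -- would otherwise still have the value `x`, which now belongs to the new head; hence it now
    -- continues with `a` and ends in `y`.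
    by_cases hwx : w = x
    · subst hwx
      have hz : z < 0 := by
        by_contra hz
        obtain rfl := hg2.eq_of_nonneg (by omega)
        obtain ⟨q, hq⟩ := hmem
        exact hD.disjoint w (by simp [hzj]) q hq
      simp only [hz, decide_true] at hg1
      subst hg1
      simp only [if_true, hz, decide_true, true_and, Equiv.swap_apply_right]
      rcases hg2.update_or p a with h | ⟨-, h⟩
      · exfalso
        have := h.injective hD'.leaves h1' (hD'.disjoint z (by simp [hzj]))
          (hD'.disjoint (L p) (by simp))
        exact (List.nodup_cons.1 hD'.path).1 (this ▸ hzj)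
      · apply h
        exact (h1.update_or p a).resolve_right fun h => hxy (hx.unique h.1)
    · have hr := (hg2.update_or p a).resolve_right fun h => hwx (h.1.unique hx)
      cases b
      · simpa using ⟨by simpa using hg1, hr⟩
      · simp only [if_true]
        rw [Equiv.swap_apply_of_ne_of_ne hwy hwx]
        exact ⟨hg1, hr⟩

/-! ### The arrivals of a configuration -/

variable {m n : ℕ}

theorem leaf_neg (p : Fin m) : (leaf p : Vtx m n).1 < 0 := by
  simp only [leaf]; omega

theorem pathVtx_nonneg (q : Fin (n + 1)) : 0 ≤ (pathVtx q : Vtx m n).1 := by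
  simp only [pathVtx]; omega

theorem exists_leaf_of_neg {v : Vtx m n} (h : v.1 < 0) : ∃ p : Fin m, v = leaf p :=
  ⟨⟨(-v.1 - 1).toNat, by have := v.2.1; omega⟩, Subtype.ext (by simp only [leaf]; omega)⟩

theorem exists_pathVtx_of_nonneg {v : Vtx m n} (h : 0 ≤ v.1) :
    ∃ q : Fin (n + 1), v = pathVtx q :=
  ⟨⟨v.1.toNat, by have := v.2.2; omega⟩, Subtype.ext (by simp only [pathVtx]; omega)⟩

theorem leaf_injective : Function.Injective (leaf : Fin m → Vtx m n) := by
  intro p q h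
  have := congrArg Subtype.val h
  simp only [leaf] at this
  exact Fin.ext (by omega)

theorem pathVtx_injective : Function.Injective (pathVtx : Fin (n + 1) → Vtx m n) := by
  intro p q h
  have := congrArg Subtype.val h
  simp only [pathVtx] at this
  exact Fin.ext (by omega)

theorem leaf_ne_pathVtx (p : Fin m) (q : Fin (n + 1)) : (leaf p : Vtx m n) ≠ pathVtx q := by
  intro h
  have h1 := leaf_neg (n := n) p
  have h2 := pathVtx_nonneg (m := m) q
  rw [h] at h1
  omega

theorem pathVtx_zero : (pathVtx 0 : Vtx m n) = origin m n := by
  apply Subtype.ext; simp [pathVtx, origin]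

variable (f : Equiv.Perm (Vtx m n))

theorem mem_pathTokens {z : ℤ} : z ∈ pathTokens f ↔ ∃ q, (f (pathVtx q)).1 = z := by
  rw [pathTokens, List.mem_ofFn]

theorem distinct_tokens : Distinct (leafTokens f) (pathTokens f) where
  leaves p q h := leaf_injective (n := n) (f.injective (Subtype.ext h))
  path := by
    rw [pathTokens, List.nodup_ofFn]
    exact fun p q h => pathVtx_injective (m := m) (f.injective (Subtype.ext h))
  disjoint := by
    intro z hz p h
    obtain ⟨q, rfl⟩ := (mem_pathTokens f).1 hz
    exact leaf_ne_pathVtx p q (f.injective (Subtype.ext h))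

/-- Passing from a negative token to the token on its goal vertex is an application of `f`, so a
chain stops as soon as the orbit leaves the negative vertices. -/
theorem exists_resolves (v : Vtx m n) (k : ℕ) (hk : 0 ≤ ((f ^ (k + 1)) v).1) :
    ∃ y, Resolves (leafTokens f) (f v).1 y := by
  induction k generalizing v with
  | zero => exact ⟨_, .nonneg _ (by simpa using hk)⟩
  | succ k ih =>
    by_cases h : 0 ≤ (f v).1
    · exact ⟨_, .nonneg _ h⟩
    · obtain ⟨p, hp⟩ := exists_leaf_of_neg (not_le.1 h)
      obtain ⟨y, hy⟩ := ih (f v) (by rwa [pow_succ, Equiv.Perm.mul_apply] at hk)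
      refine ⟨y, ?_⟩
      have := Resolves.step (L := leafTokens f) p y (by rw [hp] at hy; exact hy)
      rw [hp]
      exact this

/-- The orbit of a vertex of the path returns to this vertex, so every chain that starts on the path
ends. -/
theorem exists_resolvesList : ∃ l, ResolvesList (leafTokens f) (pathTokens f) l := by
  have : ∀ q : Fin (n + 1), ∃ y, Resolves (leafTokens f) (f (pathVtx q)).1 y := by
    intro q
    apply exists_resolves f _ (orderOf f - 1)
    rw [Nat.sub_add_cancel (orderOf_pos f), pow_orderOf_eq_one]
    exact pathVtx_nonneg q
  choose y hy using this
  refine ⟨List.ofFn fun q => (y q, decide ((f (pathVtx q)).1 < 0)), ?_⟩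
  rw [pathTokens, ResolvesList, List.forall₂_iff_get]
  refine ⟨by simp, fun i h1 h2 => ?_⟩
  simp only [List.get_eq_getElem, List.getElem_ofFn]
  exact ⟨trivial, hy _⟩

/-- From a leaf with a nonnegative token, follow the orbit backwards to the first vertex of the
path. The token there is negative and resolves to the given one. -/
theorem covers_of_resolvesList {l : List (ℤ × Bool)}
    (h : ResolvesList (leafTokens f) (pathTokens f) l) : Covers (leafTokens f) l := by
  have back : ∀ (k : ℕ) (u : Vtx m n) (y : ℤ), Resolves (leafTokens f) (f u).1 y →
      0 ≤ ((f.symm ^ k) u).1 →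
      ∃ q : Fin (n + 1), Resolves (leafTokens f) (f (pathVtx q)).1 y ∧
        (pathVtx q = u ∨ (f (pathVtx q)).1 < 0) := by
    intro k
    induction k with
    | zero =>
      intro u y hr hu
      obtain ⟨q, rfl⟩ := exists_pathVtx_of_nonneg (by simpa using hu)
      exact ⟨q, hr, Or.inl rfl⟩
    | succ k ih =>
      intro u y hr hu
      by_cases h0 : 0 ≤ u.1
      · obtain ⟨q, rfl⟩ := exists_pathVtx_of_nonneg h0
        exact ⟨q, hr, Or.inl rfl⟩
      · obtain ⟨p, rfl⟩ := exists_leaf_of_neg (not_le.1 h0)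
        obtain ⟨q, h1, h2⟩ := ih (f.symm (leaf p)) y
          (by rw [Equiv.apply_symm_apply]; exact .step p y hr)
          (by rwa [pow_succ, Equiv.Perm.mul_apply] at hu)
        refine ⟨q, h1, Or.inr ?_⟩
        rcases h2 with h2 | h2
        · rw [h2, Equiv.apply_symm_apply]; exact leaf_neg p
        · exact h2
  intro p hp
  -- Going back `orderOf f - 1` times is one step forward, namely to the nonnegative token on the
  -- leaf, so the search backwards reaches the path.
  obtain ⟨q, h1, h2⟩ := back (orderOf f - 1) (leaf p) (leafTokens f p) (.nonneg _ hp) (by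
    have : (f.symm ^ (orderOf f - 1)) (leaf p) = f (leaf p) := by
      have h1 : f.symm ^ (orderOf f - 1) * f⁻¹ = 1 := by
        change f⁻¹ ^ (orderOf f - 1) * f⁻¹ = 1
        rw [← pow_succ, Nat.sub_add_cancel (orderOf_pos f), inv_pow, pow_orderOf_eq_one, inv_one]
      have := congrArg (fun g : Equiv.Perm (Vtx m n) => g (f (leaf p))) h1
      simpa using this
    rw [this]
    exact hp)
  have h2 := h2.resolve_left (leaf_ne_pathVtx p q).symm
  have hm := (mem_pathTokens f).2 ⟨q, rfl⟩
  rw [mem_flagged]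
  obtain ⟨⟨i, hi⟩, hi'⟩ := List.get_of_mem hm
  obtain ⟨hl, hg⟩ := List.forall₂_iff_get.1 h
  have := hg i hi (hl ▸ hi)
  rw [hi'] at this
  simp only [h2, decide_true] at this
  have e : l.get ⟨i, hl ▸ hi⟩ = (leafTokens f p, true) :=
    Prod.ext (this.2.unique h1) this.1
  exact e ▸ List.get_mem ..

theorem deltaFun_eq {l : List (ℤ × Bool)} (h : ResolvesList (leafTokens f) (pathTokens f) l) :
    deltaFun f = -(discards l : ℤ) := by
  have hD := distinct_tokens f
  exact discount_eq_neg_discards _ _ l hD.leaves hD.path hD.disjoint h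
    (h.valid hD.leaves hD.path hD.disjoint) (covers_of_resolvesList f h)

end StarPath

namespace StarPath

open TokenSwapping

variable {m n : ℕ}

/-! ### The effect of a swap on the number of misplaced negative tokens and on their orbits -/

/-- A token is away from its goal vertex exactly if this vertex holds another token; so membership
can be tested at the vertex `t`, without looking for the token `t`. -/
theorem mem_misplacedNeg {f : Equiv.Perm (Vtx m n)} {t : Vtx m n} :
    t ∈ misplacedNeg f ↔ t.1 < 0 ∧ f t ≠ t := by
  constructor
  · rintro ⟨i, rfl, h1, h2⟩
    exact ⟨h1, fun h => h2 (f.injective h)⟩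
  · rintro ⟨h1, h2⟩
    refine ⟨f.symm t, f.apply_symm_apply t, h1, fun h => h2 ?_⟩
    rw [f.apply_symm_apply] at h
    conv_lhs => rw [h]
    exact f.apply_symm_apply t

theorem orbit_congr {V : Type*} {f g : Equiv.Perm V} {i : V}
    (h : ∀ v ∈ orbit f i, g v = f v) : orbit g i = orbit f i := by
  have : ∀ k : ℕ, (g ^ k) i = (f ^ k) i := by
    intro k
    induction k with
    | zero => rfl
    | succ k ih => rw [pow_succ', pow_succ', Equiv.Perm.mul_apply, Equiv.Perm.mul_apply, ih,
        h _ ⟨k, rfl⟩]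
  simp only [orbit, this]

theorem orbit_eq_of_mem {V : Type*} [Finite V] {f : Equiv.Perm V} {i j : V} (h : j ∈ orbit f i) :
    orbit f j = orbit f i := by
  obtain ⟨k, rfl⟩ := h
  ext v
  constructor
  · rintro ⟨r, rfl⟩
    exact ⟨r + k, by rw [pow_add, Equiv.Perm.mul_apply]⟩
  · rintro ⟨r, rfl⟩
    -- Since powers of `orderOf f` are trivial, `k * (orderOf f - 1)` further steps undo the `k`
    -- steps from `i` to `j`.
    refine ⟨r + k * (orderOf f - 1), ?_⟩
    rw [← Equiv.Perm.mul_apply, ← pow_add, add_assoc, ← Nat.mul_succ, Nat.succ_eq_add_one,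
      Nat.sub_add_cancel (orderOf_pos f), mul_comm k, pow_add, pow_mul, pow_orderOf_eq_one,
      one_pow, mul_one]

theorem mem_orbit_self {V : Type*} (f : Equiv.Perm V) (i : V) : i ∈ orbit f i := ⟨0, rfl⟩

theorem negOrbits_subset_of_congr {f g : Equiv.Perm (Vtx m n)} (h : ∀ u, u.1 < 0 → g u = f u) :
    negOrbits f ⊆ negOrbits g := by
  rintro O ⟨i, hi, rfl, hO⟩
  have hneg : ∀ v ∈ orbit f i, v.1 < 0 := fun v hv => (mem_misplacedNeg.1 (hO hv)).1
  have he : orbit g i = orbit f i := orbit_congr fun v hv => h v (hneg v hv)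
  refine ⟨i, hi, he.symm, fun v hv => ?_⟩
  rw [mem_misplacedNeg, h v (hneg v hv)]
  exact mem_misplacedNeg.1 (hO hv)

theorem muFun_congr {f g : Equiv.Perm (Vtx m n)} (h : ∀ u, u.1 < 0 → g u = f u) :
    muFun g = muFun f := by
  have h1 : misplacedNeg g = misplacedNeg f := by
    ext t
    rw [mem_misplacedNeg, mem_misplacedNeg]
    constructor
    · rintro ⟨h1, h2⟩; exact ⟨h1, h t h1 ▸ h2⟩
    · rintro ⟨h1, h2⟩; exact ⟨h1, (h t h1).symm ▸ h2⟩
  have h2 : negOrbits g = negOrbits f :=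
    (negOrbits_subset_of_congr fun u hu => (h u hu).symm).antisymm (negOrbits_subset_of_congr h)
  rw [muFun, muFun, h1, h2]

open Classical in
theorem ncard_eq_diff_add {α : Type*} {S : Set α} (hS : S.Finite) (a : α) :
    S.ncard = (S \ {a}).ncard + if a ∈ S then 1 else 0 := by
  split_ifs with h
  · exact (Set.ncard_sdiff_singleton_add_one h hS).symm
  · rw [Set.sdiff_singleton_eq_self h, add_zero]

/-- The configuration after swapping the vertex `0` with a leaf. -/
def leafSwap (f : Equiv.Perm (Vtx m n)) (p : Fin m) : Equiv.Perm (Vtx m n) :=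
  f * Equiv.swap (origin m n) (leaf p)

/-- The orbit of a leaf consists of misplaced negative tokens. -/
def NegCycle (f : Equiv.Perm (Vtx m n)) (p : Fin m) : Prop :=
  orbit f (leaf p) ⊆ misplacedNeg f

theorem leaf_ne_origin (p : Fin m) : (leaf p : Vtx m n) ≠ origin m n :=
  pathVtx_zero (m := m) (n := n) ▸ leaf_ne_pathVtx p 0

variable (f : Equiv.Perm (Vtx m n)) (p : Fin m)

@[simp] theorem leafSwap_origin : leafSwap f p (origin m n) = f (leaf p) := by
  simp [leafSwap]

@[simp] theorem leafSwap_leaf : leafSwap f p (leaf p) = f (origin m n) := by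
  simp [leafSwap]

theorem leafSwap_of_ne {v : Vtx m n} (h1 : v ≠ origin m n) (h2 : v ≠ leaf p) :
    leafSwap f p v = f v := by
  rw [leafSwap, Equiv.Perm.mul_apply, Equiv.swap_apply_of_ne_of_ne h1 h2]

@[simp] theorem leafSwap_leafSwap : leafSwap (leafSwap f p) p = f := by
  rw [leafSwap, leafSwap, mul_assoc, Equiv.swap_mul_self, mul_one]

theorem applySwap_leaf : applySwap f s(origin m n, leaf p) = leafSwap f p := rfl

/-- A negative orbit other than that of the leaf contains neither of the two swapped vertices, so
the swap leaves it as it is. -/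
theorem negOrbits_diff_subset :
    negOrbits f \ {orbit f (leaf p)} ⊆
      negOrbits (leafSwap f p) \ {orbit (leafSwap f p) (leaf p)} := by
  rintro O ⟨⟨i, hi, rfl, hO⟩, hne⟩
  rw [Set.mem_singleton_iff] at hne
  have hl : leaf p ∉ orbit f i := fun h => hne (orbit_eq_of_mem h).symm
  have hcong : ∀ v ∈ orbit f i, leafSwap f p v = f v := by
    intro v hv
    apply leafSwap_of_ne
    · rintro rfl
      have := (mem_misplacedNeg.1 (hO hv)).1
      simp [origin] at this
    · rintro rfl
      exact hl hv
  have he := orbit_congr hcong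
  refine ⟨⟨i, hi, he.symm, fun v hv => ?_⟩, ?_⟩
  · rw [mem_misplacedNeg, hcong v hv]
    exact mem_misplacedNeg.1 (hO hv)
  · rw [Set.mem_singleton_iff]
    exact fun h => hl (h ▸ mem_orbit_self _ _)

-- Only the leaf itself can enter or leave N, and only its orbit can enter or leave Δ. The additive
-- form avoids truncated subtraction.
open Classical in
theorem muFun_leafSwap :
    muFun f + (if leafSwap f p (leaf p) ≠ leaf p then 1 else 0) +
        (if NegCycle (leafSwap f p) p then 1 else 0) =
      muFun (leafSwap f p) + (if f (leaf p) ≠ leaf p then 1 else 0) +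
        (if NegCycle f p then 1 else 0) := by
  have hN : misplacedNeg f \ {leaf p} = misplacedNeg (leafSwap f p) \ {leaf p} := by
    ext t
    simp only [Set.mem_sdiff, mem_misplacedNeg, Set.mem_singleton_iff]
    constructor
    all_goals
      rintro ⟨⟨h1, h2⟩, h3⟩
      have h0 : t ≠ origin m n := by rintro rfl; simp [origin] at h1
      rw [leafSwap_of_ne f p h0 h3] at *
      exact ⟨⟨h1, h2⟩, h3⟩
  have hO : negOrbits f \ {orbit f (leaf p)} =
      negOrbits (leafSwap f p) \ {orbit (leafSwap f p) (leaf p)} := by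
    apply (negOrbits_diff_subset f p).antisymm
    have := negOrbits_diff_subset (leafSwap f p) p
    rwa [leafSwap_leafSwap] at this
  have key : ∀ g : Equiv.Perm (Vtx m n), muFun g = (misplacedNeg g \ {leaf p}).ncard +
      (negOrbits g \ {orbit g (leaf p)}).ncard + (if g (leaf p) ≠ leaf p then 1 else 0) +
        (if NegCycle g p then 1 else 0) := by
    intro g
    rw [muFun, ncard_eq_diff_add (Set.toFinite _) (leaf p),
      ncard_eq_diff_add (S := negOrbits g) (Set.toFinite _) (orbit g (leaf p))]
    have h1 : leaf p ∈ misplacedNeg g ↔ g (leaf p) ≠ leaf p := by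
      rw [mem_misplacedNeg]; exact and_iff_right (leaf_neg p)
    have h2 : orbit g (leaf p) ∈ negOrbits g ↔ NegCycle g p := by
      constructor
      · rintro ⟨i, -, h1, h2⟩; exact h2
      · intro h; exact ⟨leaf p, leaf_neg p, rfl, h⟩
    simp only [h1, h2]
    ring
  rw [key f, key (leafSwap f p), hN, hO]
  ring

/-- This translates orbits into resolution: the orbit of the leaf stays negative exactly if the
chain of its token never meets a nonnegative token. A fixed leaf has no such end either, which is
why it is excluded separately. -/
theorem negCycle_iff : NegCycle f p ↔
    (∀ x, ¬ Resolves (leafTokens f) (leafTokens f p) x) ∧ f (leaf p) ≠ leaf p := by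
  constructor
  · intro h
    constructor
    · intro x hx
      have key : ∀ z x, Resolves (leafTokens f) z x → ∀ v ∈ orbit f (leaf p), (f v).1 = z →
          False := by
        intro z x hz
        induction hz with
        | nonneg z hz =>
          rintro v ⟨k, rfl⟩ rfl
          have : (f ^ (k + 1)) (leaf p) ∈ orbit f (leaf p) := ⟨k + 1, rfl⟩
          have := (mem_misplacedNeg.1 (h this)).1
          rw [pow_succ', Equiv.Perm.mul_apply] at this
          omega
        | step q y hq ih =>
          rintro v ⟨k, rfl⟩ hv
          have e : f ((f ^ k) (leaf p)) = leaf q := Subtype.ext hv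
          exact ih _ ⟨k + 1, rfl⟩ (by rw [pow_succ', Equiv.Perm.mul_apply, e]; rfl)
      exact key _ _ hx _ (mem_orbit_self _ _) rfl
    · exact (mem_misplacedNeg.1 (h (mem_orbit_self _ _))).2
  · rintro ⟨h1, h2⟩ v ⟨k, rfl⟩
    rw [mem_misplacedNeg]
    constructor
    · by_contra hk
      rcases k with _ | k
      · exact hk (leaf_neg p)
      · obtain ⟨y, hy⟩ := exists_resolves f (leaf p) k (not_lt.1 hk)
        exact h1 y hy
    · rw [← Equiv.Perm.mul_apply, ← pow_succ', pow_succ, Equiv.Perm.mul_apply]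
      exact fun h => h2 ((f ^ k).injective h)

/-! ### The effect of a swap on `π` -/

/-- The token on the vertex `0` is nonnegative and exceeds all the tokens on the leaves. -/
def HeadMax : Prop := 0 ≤ (f (origin m n)).1 ∧ ∀ p, leafTokens f p < (f (origin m n)).1

theorem ncard_Iio (j : Vtx m n) : ({i : Vtx m n | i < j}.ncard : ℤ) = m + j.1 := by
  have h := Set.ncard_image_of_injective {i : Vtx m n | i < j} Subtype.val_injective
  have e : Subtype.val '' {i : Vtx m n | i < j} = (Finset.Ico (-(m : ℤ)) j.1 : Set ℤ) := by
    ext z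
    simp only [Set.mem_image, Set.mem_ofPred_eq, Finset.coe_Ico, Set.mem_Ico]
    constructor
    · rintro ⟨x, hx, rfl⟩
      exact ⟨x.2.1, hx⟩
    · rintro ⟨h1, h2⟩
      exact ⟨⟨z, h1, h2.le.trans j.2.2⟩, h2, rfl⟩
  rw [← h, e, Set.ncard_coe_finset, Int.card_Ico]
  have := j.2.1
  omega

theorem ncard_lt_on_leaves (j : Vtx m n) :
    {i : Vtx m n | i < j ∧ (f.symm i).1 < 0}.ncard =
      (Finset.univ.filter fun p : Fin m => leafTokens f p < j.1).card := by
  classical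
  have : {i : Vtx m n | i < j ∧ (f.symm i).1 < 0} =
      (((Finset.univ.filter fun p : Fin m => leafTokens f p < j.1).image
        fun p => f (leaf p) : Finset (Vtx m n)) : Set (Vtx m n)) := by
    ext i
    simp only [Set.mem_ofPred_eq, Finset.coe_image, Finset.coe_filter, Finset.mem_univ, true_and,
      Set.mem_image]
    constructor
    · rintro ⟨h1, h2⟩
      obtain ⟨p, hp⟩ := exists_leaf_of_neg h2
      have : f (leaf p) = i := by rw [← hp, f.apply_symm_apply]
      exact ⟨p, by rw [leafTokens, this]; exact h1, this⟩
    · rintro ⟨p, h1, rfl⟩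
      exact ⟨h1, by rw [f.symm_apply_apply]; exact leaf_neg p⟩
  rw [this, Set.ncard_coe_finset]
  exact Finset.card_image_of_injective _ (f.injective.comp leaf_injective)

-- There are `m + j` tokens below `j`. If `j` is on the vertex `0`, those that are not to its right
-- are on the leaves, so the cap `j + 1` is attained unless all `m` leaf tokens are smaller; in that
-- case the inversion number is `j`. This is the only way in which π distinguishes the vertex `0`
-- from a leaf.
open Classical in
theorem piTok_add (j : Fin (n + 1)) :
    piTok f j + (if f.symm (pathVtx j) = origin m n ∧ ∀ p, leafTokens f p < (j : ℤ)
        then 1 else 0) =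
      if (f.symm (pathVtx j)).1 ≤ 0 then (j : ℕ) + 1 else piTok f j := by
  by_cases h0 : f.symm (pathVtx j) = origin m n
  · have h00 : (f.symm (pathVtx j)).1 = 0 := by rw [h0]; rfl
    have hneg : ¬ (f.symm (pathVtx j)).1 < 0 := by omega
    rw [if_pos h00.le, piTok, if_neg hneg, inv]
    have hcount := ncard_Iio (pathVtx j : Vtx m n)
    have hunion : {i : Vtx m n | i < pathVtx j} =
        {i : Vtx m n | i < pathVtx j ∧ f.symm i > f.symm (pathVtx j)} ∪
          {i : Vtx m n | i < pathVtx j ∧ (f.symm i).1 < 0} := by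
      ext i
      simp only [Set.mem_ofPred_eq, Set.mem_union]
      constructor
      · intro hi
        by_cases h : (f.symm i).1 < 0
        · exact Or.inr ⟨hi, h⟩
        · refine Or.inl ⟨hi, lt_of_le_of_ne ?_ ?_⟩
          · exact Subtype.coe_le_coe.1 (by omega)
          · exact fun e => hi.ne (f.symm.injective e.symm)
      · rintro (h | h) <;> exact h.1
    have hdisj : Disjoint {i : Vtx m n | i < pathVtx j ∧ f.symm i > f.symm (pathVtx j)}
        {i : Vtx m n | i < pathVtx j ∧ (f.symm i).1 < 0} := by
      rw [Set.disjoint_left]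
      rintro i ⟨-, h1⟩ ⟨-, h2⟩
      have := Subtype.coe_lt_coe.2 h1
      omega
    rw [hunion, Set.ncard_union_eq hdisj, ncard_lt_on_leaves] at hcount
    have hj : (pathVtx j : Vtx m n).1 = j := rfl
    rw [hj] at hcount
    by_cases hall : ∀ p, leafTokens f p < (j : ℤ)
    · rw [if_pos ⟨h0, hall⟩]
      rw [Finset.filter_true_of_mem (fun p _ => hall p), Finset.card_univ, Fintype.card_fin]
        at hcount
      push_cast at hcount
      omega
    · rw [if_neg fun h => hall h.2]
      have : (Finset.univ.filter fun p : Fin m => leafTokens f p < (j : ℤ)).card < m := by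
        conv_rhs => rw [← Fintype.card_fin m, ← Finset.card_univ]
        apply Finset.card_lt_card
        rw [Finset.ssubset_univ_iff]
        intro h
        exact hall fun p => by simpa using (Finset.ext_iff.1 h p).2 (Finset.mem_univ p)
      push_cast at hcount
      omega
  · rw [if_neg fun h => h0 h.1, add_zero]
    split_ifs with h
    · have : (f.symm (pathVtx j)).1 < 0 :=
        lt_of_le_of_ne h fun e => h0 (Subtype.ext e)
      rw [piTok, if_pos this]
    · rfl

open Classical in
theorem piFun_add : piFun f + (if HeadMax f then 1 else 0) =
    ∑ j : Fin (n + 1),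
      if (f.symm (pathVtx j)).1 ≤ 0 then (j : ℕ) + 1 else piTok f j := by
  rw [← Finset.sum_congr rfl fun j _ => piTok_add f j, Finset.sum_add_distrib, piFun]
  congr 1
  by_cases h0 : 0 ≤ (f (origin m n)).1
  · obtain ⟨j, hj⟩ := exists_pathVtx_of_nonneg h0
    have hjv : (f (origin m n)).1 = j := by rw [hj]; rfl
    rw [Finset.sum_eq_single j]
    · have : f.symm (pathVtx j) = origin m n := by rw [← hj, f.symm_apply_apply]
      simp only [HeadMax, this, true_and, hjv]
      simp
    · intro i _ hi
      rw [if_neg]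
      rintro ⟨h, -⟩
      apply hi
      apply pathVtx_injective (m := m)
      rw [← hj, ← h, f.apply_symm_apply]
    · simp
  · rw [if_neg fun h => h0 h.1, Finset.sum_eq_zero]
    intro j _
    rw [if_neg]
    rintro ⟨h, -⟩
    apply h0
    rw [← h, f.apply_symm_apply]
    exact pathVtx_nonneg j

theorem leafSwap_symm (v : Vtx m n) :
    (leafSwap f p).symm v = Equiv.swap (origin m n) (leaf p) (f.symm v) := rfl

theorem swap_le_zero_iff (v : Vtx m n) :
    (Equiv.swap (origin m n) (leaf p) v).1 ≤ 0 ↔ v.1 ≤ 0 := by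
  have h0 : (origin m n).1 = 0 := rfl
  have h1 := leaf_neg (n := n) p
  by_cases hv : v = origin m n
  · rw [hv, Equiv.swap_apply_left]; omega
  · by_cases hv' : v = leaf p
    · rw [hv', Equiv.swap_apply_right]; omega
    · rw [Equiv.swap_apply_of_ne_of_ne hv hv']

theorem swap_eq_of_pos {v : Vtx m n} (h : 0 < v.1) : Equiv.swap (origin m n) (leaf p) v = v := by
  apply Equiv.swap_apply_of_ne_of_ne
  · rintro rfl; simp [origin] at h
  · rintro rfl; have := leaf_neg (n := n) p; omega

-- In the form of `piFun_add`, the sum depends only on which tokens are on the vertices `≤ 0` and on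
-- the order of the others, and a leaf swap preserves both.
open Classical in
theorem piFun_leafSwap : piFun f + (if HeadMax f then 1 else 0) =
    piFun (leafSwap f p) + (if HeadMax (leafSwap f p) then 1 else 0) := by
  rw [piFun_add, piFun_add]
  apply Finset.sum_congr rfl
  intro j _
  rw [leafSwap_symm]
  simp only [swap_le_zero_iff]
  split_ifs with h
  · rfl
  · have h' : 0 < (f.symm (pathVtx j)).1 := not_le.1 h
    rw [piTok, piTok, leafSwap_symm, swap_eq_of_pos p h', if_neg (by omega), if_neg (by omega)]
    congr 1
    simp only [inv, leafSwap_symm, swap_eq_of_pos p h']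
    congr 1
    ext i
    simp only [Set.mem_ofPred_eq, and_congr_right_iff]
    intro _
    by_cases hi : 0 < (f.symm i).1
    · rw [swap_eq_of_pos p hi]
    · have h2 := (swap_le_zero_iff p (f.symm i)).2 (not_lt.1 hi)
      constructor
      all_goals
        intro h3
        have := Subtype.coe_lt_coe.2 h3
        omega

/-- The configuration after swapping two adjacent vertices of the path. -/
def pathSwap (q : ℕ) (hq : q < n) : Equiv.Perm (Vtx m n) :=
  f * Equiv.swap (pathVtx ⟨q, by omega⟩) (pathVtx ⟨q + 1, by omega⟩)

theorem muFun_pathSwap (q : ℕ) (hq : q < n) : muFun (pathSwap f q hq) = muFun f := by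
  apply muFun_congr
  intro u hu
  rw [pathSwap, Equiv.Perm.mul_apply, Equiv.swap_apply_of_ne_of_ne]
  · rintro rfl; have := pathVtx_nonneg (m := m) (⟨q, by omega⟩ : Fin (n + 1)); omega
  · rintro rfl; have := pathVtx_nonneg (m := m) (⟨q + 1, by omega⟩ : Fin (n + 1)); omega

theorem swap_lt_swap_iff {u v x y : Vtx m n} (huv : v.1 = u.1 + 1)
    (h : ¬ (x = u ∧ y = v)) (h' : ¬ (y = u ∧ x = v)) :
    Equiv.swap u v x < Equiv.swap u v y ↔ x < y := by
  simp only [Subtype.ext_iff] at h h'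
  rw [← Subtype.coe_lt_coe, ← Subtype.coe_lt_coe, Equiv.swap_apply_def, Equiv.swap_apply_def]
  simp only [Subtype.ext_iff]
  split_ifs <;> omega

theorem inv_pathSwap_of_ne (q : ℕ) (hq : q < n)
    (hlt : f (pathVtx ⟨q + 1, by omega⟩) < f (pathVtx ⟨q, by omega⟩)) {j : Vtx m n}
    (hj : j ≠ f (pathVtx ⟨q, by omega⟩)) : inv (pathSwap f q hq) j = inv f j := by
  have hs : ∀ v, (pathSwap f q hq).symm v =
    Equiv.swap (pathVtx ⟨q, by omega⟩) (pathVtx ⟨q + 1, by omega⟩) (f.symm v) := fun _ => rfl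
  simp only [inv, hs]
  congr 1
  ext i
  simp only [Set.mem_ofPred_eq, and_congr_right_iff]
  intro hij
  apply swap_lt_swap_iff (by simp [pathVtx])
  · rintro ⟨h1, h2⟩
    exact hj (by rw [← h1, f.apply_symm_apply])
  · rintro ⟨h1, h2⟩
    rw [← h1, ← h2, f.apply_symm_apply, f.apply_symm_apply] at hlt
    exact absurd hlt (not_lt.2 hij.le)

theorem inv_pathSwap_self (q : ℕ) (hq : q < n)
    (hlt : f (pathVtx ⟨q + 1, by omega⟩) < f (pathVtx ⟨q, by omega⟩)) :
    inv f (f (pathVtx ⟨q, by omega⟩)) =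
      inv (pathSwap f q hq) (f (pathVtx ⟨q, by omega⟩)) + 1 := by
  have hs : ∀ v, (pathSwap f q hq).symm v =
    Equiv.swap (pathVtx ⟨q, by omega⟩) (pathVtx ⟨q + 1, by omega⟩) (f.symm v) := fun _ => rfl
  have hmem : f (pathVtx ⟨q + 1, by omega⟩) ∈ {i : Vtx m n | i < f (pathVtx ⟨q, by omega⟩) ∧
      f.symm i > f.symm (f (pathVtx ⟨q, by omega⟩))} := by
    refine ⟨hlt, ?_⟩
    rw [f.symm_apply_apply, f.symm_apply_apply]
    exact Subtype.coe_lt_coe.1 (by simp [pathVtx])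
  rw [inv, ← Set.ncard_sdiff_singleton_add_one hmem (Set.toFinite _), inv]
  congr 2
  ext i
  simp only [Set.mem_sdiff, Set.mem_ofPred_eq, Set.mem_singleton_iff, hs, f.symm_apply_apply]
  by_cases hi : i = f (pathVtx ⟨q + 1, by omega⟩)
  · subst hi
    simp only [f.symm_apply_apply, Equiv.swap_apply_left, Equiv.swap_apply_right, not_true,
      and_false, false_iff, not_and]
    intro _ h
    have := Subtype.coe_lt_coe.2 h
    simp [pathVtx] at this
  · simp only [hi, not_false_eq_true, and_true, and_congr_right_iff]
    intro hij
    symm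
    apply swap_lt_swap_iff (by simp [pathVtx])
    · rintro ⟨-, h2⟩
      exact hi (by rw [← h2, f.apply_symm_apply])
    · rintro ⟨h1, h2⟩
      have := congrArg Subtype.val h2
      simp [pathVtx] at this

theorem piTok_pathSwap (q : ℕ) (hq : q < n)
    (hlt : f (pathVtx ⟨q + 1, by omega⟩) < f (pathVtx ⟨q, by omega⟩)) {j : Fin (n + 1)}
    (hj : pathVtx j ≠ f (pathVtx ⟨q, by omega⟩)) : piTok (pathSwap f q hq) j = piTok f j := by
  rw [piTok, piTok, inv_pathSwap_of_ne f q hq hlt hj]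
  have hs : (pathSwap f q hq).symm (pathVtx j) =
    Equiv.swap (pathVtx ⟨q, by omega⟩) (pathVtx ⟨q + 1, by omega⟩) (f.symm (pathVtx j)) := rfl
  have : ((pathSwap f q hq).symm (pathVtx j)).1 < 0 ↔ (f.symm (pathVtx j)).1 < 0 := by
    rw [hs, Equiv.swap_apply_def]
    split_ifs with h1 h2
    · rw [h1]; simp [pathVtx]; omega
    · rw [h2]; simp [pathVtx]; omega
    · rfl
  simp only [this]

/-- The larger token moves right past the smaller one. It loses exactly one inversion and no other
token loses or gains any; the cap can hide the loss only if the inversion number was above `j + 1`.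
If the larger token is negative, π does not notice the swap. -/
theorem piFun_pathSwap (q : ℕ) (hq : q < n)
    (hlt : f (pathVtx ⟨q + 1, by omega⟩) < f (pathVtx ⟨q, by omega⟩)) :
    piFun (pathSwap f q hq) ≤ piFun f ∧ piFun f ≤ piFun (pathSwap f q hq) + 1 ∧
      (∀ j : Fin (n + 1), f (pathVtx ⟨q, by omega⟩) = pathVtx j →
        inv f (pathVtx j) ≤ (j : ℕ) + 1 → piFun f = piFun (pathSwap f q hq) + 1) := by
  by_cases h0 : 0 ≤ (f (pathVtx ⟨q, by omega⟩)).1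
  · obtain ⟨j, hj⟩ := exists_pathVtx_of_nonneg h0
    have hsum : ∑ i ∈ Finset.univ.erase j, piTok (pathSwap f q hq) i =
        ∑ i ∈ Finset.univ.erase j, piTok f i := by
      apply Finset.sum_congr rfl
      intro i hi
      apply piTok_pathSwap f q hq hlt
      rw [hj]
      exact fun h => (Finset.mem_erase.1 hi).1 (pathVtx_injective (m := m) h)
    have e1 := Finset.add_sum_erase Finset.univ (piTok f) (Finset.mem_univ j)
    have e2 := Finset.add_sum_erase Finset.univ (piTok (pathSwap f q hq)) (Finset.mem_univ j)
    have hinv := inv_pathSwap_self f q hq hlt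
    have hs1 : f.symm (pathVtx j) = pathVtx ⟨q, by omega⟩ := by rw [← hj, f.symm_apply_apply]
    have hs2 : (pathSwap f q hq).symm (pathVtx j) = pathVtx ⟨q + 1, by omega⟩ := by
      have : (pathSwap f q hq).symm (pathVtx j) = Equiv.swap (pathVtx ⟨q, by omega⟩)
        (pathVtx ⟨q + 1, by omega⟩) (f.symm (pathVtx j)) := rfl
      rw [this, hs1, Equiv.swap_apply_left]
    have t1 : piTok f j = min ((j : ℕ) + 1) (inv f (pathVtx j)) := by
      rw [piTok, hs1, if_neg (not_lt.2 (pathVtx_nonneg _))]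
    have t2 : piTok (pathSwap f q hq) j =
        min ((j : ℕ) + 1) (inv (pathSwap f q hq) (pathVtx j)) := by
      rw [piTok, hs2, if_neg (not_lt.2 (pathVtx_nonneg _))]
    rw [hj] at hinv
    rw [piFun, piFun, ← e1, ← e2, hsum]
    refine ⟨by omega, by omega, fun i hi hle => ?_⟩
    obtain rfl : j = i := pathVtx_injective (m := m) (hj.symm.trans hi)
    omega
  · have : piFun (pathSwap f q hq) = piFun f := by
      apply Finset.sum_congr rfl
      intro i _
      apply piTok_pathSwap f q hq hlt
      intro h
      exact h0 (h ▸ pathVtx_nonneg i)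
    rw [this]
    refine ⟨le_rfl, by omega, fun j hj => ?_⟩
    exact absurd (hj ▸ pathVtx_nonneg j) h0

end StarPath

namespace StarPath

open TokenSwapping

variable {m n : ℕ} (f : Equiv.Perm (Vtx m n)) (p : Fin m)

/-! ### The effect of a swap on `Ψ` -/

/-- `⟨f(1), …, f(n)⟩`. -/
def pathTail : List ℤ := List.ofFn fun q : Fin n => (f (pathVtx q.succ)).1

theorem pathTokens_eq_cons : pathTokens f = (f (origin m n)).1 :: pathTail f := by
  rw [pathTokens, List.ofFn_succ, pathVtx_zero]; rfl

theorem getElem_pathTokens (i : ℕ) (hi : i < (pathTokens f).length) :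
    (pathTokens f)[i] = (f (pathVtx ⟨i, by simpa [pathTokens] using hi⟩)).1 := by
  simp only [pathTokens, List.getElem_ofFn]

theorem pathVtx_succ_ne_origin (q : Fin n) : (pathVtx q.succ : Vtx m n) ≠ origin m n := by
  rw [← pathVtx_zero]
  exact fun h => Fin.succ_ne_zero q (pathVtx_injective h)

@[simp] theorem pathTail_leafSwap : pathTail (leafSwap f p) = pathTail f := by
  unfold pathTail
  refine congrArg List.ofFn (funext fun q => ?_)
  rw [leafSwap_of_ne f p (pathVtx_succ_ne_origin q) (leaf_ne_pathVtx p q.succ).symm]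

theorem leafTokens_leafSwap :
    leafTokens (leafSwap f p) = Function.update (leafTokens f) p (f (origin m n)).1 := by
  funext q
  by_cases h : q = p
  · subst h
    rw [Function.update_self, leafTokens, leafSwap_leaf]
  · rw [Function.update_of_ne h, leafTokens, leafTokens,
      leafSwap_of_ne f p (leaf_ne_origin q) fun e => h (leaf_injective e)]

-- An extra flag on the head counts only if the head has none and is discarded on arrival. The
-- flagged values being the nonnegative tokens on the leaves, this is the condition `HeadMax`.
open Classical in
theorem discards_head {y : ℤ} {d : Bool} {r : List (ℤ × Bool)}
    (h : ResolvesList (leafTokens f) (pathTokens f) ((y, d) :: r)) :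
    discards ((y, true) :: r) = discards ((y, d) :: r) + if HeadMax f then 1 else 0 := by
  have hc := covers_of_resolvesList f h
  rw [pathTokens_eq_cons] at h
  obtain _ | ⟨⟨hd, hr⟩, h2⟩ := h
  simp only at hd hr
  have hiff : HeadMax f ↔ d = false ∧ maxFlagged r < y := by
    constructor
    · rintro ⟨h0, hall⟩
      obtain rfl := hr.eq_of_nonneg h0
      refine ⟨by simpa [hd] using h0, ?_⟩
      have : maxFlagged r ≤ (f (origin m n)).1 - 1 := by
        apply maxFlagged_le (by omega)
        intro v hv
        obtain ⟨z, -, hz, hzr⟩ := ResolvesList.of_mem_flagged h2 hv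
        obtain ⟨q, rfl⟩ := hzr.mem_range hz
        have := hall q
        omega
      omega
    · rintro ⟨rfl, hlt⟩
      have h0 : 0 ≤ (f (origin m n)).1 := by simpa using hd
      obtain rfl := hr.eq_of_nonneg h0
      refine ⟨h0, fun q => ?_⟩
      by_cases hq : 0 ≤ leafTokens f q
      · have := hc q hq
        rw [flagged_cons_false] at this
        exact (le_maxFlagged this).trans_lt hlt
      · omega
  rw [discards_cons, discards_cons]
  simp only [hiff]
  cases d <;> simp
  ring

-- This is the form of Ψ suited to leaf swaps: the first summand is invariant, and the flag of the
-- head, which such a swap can change, has disappeared.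
open Classical in
theorem psiFun_eq {y : ℤ} {d : Bool} {r : List (ℤ × Bool)}
    (h : ResolvesList (leafTokens f) (pathTokens f) ((y, d) :: r)) :
    psiFun f = ((piFun f + if HeadMax f then 1 else 0 : ℕ) : ℤ) + muFun f -
      discards ((y, true) :: r) := by
  rw [psiFun, deltaFun_eq f h, discards_head f h]
  push_cast
  ring

theorem exists_resolvesList_cons :
    ∃ y d r, ResolvesList (leafTokens f) (pathTokens f) ((y, d) :: r) := by
  obtain ⟨l, hl⟩ := exists_resolvesList f
  rcases l with _ | ⟨⟨y, d⟩, r⟩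
  · rw [pathTokens_eq_cons] at hl; cases hl
  · exact ⟨y, d, r, hl⟩

theorem psiFun_leafSwap_of_not_resolves
    (hn : ∀ x, ¬ Resolves (leafTokens f) (leafTokens f p) x) :
    psiFun (leafSwap f p) - psiFun f = (muFun (leafSwap f p) : ℤ) - muFun f := by
  obtain ⟨y, d, r, h⟩ := exists_resolvesList_cons f
  obtain ⟨y', d', r', h'⟩ := exists_resolvesList_cons (leafSwap f p)
  rw [psiFun_eq f h, psiFun_eq _ h', piFun_leafSwap f p]
  rw [pathTokens_eq_cons] at h h'
  rw [leafTokens_leafSwap, leafSwap_origin, pathTail_leafSwap] at h'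
  obtain ⟨rfl, rfl⟩ := resolvesList_swap_of_not_resolves h h' hn
  ring

theorem abs_psiFun_leafSwap_le :
    |psiFun (leafSwap f p) - psiFun f - ((muFun (leafSwap f p) : ℤ) - muFun f)| ≤ 1 := by
  obtain ⟨y, d, r, h⟩ := exists_resolvesList_cons f
  obtain ⟨y', d', r', h'⟩ := exists_resolvesList_cons (leafSwap f p)
  rw [psiFun_eq f h, psiFun_eq _ h', piFun_leafSwap f p]
  have hc := covers_of_resolvesList f h
  have hD := distinct_tokens f
  have hD' := distinct_tokens (leafSwap f p)
  have hv := h.valid hD.leaves hD.path hD.disjoint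
  rw [pathTokens_eq_cons] at h h' hD hD'
  rw [leafTokens_leafSwap, leafSwap_origin, pathTail_leafSwap] at h' hD'
  rcases resolvesList_swap hD hD' h h' hc with ⟨rfl, rfl⟩ | ⟨h1, rfl⟩
  · rw [abs_le]; constructor <;> linarith
  -- With both heads flagged, the change of the head is part of the same exchange of flagged values.
  · have hex : (y', true) :: exchangeFlagged y y' r = exchangeFlagged y y' ((y, true) :: r) := by
      simp [exchangeFlagged]
    rw [hex]
    have hv' : Valid ((y, true) :: r) := by
      rw [valid_cons] at hv ⊢; exact hv
    have := abs_discards_exchangeFlagged_le _ y y' hv' (by simp) (by simp [h1])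
    rw [abs_le] at this ⊢
    constructor <;> linarith

theorem not_negCycle_of_nonneg {v : Vtx m n} (hv : v ∈ orbit f (leaf p)) (h0 : 0 ≤ v.1) :
    ¬ NegCycle f p := by
  intro h
  have := (mem_misplacedNeg.1 (h hv)).1
  omega

theorem origin_mem_orbit (h : f (origin m n) = leaf p) : origin m n ∈ orbit f (leaf p) := by
  have : leaf p ∈ orbit f (origin m n) := ⟨1, by rw [pow_one, h]⟩
  rw [orbit_eq_of_mem this]
  exact mem_orbit_self _ _

/-- Sending a negative token from the vertex `0` to its goal lowers `Ψ` by one. -/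
theorem psiFun_home (h : f (origin m n) = leaf p) : psiFun (leafSwap f p) = psiFun f - 1 := by
  have hleaf : leafTokens (leafSwap f p) p = -((p : ℤ) + 1) := by
    rw [leafTokens, leafSwap_leaf, h]; rfl
  have hn : ∀ x, ¬ Resolves (leafTokens (leafSwap f p)) (leafTokens (leafSwap f p) p) x := by
    have key : ∀ z x, Resolves (leafTokens (leafSwap f p)) z x → z = -((p : ℤ) + 1) → False := by
      intro z x hz
      induction hz with
      | nonneg z hz => omega
      | step q y hq ih =>
        intro e
        have : q = p := Fin.ext (by omega)
        subst this
        exact ih hleaf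
    exact fun x hx => key _ x hx hleaf
  -- The lemma is applied to the configuration after the swap, where the leaf holds its own token
  -- and does not resolve; a second swap leads back to `f`.
  have h1 := psiFun_leafSwap_of_not_resolves _ p hn
  rw [leafSwap_leafSwap] at h1
  have h2 := muFun_leafSwap f p
  have hne : f (leaf p) ≠ leaf p := fun e => leaf_ne_origin p (f.injective (e.trans h.symm))
  have hc1 : ¬ NegCycle f p := not_negCycle_of_nonneg f p (origin_mem_orbit f p h) le_rfl
  have hc2 : ¬ NegCycle (leafSwap f p) p := by
    rw [negCycle_iff, leafSwap_leaf]; exact fun hh => hh.2 h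
  rw [if_neg hc1, if_neg hc2, if_pos hne, if_neg (by rw [leafSwap_leaf]; exact not_not.2 h)] at h2
  omega

/-- The leaf receives the token from the vertex `0`. This token resolves, and its chain avoided the
leaf, so it still resolves after the swap. -/
theorem exists_resolves_leafSwap
    (hn : ∀ x, ¬ Resolves (leafTokens f) (leafTokens f p) x) :
    ∃ x, Resolves (leafTokens (leafSwap f p)) (leafTokens (leafSwap f p) p) x := by
  obtain ⟨y, d, r, h⟩ := exists_resolvesList_cons f
  rw [pathTokens_eq_cons] at h
  obtain _ | ⟨⟨-, h1⟩, -⟩ := h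
  refine ⟨y, ?_⟩
  rw [leafTokens_leafSwap, Function.update_self]
  exact (h1.update_or p _).resolve_right fun h => hn _ h.1

theorem ne_of_negCycle (h : NegCycle f p) : f (origin m n) ≠ leaf p := fun e =>
  not_negCycle_of_nonneg f p (origin_mem_orbit f p e) le_rfl h

/-- Breaking up a cycle of misplaced negative tokens lowers `Ψ` by one. -/
theorem psiFun_extract (h : NegCycle f p) : psiFun (leafSwap f p) = psiFun f - 1 := by
  obtain ⟨hn, hne⟩ := (negCycle_iff f p).1 h
  have h1 := psiFun_leafSwap_of_not_resolves f p hn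
  have h2 := muFun_leafSwap f p
  have hc2 : ¬ NegCycle (leafSwap f p) p := by
    rw [negCycle_iff]
    obtain ⟨x, hx⟩ := exists_resolves_leafSwap f p hn
    exact fun hh => hh.1 x hx
  rw [if_pos h, if_neg hc2, if_pos hne, if_pos (by rw [leafSwap_leaf]; exact ne_of_negCycle f p h)]
    at h2
  omega

theorem deltaFun_cons : deltaFun f = discount (leafTokens f) ((f (origin m n)).1 :: pathTail f) := by
  rw [deltaFun, pathTokens_eq_cons]

/-- Moving the largest token on the leaves to the vertex `0`, in exchange for a smaller
nonnegative token, lowers `Ψ` by one. -/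
theorem psiFun_out (h0 : 0 ≤ (f (origin m n)).1) (hlt : (f (origin m n)).1 < leafTokens f p)
    (hmax : ∀ q, leafTokens f q ≤ leafTokens f p) : psiFun (leafSwap f p) = psiFun f - 1 := by
  have hL := (distinct_tokens f).leaves
  have hfp : (f (leaf p)).1 = leafTokens f p := rfl
  have hmem : ∀ g : Equiv.Perm (Vtx m n), g (leaf p) ∈ orbit g (leaf p) := fun g =>
    ⟨1, by rw [pow_one]⟩
  have hmu : muFun (leafSwap f p) = muFun f := by
    have h2 := muFun_leafSwap f p
    have hc1 : ¬ NegCycle f p := not_negCycle_of_nonneg f p (hmem f) (by omega)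
    have hc2 : ¬ NegCycle (leafSwap f p) p :=
      not_negCycle_of_nonneg _ p (hmem _) (by rw [leafSwap_leaf]; exact h0)
    have hneg := leaf_neg (n := n) p
    have hne1 : f (leaf p) ≠ leaf p := fun e => by rw [e] at hfp; omega
    have hne2 : leafSwap f p (leaf p) ≠ leaf p := fun e => by
      rw [leafSwap_leaf] at e; rw [e] at h0; omega
    rw [if_neg hc1, if_neg hc2, if_pos hne1, if_pos hne2] at h2
    omega
  have hpi : piFun f = piFun (leafSwap f p) + 1 := by
    have h2 := piFun_leafSwap f p
    have hm1 : ¬ HeadMax f := fun h => by have := h.2 p; omega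
    have hm2 : HeadMax (leafSwap f p) := by
      rw [HeadMax, leafSwap_origin]
      refine ⟨by omega, fun q => ?_⟩
      rw [leafTokens_leafSwap, hfp]
      by_cases hq : q = p
      · rw [hq, Function.update_self]; exact hlt
      · rw [Function.update_of_ne hq]
        exact lt_of_le_of_ne (hmax q) fun e => hq (hL e)
    rw [if_neg hm1, if_pos hm2] at h2
    omega
  have hmaxTok : maxTok (leafTokens f) = leafTokens f p := maxTok_eq hmax ⟨p, rfl⟩
  -- Before the swap, the clause of δ for a nonnegative head below the maximum puts the head in the
  -- place of the maximum. After the swap this has already happened and the new head exceeds all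
  -- leaf tokens, so it is skipped: both recursions continue with the same pair.
  have hdelta : deltaFun (leafSwap f p) = deltaFun f := by
    rw [deltaFun_cons, deltaFun_cons, pathTail_leafSwap, leafSwap_origin, leafTokens_leafSwap]
    have e : replaceTok (leafTokens f) (f (origin m n)).1 (maxTok (leafTokens f)) =
        Function.update (leafTokens f) p (f (origin m n)).1 := by
      funext q
      rw [hmaxTok, replaceTok]
      by_cases hq : q = p
      · rw [hq, Function.update_self, if_pos rfl]
      · rw [Function.update_of_ne hq, if_neg]
        exact fun e => hq (hL (WithBot.coe_inj.1 e))
    conv_rhs =>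
      rw [discount, dif_neg (by rw [hmaxTok]; exact not_lt.2 (by exact_mod_cast h0.trans hlt.le)),
        if_pos h0, if_neg (by rw [hmaxTok]; exact not_lt.2 (by exact_mod_cast hlt.le)), e]
    rw [discount]
    split_ifs with h1 h2 h3
    · rw [discount_of_neg h1]
    · rfl
    · exfalso
      apply h3
      rw [maxTok_lt_iff]
      intro q
      by_cases hq : q = p
      · rw [hq, Function.update_self]; exact hlt
      · rw [Function.update_of_ne hq]
        exact lt_of_le_of_ne (hmax q) fun e => hq (hL e)
    all_goals omega
  rw [psiFun, psiFun, hdelta, hmu, hpi]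
  push_cast
  ring

@[simp] theorem leafTokens_pathSwap (q : ℕ) (hq : q < n) :
    leafTokens (pathSwap f q hq) = leafTokens f := by
  funext p
  rw [leafTokens, leafTokens, pathSwap, Equiv.Perm.mul_apply, Equiv.swap_apply_of_ne_of_ne
    (leaf_ne_pathVtx _ _) (leaf_ne_pathVtx _ _)]

theorem pathTokens_pathSwap (q : ℕ) (hq : q < n) :
    ∃ pre post, pre.length = q ∧
      pathTokens f = pre ++ (f (pathVtx ⟨q, by omega⟩)).1 ::
        (f (pathVtx ⟨q + 1, by omega⟩)).1 :: post ∧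
      pathTokens (pathSwap f q hq) = pre ++ (f (pathVtx ⟨q + 1, by omega⟩)).1 ::
        (f (pathVtx ⟨q, by omega⟩)).1 :: post := by
  have hlen : ∀ g : Equiv.Perm (Vtx m n), (pathTokens g).length = n + 1 := by simp [pathTokens]
  have hsplit : ∀ (l : List ℤ) (h : q + 1 < l.length),
      l = l.take q ++ l[q] :: l[q + 1] :: l.drop (q + 2) := by
    intro l h
    conv_lhs => rw [← List.take_append_drop q l]
    rw [List.drop_eq_getElem_cons (by omega), List.drop_eq_getElem_cons (by omega)]
  have hget : ∀ (g : Equiv.Perm (Vtx m n)) (i : ℕ) (hi : i < (pathTokens g).length),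
      (pathTokens g)[i] = (g (pathVtx ⟨i, by rw [hlen] at hi; omega⟩)).1 := by
    intro g i hi
    exact getElem_pathTokens g i hi
  refine ⟨(pathTokens f).take q, (pathTokens f).drop (q + 2), ?_, ?_, ?_⟩
  · rw [List.length_take, hlen]; omega
  · conv_lhs => rw [hsplit (pathTokens f) (by rw [hlen]; omega)]
    rw [hget, hget]
  · have hne : ∀ (i : ℕ) (hi : i < n + 1), i ≠ q → i ≠ q + 1 →
        pathSwap f q hq (pathVtx ⟨i, hi⟩) = f (pathVtx ⟨i, hi⟩) := by
      intro i hi h1 h2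
      rw [pathSwap, Equiv.Perm.mul_apply, Equiv.swap_apply_of_ne_of_ne]
      · exact fun h => h1 (Fin.mk.inj_iff.1 (pathVtx_injective h))
      · exact fun h => h2 (Fin.mk.inj_iff.1 (pathVtx_injective h))
    rw [hsplit (pathTokens (pathSwap f q hq)) (by rw [hlen]; omega), hget, hget]
    congr 1
    · apply List.ext_getElem
      · simp [hlen]
      · intro i h1 h2
        rw [List.getElem_take, List.getElem_take, hget, hget, hne]
        all_goals
          rw [List.length_take] at h1
          omega
    · congr 1
      · simp [pathSwap]
      · congr 1
        · simp [pathSwap]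
        · apply List.ext_getElem
          · simp [hlen]
          · intro i h1 h2
            rw [List.getElem_drop, List.getElem_drop, hget, hget, hne]
            all_goals omega

theorem resolvesList_append {L : Fin m → ℤ} {j₁ j₂ : List ℤ} {l : List (ℤ × Bool)} :
    ResolvesList L (j₁ ++ j₂) l ↔
      ∃ l₁ l₂, l = l₁ ++ l₂ ∧ ResolvesList L j₁ l₁ ∧ ResolvesList L j₂ l₂ := by
  constructor
  · intro h
    refine ⟨l.take j₁.length, l.drop j₁.length, (List.take_append_drop ..).symm, ?_, ?_⟩
    · exact List.forall₂_take_append l j₁ j₂ h.flip |>.flip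
    · exact List.forall₂_drop_append l j₁ j₂ h.flip |>.flip
  · rintro ⟨l₁, l₂, rfl, h1, h2⟩
    exact List.rel_append h1 h2

theorem exists_resolvesList_pathSwap (q : ℕ) (hq : q < n) :
    ∃ pre x y post, ResolvesList (leafTokens f) (pathTokens f) (pre ++ x :: y :: post) ∧
      ResolvesList (leafTokens (pathSwap f q hq)) (pathTokens (pathSwap f q hq))
        (pre ++ y :: x :: post) ∧
      (∀ v ∈ pre.map Prod.fst, ∃ i : Fin (n + 1), (i : ℕ) < q ∧
        Resolves (leafTokens f) (f (pathVtx i)).1 v) ∧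
      (x.2 = decide ((f (pathVtx ⟨q, by omega⟩)).1 < 0) ∧
        Resolves (leafTokens f) (f (pathVtx ⟨q, by omega⟩)).1 x.1) ∧
      (y.2 = decide ((f (pathVtx ⟨q + 1, by omega⟩)).1 < 0) ∧
        Resolves (leafTokens f) (f (pathVtx ⟨q + 1, by omega⟩)).1 y.1) := by
  obtain ⟨l, hl⟩ := exists_resolvesList f
  obtain ⟨pre, post, hlen, h1, h2⟩ := pathTokens_pathSwap f q hq
  have hl' := hl
  rw [h1, resolvesList_append] at hl
  obtain ⟨lpre, l', rfl, hpre, hl⟩ := hl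
  obtain _ | @⟨_, x, _, _, hx, hl⟩ := hl
  obtain _ | @⟨_, y, _, lpost, hy, hl⟩ := hl
  refine ⟨lpre, x, y, lpost, hl', ?_, ?_, hx, hy⟩
  · rw [leafTokens_pathSwap, h2, resolvesList_append]
    exact ⟨_, _, rfl, hpre, .cons hy (.cons hx hl)⟩
  · intro v hv
    obtain ⟨z, hz, hr⟩ := hpre.of_mem_values hv
    obtain ⟨i, hi, rfl⟩ := List.mem_iff_getElem.1 hz
    refine ⟨⟨i, by omega⟩, by simpa [hlen] using hi, ?_⟩
    have : (f (pathVtx ⟨i, by omega⟩)).1 = pre[i] := by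
      have e : (pathTokens f)[i]'(by rw [h1, List.length_append]; omega) =
          (f (pathVtx ⟨i, by omega⟩)).1 := getElem_pathTokens f i _
      rw [← e]
      simp only [h1]
      rw [List.getElem_append_left hi]
    rw [this]
    exact hr

theorem pathSwap_pathSwap (q : ℕ) (hq : q < n) : pathSwap (pathSwap f q hq) q hq = f := by
  rw [pathSwap, pathSwap, mul_assoc, Equiv.swap_mul_self, mul_one]

/-- One unit is due to π and one to the exchange of two adjacent arrivals. -/
theorem abs_psiFun_pathSwap_le (q : ℕ) (hq : q < n) :
    |psiFun (pathSwap f q hq) - psiFun f| ≤ 2 := by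
  have hpi : |(piFun (pathSwap f q hq) : ℤ) - piFun f| ≤ 1 := by
    rw [abs_le]
    have hne : f (pathVtx ⟨q + 1, by omega⟩) ≠ f (pathVtx ⟨q, by omega⟩) := fun h => by
      have := Fin.mk.inj_iff.1 (pathVtx_injective (f.injective h)); omega
    rcases lt_or_gt_of_ne hne with h | h
    · obtain ⟨h1, h2, -⟩ := piFun_pathSwap f q hq h
      omega
    · obtain ⟨h1, h2, -⟩ := piFun_pathSwap (pathSwap f q hq) q hq (by simpa [pathSwap] using h)
      rw [pathSwap_pathSwap] at h1 h2
      omega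
  obtain ⟨pre, x, y, post, h1, h2, -⟩ := exists_resolvesList_pathSwap f q hq
  have hD := distinct_tokens f
  have := abs_discards_swap_le pre x y post (h1.valid hD.leaves hD.path hD.disjoint)
  rw [psiFun, psiFun, deltaFun_eq _ h1, deltaFun_eq _ h2, muFun_pathSwap]
  rw [abs_le] at *
  omega

/-- All vertices beyond `k` hold their tokens. -/
def SolvedAbove (k : ℤ) : Prop := ∀ v : Vtx m n, k < v.1 → f v = v

variable {f}

theorem SolvedAbove.le_of_apply {k : ℤ} (h : SolvedAbove f k) {v : Vtx m n} (hv : v.1 ≤ k) :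
    (f v).1 ≤ k := by
  by_contra hc
  have := f.injective (h (f v) (not_le.1 hc))
  rw [this] at hc
  exact hc hv

theorem SolvedAbove.lt_of_apply {k : ℤ} (h : SolvedAbove f k) {u v : Vtx m n} (hu : (f u).1 = k)
    (huv : v ≠ u) (hv : v.1 ≤ k) : (f v).1 < k :=
  lt_of_le_of_ne (h.le_of_apply hv) fun e =>
    huv (f.injective (Subtype.ext (e.trans hu.symm)))

/-- The counted tokens are on the path, and not beyond the vertex `k`, where all tokens are larger;
this leaves the `k + 1` vertices `0, …, k`. Hence the cap in π is not effective for the largest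
misplaced token. -/
theorem SolvedAbove.inv_le {k : Fin (n + 1)} (h : SolvedAbove f k) {q : Fin (n + 1)}
    (hq : f (pathVtx q) = pathVtx k) : inv f (pathVtx k) ≤ (k : ℕ) + 1 := by
  have hs : f.symm (pathVtx k) = pathVtx q := by rw [← hq, f.symm_apply_apply]
  have hsub : (fun i => (f.symm i).1) '' {i : Vtx m n | i < pathVtx k ∧
      f.symm i > f.symm (pathVtx k)} ⊆ (Finset.Icc 0 (k : ℤ) : Set ℤ) := by
    rintro _ ⟨i, ⟨h1, h2⟩, rfl⟩
    rw [hs] at h2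
    have h2 := Subtype.coe_lt_coe.2 h2
    have h1 := Subtype.coe_lt_coe.2 h1
    have h3 := pathVtx_nonneg (m := m) q
    have hk : (pathVtx k : Vtx m n).1 = k := rfl
    simp only [Finset.coe_Icc, Set.mem_Icc]
    refine ⟨by omega, ?_⟩
    by_contra hc
    have := h (f.symm i) (not_le.1 hc)
    rw [f.apply_symm_apply] at this
    rw [← this] at hc
    omega
  have hinj : Function.Injective fun i : Vtx m n => (f.symm i).1 :=
    Subtype.val_injective.comp f.symm.injective
  have := Set.ncard_le_ncard hsub (Set.toFinite _)
  rw [Set.ncard_image_of_injective _ hinj, Set.ncard_coe_finset, Int.card_Icc] at this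
  rw [inv]
  omega

/-- Moving the largest misplaced token along the path towards its goal lowers `Ψ` by one. -/
theorem psiFun_right {k : Fin (n + 1)} (h : SolvedAbove f k) {q : ℕ} (hq : q < n)
    (hqk : q < k) (hfq : f (pathVtx ⟨q, by omega⟩) = pathVtx k) :
    psiFun (pathSwap f q hq) = psiFun f - 1 := by
  have hkv : (pathVtx k : Vtx m n).1 = k := rfl
  have hpos : ∀ i : Fin (n + 1), (pathVtx i : Vtx m n).1 = i := fun _ => rfl
  have hfq' : (f (pathVtx ⟨q, by omega⟩)).1 = k := by rw [hfq]; rfl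
  have hless : ∀ v : Vtx m n, v.1 ≤ k → v.1 ≠ q → (f v).1 < k := fun v hv hne =>
    h.lt_of_apply hfq' (fun e => hne (by rw [e]; rfl)) hv
  have hlt : f (pathVtx ⟨q + 1, by omega⟩) < f (pathVtx ⟨q, by omega⟩) := by
    rw [← Subtype.coe_lt_coe, hfq']
    apply hless <;> rw [hpos] <;> push_cast <;> omega
  have hpi := (piFun_pathSwap f q hq hlt).2.2 k hfq (h.inv_le hfq)
  obtain ⟨pre, ⟨x, bx⟩, ⟨y, b⟩, post, h1, h2, hpre, ⟨hx1, hx2⟩, -, hy⟩ :=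
    exists_resolvesList_pathSwap f q hq
  simp only at hx1 hx2 hy
  have hleaf : ∀ p, leafTokens f p < k := by
    intro p
    have := leaf_neg (n := n) p
    apply hless <;> omega
  have hval : ∀ z w, Resolves (leafTokens f) z w → z < k → w < k := by
    intro z w hr hz
    by_cases h0 : 0 ≤ z
    · rw [hr.eq_of_nonneg h0]; exact hz
    · obtain ⟨p, rfl⟩ := hr.mem_range (by omega)
      exact hleaf p
  have hflag : ∀ w ∈ flagged (pre ++ (x, bx) :: (y, b) :: post), w < k := by
    intro w hw
    obtain ⟨z, -, hz, hr⟩ := h1.of_mem_flagged hw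
    exact hval z w hr (by omega)
  rw [hfq'] at hx1 hx2
  obtain rfl := hx2.eq_of_nonneg (by omega)
  obtain rfl : bx = false := by rw [hx1]; exact decide_eq_false (by omega)
  have hpre' : ∀ w ∈ pre.map Prod.fst, w < k := by
    intro w hw
    obtain ⟨i, hi, hr⟩ := hpre w hw
    apply hval _ _ hr
    apply hless <;> rw [hpos] <;> omega
  have hyk : y < k := by
    apply hval _ _ hy
    apply hless <;> rw [hpos] <;> push_cast <;> omega
  -- The value `k` is unflagged and exceeds whatever precedes it and all flagged values. It can be
  -- erased both before and after the swap, and the two lists then agree.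
  have e1 : discards (pre ++ (((k : ℕ) : ℤ), false) :: (y, b) :: post) =
      discards (pre ++ (y, b) :: post) := by
    apply discards_erase _ _ _ (by omega) hpre'
    intro w hw
    apply hflag
    simp only [flagged_append, List.mem_append, flagged_cons_false]
    exact Or.inr hw
  have e2 : discards (pre ++ (y, b) :: (((k : ℕ) : ℤ), false) :: post) =
      discards (pre ++ (y, b) :: post) := by
    have := discards_erase k (pre ++ [(y, b)]) post (by omega)
      (by
        intro w hw
        simp only [List.map_append, List.mem_append, List.map_cons, List.map_nil,
          List.mem_singleton] at hw
        rcases hw with hw | rfl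
        · exact hpre' w hw
        · exact hyk)
      (by
        intro w hw
        apply hflag
        rw [mem_flagged] at hw ⊢
        simp [hw])
    simpa using this
  rw [psiFun, psiFun, deltaFun_eq _ h1, deltaFun_eq _ h2, muFun_pathSwap, e1, e2, hpi]
  push_cast
  ring

end StarPath

namespace StarPath

open TokenSwapping

variable {m n : ℕ}

/-! ### Paths in the star-path graph -/

theorem adj_origin_leaf (p : Fin m) : (graph m n).Adj (origin m n) (leaf p) :=
  Or.inr (Or.inl ⟨leaf_neg p, rfl⟩)

theorem adj_pathVtx (q : ℕ) (hq : q < n) :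
    (graph m n).Adj (pathVtx ⟨q, by omega⟩) (pathVtx ⟨q + 1, by omega⟩) :=
  Or.inr (Or.inr (Or.inl ⟨pathVtx_nonneg _, by simp [pathVtx]⟩))

theorem edge_cases {e : Sym2 (Vtx m n)} (he : e ∈ (graph m n).edgeSet) :
    (∃ p : Fin m, e = s(origin m n, leaf p)) ∨
      ∃ (q : ℕ) (hq : q < n), e = s(pathVtx ⟨q, by omega⟩, pathVtx ⟨q + 1, by omega⟩) := by
  induction e using Sym2.ind with
  | _ u v =>
    rw [SimpleGraph.mem_edgeSet] at he
    have key : ∀ u v : Vtx m n, 0 ≤ u.1 → v.1 = u.1 + 1 → ∃ (q : ℕ) (hq : q < n),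
        u = pathVtx ⟨q, by omega⟩ ∧ v = pathVtx ⟨q + 1, by omega⟩ := by
      intro u v hu hv
      have := v.2.2
      exact ⟨u.1.toNat, by omega, Subtype.ext (by simp only [pathVtx]; omega),
        Subtype.ext (by simp only [pathVtx]; push_cast; omega)⟩
    rcases he with ⟨h1, h2⟩ | ⟨h1, h2⟩ | ⟨h1, h2⟩ | ⟨h1, h2⟩
    · obtain ⟨p, rfl⟩ := exists_leaf_of_neg h1
      obtain rfl : v = origin m n := Subtype.ext h2
      exact Or.inl ⟨p, Sym2.eq_swap⟩
    · obtain ⟨p, rfl⟩ := exists_leaf_of_neg h1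
      obtain rfl : u = origin m n := Subtype.ext h2
      exact Or.inl ⟨p, rfl⟩
    · obtain ⟨q, hq, rfl, rfl⟩ := key u v h1 h2
      exact Or.inr ⟨q, hq, rfl⟩
    · obtain ⟨q, hq, rfl, rfl⟩ := key v u h1 h2
      exact Or.inr ⟨q, hq, Sym2.eq_swap⟩

/-- All the swaps are edges, and each of them lowers `Ψ` by one. -/
def Descends (f : Equiv.Perm (Vtx m n)) : List (Sym2 (Vtx m n)) → Prop
  | [] => True
  | e :: es => e ∈ (graph m n).edgeSet ∧ psiFun (applySwap f e) = psiFun f - 1 ∧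
      Descends (applySwap f e) es

theorem applySwaps_nil (f : Equiv.Perm (Vtx m n)) : applySwaps f [] = f := rfl

theorem applySwaps_cons (f : Equiv.Perm (Vtx m n)) (e : Sym2 (Vtx m n))
    (es : List (Sym2 (Vtx m n))) : applySwaps f (e :: es) = applySwaps (applySwap f e) es := rfl

theorem applySwaps_append (f : Equiv.Perm (Vtx m n)) (es es' : List (Sym2 (Vtx m n))) :
    applySwaps f (es ++ es') = applySwaps (applySwaps f es) es' := List.foldl_append

theorem Descends.append {f : Equiv.Perm (Vtx m n)} {es es' : List (Sym2 (Vtx m n))}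
    (h : Descends f es) (h' : Descends (applySwaps f es) es') : Descends f (es ++ es') := by
  induction es generalizing f with
  | nil => exact h'
  | cons e es ih => exact ⟨h.1, h.2.1, ih h.2.2 h'⟩

theorem Descends.psiFun_eq {f : Equiv.Perm (Vtx m n)} {es : List (Sym2 (Vtx m n))}
    (h : Descends f es) : psiFun (applySwaps f es) = psiFun f - es.length := by
  induction es generalizing f with
  | nil => simp [applySwaps_nil]
  | cons e es ih =>
    rw [applySwaps_cons, ih h.2.2, h.2.1]
    push_cast [List.length_cons]
    ring

theorem Descends.edge {f : Equiv.Perm (Vtx m n)} {es : List (Sym2 (Vtx m n))}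
    (h : Descends f es) : ∀ e ∈ es, e ∈ (graph m n).edgeSet := by
  induction es generalizing f with
  | nil => simp
  | cons e es ih => exact List.forall_mem_cons.2 ⟨h.1, ih h.2.2⟩

theorem Descends.take {f : Equiv.Perm (Vtx m n)} {es : List (Sym2 (Vtx m n))}
    (h : Descends f es) (i : ℕ) (hi : i < es.length) :
    psiFun (applySwaps f (es.take (i + 1))) = psiFun (applySwaps f (es.take i)) - 1 := by
  induction es generalizing f i with
  | nil => simp at hi
  | cons e es ih =>
    cases i with
    | zero => simpa [applySwaps_cons, applySwaps_nil] using h.2.1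
    | succ i => simpa [applySwaps_cons] using ih h.2.2 i (by simpa using hi)

/-- Moving the largest misplaced token along the path to its goal. -/
theorem exists_path_right (d : ℕ) {f : Equiv.Perm (Vtx m n)} {u v : Vtx m n} (hu : 0 ≤ u.1)
    (huv : v.1 = u.1 + d) (hf : SolvedAbove f v.1) (hfu : f u = v) :
    ∃ w : (graph m n).Walk u v, w.IsPath ∧ (∀ x ∈ w.support, u.1 ≤ x.1) ∧
      Descends f w.edges ∧ w.edges.length = d ∧
      applySwaps f w.edges v = v ∧ (∀ x : Vtx m n, x.1 < u.1 → applySwaps f w.edges x = f x) ∧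
      (∀ x : Vtx m n, v.1 < x.1 → applySwaps f w.edges x = x) ∧
      ∀ x y : Vtx m n, u.1 ≤ x.1 → x.1 < v.1 → y.1 = x.1 + 1 →
        applySwaps f w.edges x = f y := by
  induction d generalizing f u with
  | zero =>
    obtain rfl : v = u := Subtype.ext (by simpa using huv)
    refine ⟨.nil, .nil, ?_, trivial, rfl, hfu, fun x _ => rfl, fun x hx => hf x hx, ?_⟩
    · intro x hx
      rw [SimpleGraph.Walk.support_nil, List.mem_singleton] at hx
      rw [hx]
    · intro x y h1 h2
      omega
  | succ d ih =>
    obtain ⟨⟨q, hq⟩, rfl⟩ := exists_pathVtx_of_nonneg hu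
    obtain ⟨k, rfl⟩ := exists_pathVtx_of_nonneg (v := v) (by omega)
    have hqv : ∀ i : Fin (n + 1), (pathVtx i : Vtx m n).1 = i := fun _ => rfl
    have hkv := hqv k
    have hqv' : (pathVtx ⟨q, hq⟩ : Vtx m n).1 = q := rfl
    have hk := k.2
    have hqn : q < n := by omega
    set u' : Vtx m n := pathVtx ⟨q + 1, by omega⟩ with hu'
    have hu'v : u'.1 = q + 1 := by simp [hu', pathVtx]
    have hswap : applySwap f s(pathVtx ⟨q, hq⟩, u') = pathSwap f q hqn := rfl
    have hne : ∀ x : Vtx m n, x.1 ≠ q → x.1 ≠ q + 1 → pathSwap f q hqn x = f x := by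
      intro x h1 h2
      rw [pathSwap, Equiv.Perm.mul_apply, Equiv.swap_apply_of_ne_of_ne]
      · rintro rfl; exact h1 rfl
      · rintro rfl; exact h2 hu'v
    have hnext : pathSwap f q hqn u' = pathVtx k := by
      rw [pathSwap, Equiv.Perm.mul_apply, Equiv.swap_apply_right, hfu]
    have hfirst : pathSwap f q hqn (pathVtx ⟨q, hq⟩) = f u' := by
      rw [pathSwap, Equiv.Perm.mul_apply, Equiv.swap_apply_left]
    obtain ⟨w, h1, h2, h3, h4, h5, h6, h7, h8⟩ := ih (f := pathSwap f q hqn) (u := u')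
      (by omega) (by omega)
      (fun x hx => by rw [hne x (by omega) (by omega)]; exact hf x hx) hnext
    refine ⟨.cons (adj_pathVtx q hqn) w, ?_, ?_, ?_, ?_, ?_⟩
    · refine h1.cons fun hm => ?_
      have := h2 _ hm
      omega
    · intro x hx
      rw [SimpleGraph.Walk.support_cons, List.mem_cons] at hx
      rcases hx with rfl | hx
      · exact le_rfl
      · have := h2 x hx
        omega
    · rw [SimpleGraph.Walk.edges_cons]
      exact ⟨adj_pathVtx q hqn, psiFun_right hf hqn (by omega) hfu, h3⟩
    · rw [SimpleGraph.Walk.edges_cons, List.length_cons, h4]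
    · rw [SimpleGraph.Walk.edges_cons, applySwaps_cons, hswap]
      refine ⟨h5, fun x hx => ?_, h7, fun x y hx1 hx2 hy => ?_⟩
      · rw [h6 x (by omega), hne x (by omega) (by omega)]
      · by_cases hxq : x.1 = q
        · obtain rfl : x = pathVtx ⟨q, hq⟩ := Subtype.ext hxq
          obtain rfl : y = u' := Subtype.ext (by omega)
          rw [h6 _ (by omega), hfirst]
        · rw [h8 x y (by omega) hx2 hy, hne y (by omega) (by omega)]

theorem graph_connected : (graph m n).Connected := by
  have h : ∀ v, (graph m n).Reachable (origin m n) v := by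
    intro v
    by_cases hv : v.1 < 0
    · obtain ⟨p, rfl⟩ := exists_leaf_of_neg hv
      exact (adj_origin_leaf p).reachable
    · obtain ⟨q, rfl⟩ := exists_pathVtx_of_nonneg (not_lt.1 hv)
      obtain ⟨q, hq⟩ := q
      induction q with
      | zero => exact pathVtx_zero (m := m) (n := n) ▸ SimpleGraph.Reachable.refl _
      | succ q ih =>
        exact (ih (by omega) (not_lt.2 (pathVtx_nonneg _))).trans
          (adj_pathVtx q (by omega)).reachable
  have : Nonempty (Vtx m n) := ⟨origin m n⟩
  exact ⟨fun u v => (h u).symm.trans (h v)⟩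

/-- The graph is connected, and it has at most as many edges as vertices other than `0`: an edge is
determined by its end that is farther from `0`. -/
theorem graph_isAcyclic : (graph m n).IsAcyclic := by
  refine (SimpleGraph.isTree_iff_connected_and_card.2 ⟨graph_connected, ?_⟩).isAcyclic
  have hle := (graph_connected (m := m) (n := n)).card_vert_le_card_edgeSet_add_one
  have hlt : Nat.card (graph m n).edgeSet ≤ Nat.card {v : Vtx m n // v ≠ origin m n} := by
    have hcases : ∀ e : (graph m n).edgeSet, ∃ v : {v : Vtx m n // v ≠ origin m n},
        e.1 = if h : v.1.1 ≤ 0 then s(origin m n, v.1)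
          else s(⟨v.1.1 - 1, by have := v.1.2.2; constructor <;> omega⟩, v.1) := by
      rintro ⟨e, he⟩
      rcases edge_cases he with ⟨p, rfl⟩ | ⟨q, hq, rfl⟩
      · exact ⟨⟨leaf p, leaf_ne_origin p⟩, by simp only [dif_pos (leaf_neg p).le]⟩
      · have h1 : (pathVtx ⟨q + 1, by omega⟩ : Vtx m n).1 = q + 1 := by simp [pathVtx]
        refine ⟨⟨pathVtx ⟨q + 1, by omega⟩, fun h => ?_⟩, ?_⟩
        · rw [h] at h1; simp only [origin] at h1; omega
        · simp only [h1]
          rw [dif_neg (by omega)]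
          congr 2
          exact Subtype.ext (by simp [pathVtx])
    choose φ hφ using hcases
    refine Nat.card_le_card_of_injective φ fun e e' h => Subtype.ext ?_
    rw [hφ e, hφ e', h]
  have hcard : Nat.card {v : Vtx m n // v ≠ origin m n} + 1 = Nat.card (Vtx m n) := by
    have := Set.ncard_sdiff_singleton_add_one (Set.mem_univ (origin m n)) (Set.toFinite _)
    have e : (Set.univ \ {origin m n} : Set (Vtx m n)) = {v | v ≠ origin m n} := by ext; simp
    rw [Set.ncard_univ, e] at this
    exact this
  omega

end StarPath

namespace StarPath

open TokenSwapping

variable {m n : ℕ}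

/-! ### The runs of the algorithm -/

/-- Paths in a tree are unique, so any path that one can exhibit is the one taken by the algorithm.
In particular the algorithm is deterministic. -/
theorem Moves.eq_of_isPath {k u : Vtx m n} {f g : Equiv.Perm (Vtx m n)}
    {es : List (Sym2 (Vtx m n))} (h : Moves k f es g) (hu : f.symm k = u)
    (w : (graph m n).Walk u k) (hw : w.IsPath) : es = w.edges ∧ g = applySwaps f w.edges := by
  subst hu
  obtain ⟨⟨p, hp, rfl⟩, rfl⟩ := h
  have := congrArg Subtype.val
    ((graph_isAcyclic.subsingleton_path _ _).elim ⟨p, hp⟩ ⟨w, hw⟩)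
  simp only at this
  exact ⟨by rw [this], by rw [this]⟩

theorem exists_moves (k : Vtx m n) (f : Equiv.Perm (Vtx m n)) : ∃ es g, Moves k f es g := by
  classical
  obtain ⟨w⟩ := (graph_connected (m := m) (n := n)).preconnected (f.symm k) k
  exact ⟨_, _, ⟨w.toPath, w.toPath.2, rfl⟩, rfl⟩

theorem moves_home {f g : Equiv.Perm (Vtx m n)} {es : List (Sym2 (Vtx m n))} {p : Fin m}
    (h : f (origin m n) = leaf p) (hm : Moves (f (origin m n)) f es g) :
    es = [s(origin m n, leaf p)] ∧ g = leafSwap f p := by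
  rw [h] at hm
  have hu : f.symm (leaf p) = origin m n := by rw [← h, f.symm_apply_apply]
  have := hm.eq_of_isPath hu (.cons (adj_origin_leaf p) .nil)
    (SimpleGraph.Walk.IsPath.nil.cons (by simpa using (leaf_ne_origin p).symm))
  simpa [applySwaps_cons, applySwaps_nil, applySwap_leaf] using this

theorem descends_home {f : Equiv.Perm (Vtx m n)} {p : Fin m} (h : f (origin m n) = leaf p) :
    Descends f [s(origin m n, leaf p)] :=
  ⟨adj_origin_leaf p, psiFun_home f p h, trivial⟩

theorem leafSwap_fixed {f : Equiv.Perm (Vtx m n)} {p : Fin m} (h : f (origin m n) = leaf p)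
    {v : Vtx m n} (hv : f v = v) (h0 : v ≠ origin m n) : leafSwap f p v = v := by
  rw [leafSwap_of_ne f p h0, hv]
  rintro rfl
  exact h0 (f.injective (hv.trans h.symm))

theorem WhileRun.spec {f g : Equiv.Perm (Vtx m n)} {es : List (Sym2 (Vtx m n))}
    (h : WhileRun f es g) : Descends f es ∧ g = applySwaps f es ∧ 0 ≤ (g (origin m n)).1 ∧
      ∀ v, v ≠ origin m n → f v = v → g v = v := by
  induction h with
  | done f h => exact ⟨trivial, rfl, h, fun v _ h => h⟩
  | step f g g' es es' h hm hw ih =>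
    obtain ⟨p, hp⟩ := exists_leaf_of_neg h
    obtain ⟨rfl, rfl⟩ := moves_home hp hm
    obtain ⟨h1, h2, h3, h4⟩ := ih
    refine ⟨(descends_home hp).append h1, ?_, h3, fun v hv hfv => ?_⟩
    · rw [applySwaps_append]; exact h2
    · exact h4 v hv (leafSwap_fixed hp hfv hv)

/-- Each round brings one token home and displaces no other negative token from its goal, so the
number of misplaced negative tokens decreases. -/
theorem exists_whileRun (f : Equiv.Perm (Vtx m n)) : ∃ es g, WhileRun f es g := by
  induction hN : (misplacedNeg f).ncard using Nat.strong_induction_on generalizing f with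
  | _ N ih =>
    by_cases h : 0 ≤ (f (origin m n)).1
    · exact ⟨_, _, .done f h⟩
    · obtain ⟨p, hp⟩ := exists_leaf_of_neg (not_le.1 h)
      obtain ⟨es, g, hm⟩ := exists_moves (f (origin m n)) f
      obtain ⟨-, rfl⟩ := moves_home hp hm
      have hlt : (misplacedNeg (leafSwap f p)).ncard < N := by
        rw [← hN]
        refine Set.ncard_lt_ncard ?_ (Set.toFinite _)
        rw [Set.ssubset_iff_of_subset]
        · refine ⟨leaf p, mem_misplacedNeg.2 ⟨leaf_neg p, fun e => ?_⟩, fun hm => ?_⟩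
          · exact leaf_ne_origin p (f.injective (e.trans hp.symm))
          · exact (mem_misplacedNeg.1 hm).2 (by rw [leafSwap_leaf, hp])
        · intro t ht
          obtain ⟨h1, h2⟩ := mem_misplacedNeg.1 ht
          refine mem_misplacedNeg.2 ⟨h1, fun e => h2 ?_⟩
          exact leafSwap_fixed hp e (by rintro rfl; simp [origin] at h1)
      obtain ⟨es', g', hw⟩ := ih _ hlt _ rfl
      exact ⟨_, _, .step _ _ _ _ _ (not_le.1 h) hm hw⟩

theorem exists_forRun (ks : List (Vtx m n)) (f : Equiv.Perm (Vtx m n)) :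
    ∃ es g, ForRun ks f es g := by
  induction ks generalizing f with
  | nil => exact ⟨_, _, .nil f⟩
  | cons k ks ih =>
    obtain ⟨es, g, hw⟩ := exists_whileRun f
    obtain ⟨es', g', hm⟩ := exists_moves k g
    obtain ⟨es'', g'', hf⟩ := ih g'
    exact ⟨_, _, .cons _ _ _ _ _ _ _ _ _ hw hm hf⟩

theorem SolvedAbove.whileRun {f g : Equiv.Perm (Vtx m n)} {es : List (Sym2 (Vtx m n))} {k : ℤ}
    (hf : SolvedAbove f k) (hk : 0 ≤ k) (h : WhileRun f es g) : SolvedAbove g k := by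
  intro v hv
  refine h.spec.2.2.2 v ?_ (hf v hv)
  rintro rfl
  simp only [origin] at hv
  omega

/-- Moving the largest misplaced token, from a leaf or from a vertex of the path. -/
theorem exists_path_max {f : Equiv.Perm (Vtx m n)} {k : Vtx m n} (hk : 0 ≤ k.1)
    (hf : SolvedAbove f k.1) (h0 : 0 ≤ (f (origin m n)).1) :
    ∃ w : (graph m n).Walk (f.symm k) k, w.IsPath ∧ Descends f w.edges ∧
      SolvedAbove (applySwaps f w.edges) (k.1 - 1) ∧
      (∀ p, f.symm k ≠ leaf p → leafTokens (applySwaps f w.edges) p = leafTokens f p) ∧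
      (∀ p, f.symm k = leaf p →
        leafTokens (applySwaps f w.edges) p = (f (origin m n)).1) ∧
      (∀ x : Vtx m n, 0 ≤ x.1 → x.1 < k.1 → x.1 < (f.symm k).1 →
        applySwaps f w.edges x = f x) ∧
      (∀ x y : Vtx m n, 0 ≤ x.1 → x.1 < k.1 → (f.symm k).1 ≤ x.1 → y.1 = x.1 + 1 →
        applySwaps f w.edges x = f y) ∧
      (w.edges.length : ℤ) = if 0 ≤ (f.symm k).1 then k.1 - (f.symm k).1 else k.1 + 1 := by
  -- The optimality proof needs only that the walk is a path, the descent of Ψ and `SolvedAbove`.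
  -- The clauses about the new tokens and about the length serve the simulation on stacks.
  have hfk : f (f.symm k) = k := f.apply_symm_apply k
  generalize hu : f.symm k = u at *
  have hsolved : ∀ g : Equiv.Perm (Vtx m n), g k = k → (∀ x : Vtx m n, k.1 < x.1 → g x = x) →
      SolvedAbove g (k.1 - 1) := by
    intro g h1 h2 x hx
    rcases eq_or_lt_of_le (show k.1 ≤ x.1 by omega) with h | h
    · rw [← Subtype.ext h, h1]
    · exact h2 x h
  by_cases h0u : 0 ≤ u.1
  · have huk : u.1 ≤ k.1 := by
      by_contra hc
      have := hf u (not_le.1 hc)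
      rw [hfk] at this
      rw [this] at hc
      exact hc le_rfl
    obtain ⟨w, h1, h2, h3, h4, h5, h6, h7, h8⟩ :=
      exists_path_right (k.1 - u.1).toNat h0u (by omega) hf hfk
    refine ⟨w, h1, h3, hsolved _ h5 h7, fun p _ => ?_, fun p hp => ?_, fun x _ _ hx => h6 x hx,
      fun x y _ hx hux hy => h8 x y hux hx hy, ?_⟩
    · rw [leafTokens, h6 _ (by have := leaf_neg (n := n) p; omega)]; rfl
    · have := leaf_neg (n := n) p
      rw [hp] at h0u
      omega
    · rw [h4, if_pos h0u]
      omega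
  · obtain ⟨p, rfl⟩ := exists_leaf_of_neg (not_le.1 h0u)
    have hfp : leafTokens f p = k.1 := by rw [leafTokens, hfk]
    have hlt : (f (origin m n)).1 < k.1 :=
      hf.lt_of_apply (u := leaf p) (by rw [hfk]) (leaf_ne_origin p).symm hk
    have hmax : ∀ q, leafTokens f q ≤ leafTokens f p := by
      intro q
      rw [hfp]
      have := leaf_neg (n := n) q
      exact hf.le_of_apply (by omega)
    have hne : ∀ x : Vtx m n, 0 < x.1 → leafSwap f p x = f x := by
      intro x hx
      apply leafSwap_of_ne
      · rintro rfl; simp [origin] at hx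
      · rintro rfl; have := leaf_neg (n := n) p; omega
    have ho : (origin m n).1 = 0 := rfl
    obtain ⟨w, h1, h2, h3, h4, h5, h6, h7, h8⟩ :=
      exists_path_right (f := leafSwap f p) (u := origin m n) (v := k) k.1.toNat le_rfl (by omega)
      (fun x hx => by rw [hne x (by omega)]; exact hf x hx) (by rw [leafSwap_origin, hfk])
    have hswap : applySwap f s(leaf p, origin m n) = leafSwap f p := by
      rw [Sym2.eq_swap]; rfl
    refine ⟨.cons (adj_origin_leaf p).symm w, h1.cons fun hm => ?_, ?_, ?_⟩
    · have := h2 _ hm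
      have := leaf_neg (n := n) p
      omega
    · rw [SimpleGraph.Walk.edges_cons]
      refine ⟨(adj_origin_leaf p).symm, ?_, ?_⟩
      · rw [hswap]
        exact psiFun_out f p h0 (by rw [hfp]; exact hlt) hmax
      · rw [hswap]; exact h3
    · rw [SimpleGraph.Walk.edges_cons, applySwaps_cons, hswap]
      refine ⟨hsolved _ h5 h7, fun q hq => ?_, fun q hq => ?_, fun x h1 h2 h3 => ?_,
        fun x y hx hxk _ hy => ?_, ?_⟩
      · have hqp : q ≠ p := fun e => hq (by rw [e])
        rw [leafTokens, h6 _ (leaf_neg q), ← leafTokens, leafTokens_leafSwap,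
          Function.update_of_ne hqp]
      · rw [leafTokens, h6 _ (leaf_neg q), ← leaf_injective hq, leafSwap_leaf]
      · have := leaf_neg (n := n) p
        omega
      · rw [h8 x y hx hxk hy, hne y (by omega)]
      · rw [List.length_cons, h4, if_neg h0u]
        push_cast
        omega

theorem Moves.max_spec {f g : Equiv.Perm (Vtx m n)} {k : Vtx m n} {es : List (Sym2 (Vtx m n))}
    (hk : 0 ≤ k.1) (hf : SolvedAbove f k.1) (h0 : 0 ≤ (f (origin m n)).1) (h : Moves k f es g) :
    Descends f es ∧ g = applySwaps f es ∧ SolvedAbove g (k.1 - 1) := by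
  obtain ⟨w, h1, h2, h3, -⟩ := exists_path_max hk hf h0
  obtain ⟨rfl, rfl⟩ := h.eq_of_isPath rfl w h1
  exact ⟨h2, rfl, h3⟩

/-- If the whole path is solved, only negative tokens remain for the leaves, so no chain that starts
there ever resolves. -/
theorem negCycle_of_solved {f : Equiv.Perm (Vtx m n)} (hf : SolvedAbove f (-1)) {p : Fin m}
    (hp : f (leaf p) ≠ leaf p) : NegCycle f p := by
  rw [negCycle_iff]
  refine ⟨fun x hx => ?_, hp⟩
  have hneg : ∀ q, leafTokens f q < 0 := by
    intro q
    have := leaf_neg (n := n) q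
    have := hf.le_of_apply (v := leaf q) (by omega)
    have h2 : leafTokens f q = (f (leaf q)).1 := rfl
    omega
  obtain ⟨q, rfl⟩ := hx.mem_range (hneg p)
  exact absurd hx.le (not_le.2 (hneg q))

theorem solved_of_origin {f : Equiv.Perm (Vtx m n)} (hf : SolvedAbove f 0)
    (h0 : 0 ≤ (f (origin m n)).1) : SolvedAbove f (-1) := by
  intro v hv
  by_cases h : 0 < v.1
  · exact hf v h
  · obtain rfl : v = origin m n := Subtype.ext (by simp only [origin]; omega)
    have := hf.le_of_apply (v := origin m n) le_rfl
    exact Subtype.ext (by simp only [origin] at *; omega)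

/-- A token on a wrong leaf takes two swaps through the vertex `0`: the first breaks up its negative
cycle, the second brings it home. A token on its own leaf is moved along the trivial path. -/
theorem Moves.leaf_spec {f g : Equiv.Perm (Vtx m n)} {p : Fin m} {es : List (Sym2 (Vtx m n))}
    (hf : SolvedAbove f (-1)) (h : Moves (leaf p) f es g) :
    Descends f es ∧ g = applySwaps f es ∧ g (leaf p) = leaf p ∧
      ∀ v, v ≠ origin m n → f v = v → g v = v := by
  have hu : f (f.symm (leaf p)) = leaf p := f.apply_symm_apply _
  have hneg : (f.symm (leaf p)).1 < 0 := by
    by_contra hc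
    have := hf (f.symm (leaf p)) (by omega)
    rw [hu] at this
    rw [← this] at hc
    exact hc (leaf_neg p)
  obtain ⟨q, hq⟩ := exists_leaf_of_neg hneg
  rw [hq] at hu
  by_cases hqp : q = p
  · subst hqp
    obtain ⟨rfl, rfl⟩ := h.eq_of_isPath hq .nil .nil
    exact ⟨trivial, rfl, hu, fun v _ h => h⟩
  · have hne : (leaf q : Vtx m n) ≠ leaf p := fun e => hqp (leaf_injective e)
    obtain ⟨rfl, rfl⟩ := h.eq_of_isPath hq
      (.cons (adj_origin_leaf q).symm (.cons (adj_origin_leaf p) .nil))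
      (by simp [SimpleGraph.Walk.cons_isPath_iff, leaf_ne_origin, (leaf_ne_origin p).symm, hne])
    have hswap : applySwap f s(leaf q, origin m n) = leafSwap f q := by
      rw [Sym2.eq_swap]; rfl
    have hhome : leafSwap f q (origin m n) = leaf p := by rw [leafSwap_origin, hu]
    simp only [SimpleGraph.Walk.edges_cons, SimpleGraph.Walk.edges_nil]
    rw [applySwaps_cons, hswap, applySwaps_cons, applySwaps_nil, applySwap_leaf]
    refine ⟨⟨(adj_origin_leaf q).symm, ?_, ?_⟩, trivial, ?_, fun v hv hfv => ?_⟩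
    · rw [hswap]
      exact psiFun_extract f q (negCycle_of_solved hf (by rw [hu]; exact hne.symm))
    · rw [hswap]
      exact descends_home hhome
    · rw [leafSwap_leaf, hhome]
    · apply leafSwap_fixed hhome _ hv
      rw [leafSwap_of_ne f q hv, hfv]
      rintro rfl
      exact hne (hfv.symm.trans hu)

theorem ForRun.of_append {ks ks' : List (Vtx m n)} {f g : Equiv.Perm (Vtx m n)}
    {es : List (Sym2 (Vtx m n))} (h : ForRun (ks ++ ks') f es g) :
    ∃ es₁ es₂ h, es = es₁ ++ es₂ ∧ ForRun ks f es₁ h ∧ ForRun ks' h es₂ g := by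
  induction ks generalizing f es with
  | nil => exact ⟨[], es, f, rfl, .nil f, h⟩
  | cons k ks ih =>
    obtain _ | ⟨_, _, _, g₁, g₂, _, es₁, es₂, es₃, hw, hm, hf⟩ := h
    obtain ⟨es₄, es₅, g₃, rfl, h1, h2⟩ := ih hf
    exact ⟨_, _, g₃, by simp only [List.append_assoc], .cons _ _ _ _ _ _ _ _ _ hw hm h1, h2⟩

theorem ForRun.path_spec (k : ℕ) (hk : k ≤ n + 1) {f g : Equiv.Perm (Vtx m n)}
    {es : List (Sym2 (Vtx m n))} (hf : SolvedAbove f (k - 1))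
    (h : ForRun (List.ofFn fun q : Fin k => (pathVtx ⟨q, by omega⟩ : Vtx m n)).reverse f es g) :
    Descends f es ∧ g = applySwaps f es ∧ SolvedAbove g (-1) := by
  induction k generalizing f es with
  | zero =>
    simp only [List.ofFn_zero, List.reverse_nil] at h
    cases h
    exact ⟨trivial, rfl, by simpa using hf⟩
  | succ k ih =>
    rw [List.ofFn_succ', List.concat_eq_append, List.reverse_append, List.reverse_singleton,
      List.singleton_append] at h
    obtain _ | ⟨_, _, _, g₁, g₂, _, es₁, es₂, es₃, hw, hm, hfr⟩ := h
    have hkv : (pathVtx ⟨k, by omega⟩ : Vtx m n).1 = k := rfl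
    have hf' : SolvedAbove f (k : ℤ) := by
      have e : ((k + 1 : ℕ) : ℤ) - 1 = k := by push_cast; ring
      rwa [e] at hf
    obtain ⟨h1, rfl, h3, -⟩ := hw.spec
    obtain ⟨h4, rfl, h6⟩ := Moves.max_spec (k := pathVtx ⟨k, by omega⟩) (pathVtx_nonneg _)
      (hf'.whileRun (by omega) hw) h3 hm
    obtain ⟨h7, rfl, h9⟩ := ih (by omega) h6 hfr
    refine ⟨(h1.append h4).append (by rwa [applySwaps_append]), ?_, h9⟩
    rw [applySwaps_append, applySwaps_append]

/-- Between two rounds the vertex `0` may hold a negative token, so only the positive vertices are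
assumed to be solved; the while loop of the next round restores the token `0`. Leaves that are
already correct stay so. -/
theorem ForRun.leaf_spec (ks : List (Fin m)) {f g : Equiv.Perm (Vtx m n)}
    {es : List (Sym2 (Vtx m n))} (hf : SolvedAbove f 0)
    (h : ForRun (ks.map leaf) f es g) :
    Descends f es ∧ g = applySwaps f es ∧ SolvedAbove g 0 ∧
      ∀ p, f (leaf p) = leaf p ∨ p ∈ ks → g (leaf p) = leaf p := by
  induction ks generalizing f es with
  | nil =>
    cases h
    exact ⟨trivial, rfl, hf, fun p hp => by simpa using hp⟩
  | cons k ks ih =>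
    obtain _ | ⟨_, _, _, g₁, g₂, _, es₁, es₂, es₃, hw, hm, hfr⟩ := h
    obtain ⟨h1, rfl, h3, hfix⟩ := hw.spec
    have hs := hf.whileRun le_rfl hw
    obtain ⟨h4, rfl, h6, hfix'⟩ := Moves.leaf_spec (solved_of_origin hs h3) hm
    have hs' : SolvedAbove (applySwaps (applySwaps f es₁) es₂) 0 := by
      intro v hv
      exact hfix' v (by rintro rfl; simp [origin] at hv) (hs v hv)
    obtain ⟨h7, rfl, h9, h10⟩ := ih hs' hfr
    refine ⟨(h1.append h4).append (by rwa [applySwaps_append]), ?_, h9, fun p hp => ?_⟩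
    · rw [applySwaps_append, applySwaps_append]
    · apply h10
      rcases hp with hp | hp
      · exact Or.inl (hfix' _ (leaf_ne_origin p) (hfix _ (leaf_ne_origin p) hp))
      · rcases List.mem_cons.1 hp with rfl | hp
        · exact Or.inl h6
        · exact Or.inr hp

theorem eq_one_of_solved {f : Equiv.Perm (Vtx m n)} (hf : SolvedAbove f 0)
    (hl : ∀ p : Fin m, f (leaf p) = leaf p) : f = 1 := by
  have h1 : ∀ v, v ≠ origin m n → f v = v := by
    intro v hv
    rcases lt_trichotomy v.1 0 with h | h | h
    · obtain ⟨p, rfl⟩ := exists_leaf_of_neg h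
      exact hl p
    · exact absurd (Subtype.ext h) hv
    · exact hf v h
  ext1 v
  by_cases hv : v = origin m n
  · subst hv
    by_contra hc
    exact hc (f.injective (h1 _ hc))
  · exact h1 v hv

theorem AlgorithmRun.spec {f : Equiv.Perm (Vtx m n)} {es : List (Sym2 (Vtx m n))}
    (h : AlgorithmRun f es) : Descends f es ∧ applySwaps f es = 1 := by
  obtain ⟨g, h⟩ := h
  obtain ⟨es₁, es₂, g₁, rfl, h1, h2⟩ := h.of_append
  have hf : SolvedAbove f ((n + 1 : ℕ) - 1) := by
    intro v hv
    have := v.2.2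
    push_cast at hv
    omega
  obtain ⟨h3, rfl, h4⟩ := ForRun.path_spec (n + 1) le_rfl hf h1
  have hl : (List.ofFn fun p : Fin m => (leaf p : Vtx m n)) = (List.finRange m).map leaf :=
    List.ofFn_eq_map
  rw [hl] at h2
  obtain ⟨h5, rfl, h6, h7⟩ := ForRun.leaf_spec _ (fun v hv => h4 v (by omega)) h2
  refine ⟨h3.append h5, ?_⟩
  rw [applySwaps_append]
  exact eq_one_of_solved h6 fun p => h7 p (Or.inr (List.mem_finRange p))

theorem exists_algorithmRun (f : Equiv.Perm (Vtx m n)) : ∃ es, AlgorithmRun f es := by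
  obtain ⟨es, g, h⟩ := exists_forRun (descending m n) f
  exact ⟨es, g, h⟩

/-! ### The optimum -/

theorem psiFun_one : psiFun (1 : Equiv.Perm (Vtx m n)) = 0 := by
  have h1 : piFun (1 : Equiv.Perm (Vtx m n)) = 0 := by
    apply Finset.sum_eq_zero
    intro j _
    have hs : (1 : Equiv.Perm (Vtx m n)).symm = 1 := rfl
    have : inv (1 : Equiv.Perm (Vtx m n)) (pathVtx j) = 0 := by
      rw [inv, Set.ncard_eq_zero (Set.toFinite _), Set.eq_empty_iff_forall_notMem]
      rintro i ⟨h1, h2⟩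
      rw [hs, Equiv.Perm.one_apply, Equiv.Perm.one_apply] at h2
      exact lt_asymm h1 h2
    rw [piTok, hs, Equiv.Perm.one_apply, if_neg (not_lt.2 (pathVtx_nonneg j)), this]
    simp
  have h2 : misplacedNeg (1 : Equiv.Perm (Vtx m n)) = ∅ := by
    rw [Set.eq_empty_iff_forall_notMem]
    intro t ht
    exact (mem_misplacedNeg.1 ht).2 rfl
  have h3 : negOrbits (1 : Equiv.Perm (Vtx m n)) = ∅ := by
    rw [Set.eq_empty_iff_forall_notMem]
    rintro O ⟨i, -, rfl, hO⟩
    have := hO (mem_orbit_self _ _)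
    rw [h2] at this
    exact this
  have h4 : deltaFun (1 : Equiv.Perm (Vtx m n)) = 0 :=
    discount_of_neg (maxTok_lt_zero_iff.2 fun p => leaf_neg (n := n) p) _
  rw [psiFun, muFun, h1, h2, h3, h4]
  simp

theorem exists_descent (f : Equiv.Perm (Vtx m n)) :
    ∃ es, Descends f es ∧ applySwaps f es = 1 ∧ psiFun f = es.length := by
  obtain ⟨es, h⟩ := exists_algorithmRun f
  obtain ⟨h1, h2⟩ := h.spec
  have := h1.psiFun_eq
  rw [h2, psiFun_one] at this
  exact ⟨es, h1, h2, by omega⟩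

theorem sign_applySwap (f : Equiv.Perm (Vtx m n)) {e : Sym2 (Vtx m n)}
    (he : e ∈ (graph m n).edgeSet) :
    Equiv.Perm.sign (applySwap f e) = -Equiv.Perm.sign f := by
  induction e using Sym2.ind with
  | _ u v =>
    have : applySwap f s(u, v) = f * Equiv.swap u v := rfl
    rw [this, Equiv.Perm.sign_mul, Equiv.Perm.sign_swap ((graph m n).ne_of_adj he), mul_neg_one]

theorem sign_applySwaps (f : Equiv.Perm (Vtx m n)) {es : List (Sym2 (Vtx m n))}
    (he : ∀ e ∈ es, e ∈ (graph m n).edgeSet) :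
    Equiv.Perm.sign (applySwaps f es) = (-1) ^ es.length * Equiv.Perm.sign f := by
  induction es generalizing f with
  | nil => simp [applySwaps_nil]
  | cons e es ih =>
    rw [List.forall_mem_cons] at he
    rw [applySwaps_cons, ih _ he.2, sign_applySwap f he.1, List.length_cons, pow_succ]
    simp

/-- If one of the two tokens is on its goal leaf before or after the swap, the swap or its inverse
is a move home. Otherwise the leaf is misplaced before and after, so μ changes only through Δ, by at
most one, and π + δ changes by at most one. -/
theorem abs_psiFun_applySwap_sub_le (f : Equiv.Perm (Vtx m n)) {e : Sym2 (Vtx m n)}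
    (he : e ∈ (graph m n).edgeSet) : |psiFun (applySwap f e) - psiFun f| ≤ 2 := by
  rcases edge_cases he with ⟨p, rfl⟩ | ⟨q, hq, rfl⟩
  · rw [applySwap_leaf]
    by_cases h1 : f (origin m n) = leaf p
    · rw [psiFun_home f p h1]; simp
    by_cases h2 : f (leaf p) = leaf p
    · have := psiFun_home (leafSwap f p) p (by rw [leafSwap_origin, h2])
      rw [leafSwap_leafSwap] at this
      rw [this]; simp
    classical
    have h3 := muFun_leafSwap f p
    have h4 := abs_psiFun_leafSwap_le f p
    rw [if_pos h2, if_pos (by rwa [leafSwap_leaf])] at h3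
    rw [abs_le] at *
    split_ifs at h3 <;> omega
  · exact abs_psiFun_pathSwap_le f q hq

/-- The algorithm provides solutions of lengths Ψ(f) and Ψ(fe), and the sign of a permutation
determines the parity of the length of any solution. So the difference is odd, and it is at most two
in absolute value. -/
theorem abs_psiFun_applySwap_sub (f : Equiv.Perm (Vtx m n)) {e : Sym2 (Vtx m n)}
    (he : e ∈ (graph m n).edgeSet) : |psiFun (applySwap f e) - psiFun f| = 1 := by
  have hpar : ∀ g : Equiv.Perm (Vtx m n), ∃ a : ℕ, psiFun g = a ∧
      (-1 : ℤˣ) ^ a * Equiv.Perm.sign g = 1 := by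
    intro g
    obtain ⟨es, h1, h2, h3⟩ := exists_descent g
    refine ⟨_, h3, ?_⟩
    rw [← sign_applySwaps g h1.edge, h2, Equiv.Perm.sign_one]
  obtain ⟨a, ha, ha'⟩ := hpar f
  obtain ⟨b, hb, hb'⟩ := hpar (applySwap f e)
  rw [sign_applySwap f he] at hb'
  have h2 := abs_psiFun_applySwap_sub_le f he
  have hne : (-1 : ℤˣ) ^ a ≠ (-1) ^ b := by
    intro h
    rw [← h, mul_neg, ha'] at hb'
    exact absurd hb' (by decide)
  rw [ha, hb] at h2 ⊢
  have hne' : a % 2 ≠ b % 2 := by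
    intro h
    apply hne
    rw [← Nat.div_add_mod a 2, ← Nat.div_add_mod b 2, h, pow_add, pow_add, pow_mul, pow_mul]
    simp
  rw [abs_le] at h2
  rw [abs_eq (by norm_num)]
  omega

theorem psiFun_le_length (f : Equiv.Perm (Vtx m n)) {es : List (Sym2 (Vtx m n))}
    (h : es ∈ solutions (graph m n) f) : psiFun f ≤ es.length := by
  obtain ⟨h1, h2⟩ := h
  induction es generalizing f with
  | nil =>
    rw [applySwaps_nil] at h2
    rw [h2, psiFun_one]
    simp
  | cons e es ih =>
    rw [List.forall_mem_cons] at h1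
    have h3 := ih _ h1.2 h2
    have h4 := (abs_le.1 (abs_psiFun_applySwap_sub f h1.1).le).1
    push_cast [List.length_cons]
    linarith

theorem ts_eq_psiFun (f : Equiv.Perm (Vtx m n)) : (ts (graph m n) f : ℤ) = psiFun f := by
  obtain ⟨es, h1, h2, h3⟩ := exists_descent f
  have hmem : es.length ∈ List.length '' solutions (graph m n) f := ⟨es, ⟨h1.edge, h2⟩, rfl⟩
  have hle : ts (graph m n) f ≤ es.length := Nat.sInf_le hmem
  obtain ⟨es', hes', hlen⟩ := Nat.sInf_mem ⟨_, hmem⟩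
  have := psiFun_le_length f hes'
  have hts : ts (graph m n) f = es'.length := hlen.symm
  omega

theorem AlgorithmRun.length_eq {f : Equiv.Perm (Vtx m n)} {es : List (Sym2 (Vtx m n))}
    (h : AlgorithmRun f es) : es.length = ts (graph m n) f := by
  obtain ⟨h1, h2⟩ := h.spec
  have h3 := h1.psiFun_eq
  rw [h2, psiFun_one] at h3
  have := ts_eq_psiFun f
  omega

end StarPath

namespace StackProgram

/-! ### Programs on stacks over a finite alphabet, and Turing machines that execute them -/

/-- Programs on stacks `κ` over an alphabet `A`, returning an optional letter: `pop` returns the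
letter that it removes, and `loop p` repeats `p` until it returns a letter. -/
inductive Prog (κ A : Type) : Type
  | ret (r : Option A) : Prog κ A
  | push (k : κ) (a : A) : Prog κ A
  | pop (k : κ) : Prog κ A
  | bind (p : Prog κ A) (f : Option A → Prog κ A) : Prog κ A
  | loop (p : Prog κ A) : Prog κ A

variable {κ A : Type}

namespace Prog

/-- Sequential composition. -/
def seq (p q : Prog κ A) : Prog κ A := p.bind fun _ => q

/-- The labels of the machine that executes a program. -/
def Lab : Prog κ A → Type
  | ret _ => Unit
  | push _ _ => Unit
  | pop _ => Unit
  | bind p f => Lab p ⊕ Σ r, Lab (f r)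
  | loop p => Lab p

/-- The first label. -/
def entry : (p : Prog κ A) → Lab p
  | ret _ => ()
  | push _ _ => ()
  | pop _ => ()
  | bind p _ => Sum.inl (entry p)
  | loop p => entry p

instance finite_lab [Finite A] : (p : Prog κ A) → Finite (Lab p)
  | ret _ => inferInstanceAs (Finite Unit)
  | push _ _ => inferInstanceAs (Finite Unit)
  | pop _ => inferInstanceAs (Finite Unit)
  | bind p f =>
    have := finite_lab p
    have := fun r => finite_lab (f r)
    inferInstanceAs (Finite (Lab p ⊕ Σ r, Lab (f r)))
  | loop p => finite_lab p

/-- The alphabets of the machine: `Bool` on the output stack. -/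
abbrev Alphabet (κ A : Type) : Option κ → Type
  | none => Bool
  | some _ => A

/-- The statement at a label, where `emb` embeds the labels of the program into those of the
machine, and `next r` is the label to go to when the program returns `r`. -/
def code {Λ : Type} : (p : Prog κ A) → (Lab p → Λ) → (Option A → Λ) → Lab p →
    Turing.TM2.Stmt (Alphabet κ A) Λ (Option A)
  | ret r, _, next, _ => .goto fun _ => next r
  | push k a, _, next, _ => .push (some k) (fun _ => a) (.goto fun _ => next none)
  | pop k, _, next, _ => .pop (some k) (fun _ x => x) (.goto fun x => next x)
  | bind p f, emb, next, l =>
    match l with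
    | Sum.inl l => code p (fun l => emb (Sum.inl l))
        (fun r => emb (Sum.inr ⟨r, entry (f r)⟩)) l
    | Sum.inr ⟨r, l⟩ => code (f r) (fun l => emb (Sum.inr ⟨r, l⟩)) next l
  -- A loop has no labels of its own: the exit of the body for `none` is its entry, so that a
  -- repetition costs no extra step.
  | loop p, emb, next, l => code p emb (fun r => r.elim (emb (entry p)) fun a => next (some a)) l

variable [DecidableEq κ]

/-- `Exec p S t r S'`: the program `p` turns the stacks `S` into `S'` and returns `r`, in `t`
steps. -/
inductive Exec : Prog κ A → (κ → List A) → ℕ → Option A → (κ → List A) → Prop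
  | ret (r : Option A) (S : κ → List A) : Exec (ret r) S 1 r S
  | push (k : κ) (a : A) (S : κ → List A) :
      Exec (push k a) S 1 none (Function.update S k (a :: S k))
  | pop (k : κ) (S : κ → List A) :
      Exec (pop k) S 1 (S k).head? (Function.update S k (S k).tail)
  | bind {p : Prog κ A} {f : Option A → Prog κ A} {S S' S'' : κ → List A} {t t' : ℕ}
      {r r' : Option A} (h : Exec p S t r S') (h' : Exec (f r) S' t' r' S'') :
      Exec (bind p f) S (t + t') r' S''
  | loop_some {p : Prog κ A} {S S' : κ → List A} {t : ℕ} {a : A}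
      (h : Exec p S t (some a) S') : Exec (loop p) S t (some a) S'
  | loop_none {p : Prog κ A} {S S' S'' : κ → List A} {t t' : ℕ} {r : Option A}
      (h : Exec p S t none S') (h' : Exec (loop p) S' t' r S'') : Exec (loop p) S (t + t') r S''

/-- No step pushes more than one letter. Bounds on the running time thereby become bounds on stack
lengths, in particular on the number of counted swaps. -/
theorem Exec.length_le {p : Prog κ A} {S S' : κ → List A} {t : ℕ} {r : Option A}
    (h : Exec p S t r S') (k : κ) : (S' k).length ≤ (S k).length + t := by
  induction h with
  | ret => omega
  | push k' a S =>
    by_cases hk : k = k'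
    · subst hk; simp
    · simp [Function.update_of_ne hk]
  | pop k' S =>
    by_cases hk : k = k'
    · subst hk; simp; omega
    · simp [Function.update_of_ne hk]
  | bind _ _ h1 h2 => omega
  | loop_some _ h => exact h
  | loop_none _ _ h1 h2 => omega

/-- The stacks of the machine, with the given output. -/
def withOutput (out : List Bool) (S : κ → List A) : (k : Option κ) → List (Alphabet κ A k)
  | none => out
  | some k => S k

theorem update_withOutput (out : List Bool) (S : κ → List A) (k : κ) (x : List A) :
    Function.update (withOutput out S) (some k) x = withOutput out (Function.update S k x) := by
  funext j
  obtain _ | j := j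
  · rfl
  · by_cases h : j = k
    · subst h
      simp [withOutput]
    · have h' : (some j : Option κ) ≠ some k := fun e => h (Option.some.inj e)
      rw [Function.update_of_ne h']
      simp [withOutput, Function.update_of_ne h]

-- The state `v` can be arbitrary at the start and is unspecified at the end, because it is read
-- only in the statement that has just set it by a `pop`. The embedding of labels is general so that
-- the induction reaches subprograms.
open Turing in
theorem Exec.iterate_step {Λ : Type} {p : Prog κ A} {S S' : κ → List A} {t : ℕ} {r : Option A}
    (h : Exec p S t r S') (M : Λ → TM2.Stmt (Alphabet κ A) Λ (Option A)) (out : List Bool)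
    (emb : Lab p → Λ) (next : Option A → Λ) (hM : ∀ l, M (emb l) = code p emb next l)
    (v : Option A) :
    ∃ v', (flip Bind.bind (TM2.step M))^[t] (some ⟨some (emb (entry p)), v, withOutput out S⟩) =
      some ⟨some (next r), v', withOutput out S'⟩ := by
  induction h generalizing next v with
  | ret r S =>
    refine ⟨v, ?_⟩
    simp only [Function.iterate_one, flip, Option.bind_eq_bind, Option.bind_some, TM2.step, hM]
    rfl
  | push k a S =>
    refine ⟨v, ?_⟩
    simp only [Function.iterate_one, flip, Option.bind_eq_bind, Option.bind_some, TM2.step, hM,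
      code, TM2.stepAux, update_withOutput]
    rfl
  | pop k S =>
    refine ⟨(S k).head?, ?_⟩
    simp only [Function.iterate_one, flip, Option.bind_eq_bind, Option.bind_some, TM2.step, hM,
      code, TM2.stepAux, update_withOutput]
    rfl
  | @bind p f S S' S'' t t' r r' h h' ih ih' =>
    obtain ⟨v', h1⟩ := ih (fun l => emb (Sum.inl l))
      (fun r => emb (Sum.inr ⟨r, entry (f r)⟩)) (fun l => hM (Sum.inl l)) v
    obtain ⟨v'', h2⟩ := ih' (fun l => emb (Sum.inr ⟨r, l⟩)) next
      (fun l => hM (Sum.inr ⟨r, l⟩)) v'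
    refine ⟨v'', ?_⟩
    rw [Nat.add_comm, Function.iterate_add_apply]
    exact (congrArg _ h1).trans h2
  | @loop_some p S S' t a h ih =>
    exact ih emb (fun r => r.elim (emb (entry p)) fun a => next (some a)) hM v
  | @loop_none p S S' S'' t t' r h h' ih ih' =>
    obtain ⟨v', h1⟩ := ih emb (fun r => r.elim (emb (entry p)) fun a => next (some a)) hM v
    obtain ⟨v'', h2⟩ := ih' emb next hM v'
    refine ⟨v'', ?_⟩
    rw [Nat.add_comm, Function.iterate_add_apply]
    exact (congrArg _ h1).trans h2

/-- The machine that executes a program and then outputs whether it has returned `yes`. -/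
noncomputable def machine [Fintype κ] [Fintype A] [DecidableEq A] (p : Prog κ A) (input : κ)
    (yes : A) : Turing.FinTM2 where
  K := Option κ
  k₀ := some input
  k₁ := none
  Γ := Alphabet κ A
  Λ := Lab p ⊕ Option A
  main := Sum.inl (entry p)
  ΛFin := Fintype.ofFinite _
  σ := Option A
  initialState := none
  Γk₀Fin := inferInstanceAs (Fintype A)
  m
    | Sum.inl l => code p Sum.inl Sum.inr l
    | Sum.inr r => .load (fun _ => none) (.push none (fun _ => decide (r = some yes)) .halt)

/-- The required halting configuration contains nothing but the output, so the program has to leave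
all its stacks empty. One further step resets the state and writes the answer, hence `time + 1`. -/
theorem nonempty_computableInPolyTime [Fintype κ] [Fintype A] [DecidableEq A] (p : Prog κ A)
    (input : κ) (yes : A) {α : Type} (enc : α → List A) (answer : α → Bool)
    (time : Polynomial ℕ)
    (h : ∀ x, ∃ t ≤ time.eval (enc x).length, ∃ r,
      Exec p (Function.update (fun _ => []) input (enc x)) t r (fun _ => []) ∧
        decide (r = some yes) = answer x) :
    Nonempty (Turing.TM2ComputableInPolyTime enc Computability.encodeBool answer) := by
  choose t ht r he hr using h
  have main : ∀ x, ∃ v', (flip Bind.bind (Turing.TM2.step (machine p input yes).m))^[t x]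
      (some ⟨some (machine p input yes).main, none,
        withOutput [] (Function.update (fun _ => []) input (enc x))⟩) =
      some ⟨some (Sum.inr (r x)), v', withOutput [] fun _ => []⟩ := fun x =>
    (he x).iterate_step (machine p input yes).m [] Sum.inl Sum.inr (fun _ => rfl) none
  refine ⟨{
    tm := machine p input yes
    inputAlphabet := Equiv.refl A
    outputAlphabet := Equiv.refl Bool
    time := time + 1
    outputsFun := fun x =>
      { steps := t x + 1
        evals_in_steps := ?_
        steps_le_m := by simpa using ht x } }⟩
  obtain ⟨v', hv⟩ := main x
  have hinit : Turing.initList (machine p input yes) ((enc x).map (Equiv.refl A).invFun) =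
      ⟨some (machine p input yes).main, none,
        withOutput [] (Function.update (fun _ => []) input (enc x))⟩ := by
    rw [← update_withOutput]
    unfold Turing.initList
    congr 1
    funext k
    by_cases hk : k = some input
    · subst hk
      simp [machine]
      rfl
    · refine (dif_neg hk).trans (Eq.trans ?_ (Function.update_of_ne hk (enc x)
        (withOutput [] fun _ => [])).symm)
      obtain _ | k := k <;> rfl
  have hhalt : Turing.TM2.stepAux ((machine p input yes).m (Sum.inr (r x))) v'
      (withOutput [] fun _ => []) = Turing.haltList (machine p input yes)
        ((Computability.encodeBool (answer x)).map (Equiv.refl Bool).invFun) := by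
    unfold Turing.haltList
    rw [← hr x]
    simp only [machine, Turing.TM2.stepAux]
    congr 1
    funext k
    obtain _ | k := k
    · exact Function.update_self ..
    · exact Function.update_of_ne (Option.some_ne_none k) ..
  rw [Nat.add_comm, Function.iterate_add_apply]
  refine (congrArg _ ((congrArg _ (congrArg some hinit)).trans hv)).trans ?_
  exact congrArg some hhalt

end Prog

end StackProgram

/-! ### Execution of stack programs within a time bound. -/

namespace StackProgram

open Computability (Γ')

namespace Prog

variable {κ A : Type} [DecidableEq κ]

/-- `Runs p S t r S'`: the program `p` turns the stacks `S` into `S'` and returns `r`, in at most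
`t` steps. -/
def Runs (p : Prog κ A) (S : κ → List A) (t : ℕ) (r : Option A) (S' : κ → List A) : Prop :=
  ∃ t' ≤ t, Exec p S t' r S'

variable {p q : Prog κ A} {f : Option A → Prog κ A} {S S' S'' : κ → List A} {t t' : ℕ}
  {r r' : Option A} {a b : κ}

theorem Runs.mono (h : Runs p S t r S') (ht : t ≤ t') : Runs p S t' r S' :=
  h.imp fun _ h => ⟨h.1.trans ht, h.2⟩

theorem Runs.congr (h : Runs p S t r S') (ht : t ≤ t') (hS : S' = S'') : Runs p S t' r S'' :=
  hS ▸ h.mono ht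

theorem Runs.bind (h : Runs p S t r S') (h' : Runs (f r) S' t' r' S'') :
    Runs (p.bind f) S (t + t') r' S'' := by
  obtain ⟨u, hu, h⟩ := h
  obtain ⟨u', hu', h'⟩ := h'
  exact ⟨u + u', by omega, h.bind h'⟩

theorem Runs.seq (h : Runs p S t r S') (h' : Runs q S' t' r' S'') :
    Runs (p.seq q) S (t + t') r' S'' :=
  h.bind h'

theorem Runs.loop_some {x : A} (h : Runs p S t (some x) S') : Runs p.loop S t (some x) S' :=
  h.imp fun _ h => ⟨h.1, h.2.loop_some⟩

theorem Runs.loop_none (h : Runs p S t none S') (h' : Runs p.loop S' t' r S'') :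
    Runs p.loop S (t + t') r S'' := by
  obtain ⟨u, hu, h⟩ := h
  obtain ⟨u', hu', h'⟩ := h'
  exact ⟨u + u', by omega, h.loop_none h'⟩

theorem runs_ret (r : Option A) (S : κ → List A) : Runs (.ret r) S 1 r S := ⟨1, le_rfl, .ret r S⟩

theorem runs_push (k : κ) (x : A) (S : κ → List A) :
    Runs (.push k x) S 1 none (Function.update S k (x :: S k)) := ⟨1, le_rfl, .push k x S⟩

theorem runs_pop_cons {k : κ} {x : A} {l : List A} (h : S k = x :: l) :
    Runs (.pop k) S 1 (some x) (Function.update S k l) := by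
  refine ⟨1, le_rfl, ?_⟩
  have := Exec.pop k S
  rwa [h] at this

theorem runs_pop_nil {k : κ} (h : S k = []) : Runs (.pop k) S 1 none S := by
  refine ⟨1, le_rfl, ?_⟩
  have := Exec.pop k S
  rwa [h, List.head?_nil, List.tail_nil, ← h, Function.update_eq_self] at this

theorem Runs.length_le (h : Runs p S t r S') (k : κ) : (S' k).length ≤ (S k).length + t := by
  obtain ⟨u, hu, h⟩ := h
  have := h.length_le k
  omega

end Prog

open Prog Function

variable {κ : Type}

/-! ### Unary numbers, blocks and binary words on stacks -/

/-- Move the letters of a stack to another one, one by one. -/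
def moveAll (a b : κ) : Prog κ Γ' :=
  .loop <| (Prog.pop a).bind fun
    | none => .ret (some .blank)
    | some x => .push b x

/-- Empty a stack. -/
def clear (a : κ) : Prog κ Γ' :=
  .loop <| (Prog.pop a).bind fun
    | none => .ret (some .blank)
    | some _ => .ret none

/-- Move a binary word, and drop the letter that follows it. -/
def moveWord (a b : κ) : Prog κ Γ' :=
  .loop <| (Prog.pop a).bind fun
    | some (.bit x) => .push b (.bit x)
    | _ => .ret (some .blank)

/-- The block of a sign `x.1` and a number `x.2`. -/
def block (x : Γ' × ℕ) : List Γ' := x.1 :: (List.replicate x.2 .blank ++ [x.1])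

/-- Move the block on top of a stack to another one. -/
def moveBlock (a b : κ) : Prog κ Γ' :=
  (Prog.pop a).bind fun
    | none => .ret none
    | some x => (Prog.push b x).seq <| .seq
        (.loop <| (Prog.pop a).bind fun
          | some .blank => .push b .blank
          | some x => (Prog.push b x).seq (.ret (some x))
          | none => .ret (some .blank))
        (.ret none)

/-- Drop the block on top of a stack. -/
def dropBlock (a : κ) : Prog κ Γ' :=
  (Prog.pop a).seq <| .seq
    (.loop <| (Prog.pop a).bind fun
      | some .blank => .ret none
      | _ => .ret (some .blank))
    (.ret none)

/-- Decrement the binary number on a stack, and return `none` if it is `0`; in this case the number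
and the letter that follows it are dropped. -/
def decr (temp a : κ) : Prog κ Γ' :=
  .bind
    (.loop <| (Prog.pop a).bind fun
      | some (.bit true) => (Prog.push a (.bit false)).seq (.ret (some (.bit true)))
      | some (.bit false) => .push temp .blank
      | _ => .ret (some (.bit false)))
    fun
      | some (.bit true) => .loop <| (Prog.pop temp).bind fun
          | none => .ret (some .blank)
          | some _ => .push a (.bit true)
      | _ => (clear temp).seq (.ret none)

/-- Convert the binary number on `a` into a unary one on `b`. -/
def unary (temp a b : κ) : Prog κ Γ' :=
  .loop <| (decr temp a).bind fun
    | none => .ret (some .blank)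
    | some _ => .push b .blank

/-- The number with the given bits, least significant bit first. -/
def ofBits (l : List Bool) : ℕ := l.foldr (fun b v => b.toNat + 2 * v) 0

variable [DecidableEq κ] {a b temp : κ} {S : κ → List Γ'}

theorem runs_moveAll (hab : a ≠ b) {x : List Γ'} (h : S a = x) :
    Runs (moveAll a b) S (2 * x.length + 2) (some .blank)
      (update (update S a []) b (x.reverse ++ S b)) := by
  induction x generalizing S with
  | nil =>
    refine Runs.congr (Runs.loop_some ((runs_pop_nil h).bind (runs_ret _ _))) (by simp) ?_
    rw [List.reverse_nil, List.nil_append, ← h, update_eq_self, update_eq_self]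
  | cons c x ih =>
    refine Runs.congr (Runs.loop_none ((runs_pop_cons h).bind (runs_push b c _))
      (ih (by simp [hab]))) (by simp only [List.length_cons]; omega) ?_
    ext1 s
    by_cases hs : s = b <;> by_cases hs' : s = a <;> simp_all [update_apply]

theorem runs_clear {x : List Γ'} (h : S a = x) :
    Runs (clear a) S (2 * x.length + 2) (some .blank) (update S a []) := by
  induction x generalizing S with
  | nil =>
    refine Runs.congr (Runs.loop_some ((runs_pop_nil h).bind (runs_ret _ _))) (by simp) ?_
    rw [← h, update_eq_self]
  | cons c x ih =>
    refine Runs.congr (Runs.loop_none ((runs_pop_cons h).bind (runs_ret _ _))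
      (ih (by simp))) (by simp only [List.length_cons]; omega) ?_
    rw [update_idem]

theorem runs_moveWord (hab : a ≠ b) {w : List Bool} {x : List Γ'}
    (h : S a = w.map .bit ++ .comma :: x) :
    Runs (moveWord a b) S (2 * w.length + 2) (some .blank)
      (update (update S a x) b ((w.map .bit).reverse ++ S b)) := by
  induction w generalizing S with
  | nil =>
    refine Runs.congr (Runs.loop_some ((runs_pop_cons h).bind (runs_ret _ _))) (by simp) ?_
    simp [hab.symm]
  | cons c w ih =>
    refine Runs.congr (Runs.loop_none ((runs_pop_cons h).bind (runs_push b _ _))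
      (ih (by simp [hab]))) (by simp only [List.length_cons]; omega) ?_
    ext1 s
    by_cases hs : s = b <;> by_cases hs' : s = a <;> simp_all [update_apply]

theorem runs_moveBlock (hab : a ≠ b) {y : Γ' × ℕ} (hy : y.1 ≠ .blank) {x : List Γ'}
    (h : S a = block y ++ x) :
    Runs (moveBlock a b) S (2 * y.2 + 6) none
      (update (update S a x) b (block y ++ S b)) := by
  obtain ⟨s, n⟩ := y
  have key : ∀ (n : ℕ) (S : κ → List Γ'), S a = List.replicate n .blank ++ s :: x →
      Runs (.loop <| (Prog.pop a).bind fun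
          | some .blank => .push b .blank
          | some x => (Prog.push b x).seq (.ret (some x))
          | none => .ret (some .blank)) S (2 * n + 3) (some s)
        (update (update S a x) b (s :: (List.replicate n .blank ++ S b))) := by
    intro n
    induction n with
    | zero =>
      intro S h
      refine Runs.congr (Runs.loop_some ((runs_pop_cons (x := s) (l := x) (by simpa using h)).bind
        (t' := 2) (r' := some s) (S'' := update (update S a x) b (s :: S b)) ?_))
        le_rfl (by simp)
      have := (runs_push b s (update S a x)).seq (runs_ret (some s) _)
      rw [update_of_ne hab.symm] at this
      cases s <;> first | exact (hy rfl).elim | exact this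
    | succ n ih =>
      intro S h
      refine Runs.congr (Runs.loop_none ((runs_pop_cons (x := Γ'.blank)
        (l := List.replicate n Γ'.blank ++ s :: x)
        (by simpa [List.replicate_succ] using h)).bind (runs_push b Γ'.blank _))
        (ih _ (by simp [hab]))) (by omega) ?_
      ext1 j
      by_cases hs : j = b <;> by_cases hs' : j = a <;>
        simp_all [List.replicate_succ', hab.symm]
  refine Runs.congr ((runs_pop_cons (x := s) (l := List.replicate n .blank ++ s :: x)
    (by simpa [block] using h)).bind ((runs_push b s _).seq
    ((key n _ (by simp [hab])).seq (runs_ret none _)))) (by omega) ?_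
  ext1 j
  by_cases hs : j = b <;> by_cases hs' : j = a <;> simp_all [update_apply, block]

theorem runs_dropBlock {y : Γ' × ℕ} (hy : y.1 ≠ .blank) {x : List Γ'}
    (h : S a = block y ++ x) :
    Runs (dropBlock a) S (2 * y.2 + 4) none (update S a x) := by
  obtain ⟨s, n⟩ := y
  have key : ∀ (n : ℕ) (S : κ → List Γ'), S a = List.replicate n .blank ++ s :: x →
      Runs (.loop <| (Prog.pop a).bind fun
          | some .blank => .ret none
          | _ => .ret (some .blank)) S (2 * n + 2) (some .blank) (update S a x) := by
    intro n
    induction n with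
    | zero =>
      intro S h
      refine Runs.congr (Runs.loop_some ((runs_pop_cons (x := s) (l := x) (by simpa using h)).bind
        (t' := 1) (r' := some .blank) (S'' := update S a x) ?_)) le_rfl rfl
      cases s <;> first | exact (hy rfl).elim | exact runs_ret _ _
    | succ n ih =>
      intro S h
      refine Runs.congr (Runs.loop_none ((runs_pop_cons (x := Γ'.blank)
        (l := List.replicate n Γ'.blank ++ s :: x)
        (by simpa [List.replicate_succ] using h)).bind (runs_ret _ _))
        (ih _ (by simp))) (by omega) ?_
      rw [update_idem]
  refine Runs.congr ((runs_pop_cons (x := s) (l := List.replicate n .blank ++ s :: x)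
    (by simpa [block] using h)).seq
    ((key n _ (by simp)).seq (runs_ret none _))) (by omega) ?_
  rw [update_idem]

end StackProgram

/-! ### Binary decrement and conversion to unary. -/

namespace StackProgram

open Computability Prog Function

/-- This is the borrow of a decrement, least significant bit first. The word keeps its length, so
the time bound for `decr` remains valid over repeated decrements. -/
theorem ofBits_replicate_true (i : ℕ) (w : List Bool) :
    ofBits (List.replicate i true ++ false :: w) + 1 =
      ofBits (List.replicate i false ++ true :: w) := by
  induction i with
  | zero => simp [ofBits]; omega
  | succ i ih =>
    simp only [ofBits, List.replicate_succ, List.cons_append, List.foldr_cons] at ih ⊢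
    rw [← ih]
    simp
    omega

theorem ofBits_replicate_false (i : ℕ) : ofBits (List.replicate i false) = 0 := by
  induction i with
  | zero => rfl
  | succ i ih =>
    simp only [ofBits, List.replicate_succ, List.foldr_cons] at ih ⊢
    rw [ih]
    rfl

theorem eq_replicate_false (w : List Bool) :
    (∃ i v, w = List.replicate i false ++ true :: v) ∨ w = List.replicate w.length false := by
  induction w with
  | nil => exact Or.inr rfl
  | cons c w ih =>
    cases c
    · obtain ⟨i, v, h⟩ | h := ih
      · exact Or.inl ⟨i + 1, v, by rw [h]; rfl⟩
      · exact Or.inr (by rw [List.length_cons, List.replicate_succ, ← h])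
    · exact Or.inl ⟨0, w, rfl⟩

theorem ofBits_encodeNat (n : ℕ) : ofBits (encodeNat n) = n := by
  have h : ∀ p : PosNum, ofBits (encodePosNum p) = (p : ℕ) := by
    intro p
    induction p with
    | one => rfl
    | bit0 p ih =>
      rw [PosNum.cast_bit0, ← ih]
      simp [encodePosNum, ofBits]
      omega
    | bit1 p ih =>
      rw [PosNum.cast_bit1, ← ih]
      simp [encodePosNum, ofBits]
      omega
  have h' : ∀ p : Num, ofBits (encodeNum p) = (p : ℕ) := by
    rintro (_ | p)
    · rfl
    · exact h p
  rw [encodeNat, h', Num.to_of_nat]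

variable {κ : Type} [DecidableEq κ] {a b temp : κ} {S : κ → List Γ'}

/-- What happens after the leading zeros is left open in `hz`, so that the lemma serves both for a
borrow from a one and for the number zero. -/
theorem runs_decr_zeros (hab : temp ≠ a) (i : ℕ) {z : List Γ'}
    (h : S a = List.replicate i (.bit false) ++ z) {t : ℕ} {r : Option Γ'} {y : List Γ'}
    (hz : ∀ T : κ → List Γ', T a = z → Runs (.loop <| (Prog.pop a).bind fun
      | some (.bit true) => (Prog.push a (.bit false)).seq (.ret (some (.bit true)))
      | some (.bit false) => .push temp .blank
      | _ => .ret (some (.bit false))) T t r (update T a y)) :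
    Runs (.loop <| (Prog.pop a).bind fun
      | some (.bit true) => (Prog.push a (.bit false)).seq (.ret (some (.bit true)))
      | some (.bit false) => .push temp .blank
      | _ => .ret (some (.bit false))) S (2 * i + t) r
      (update (update S a y) temp (List.replicate i .blank ++ S temp)) := by
  induction i generalizing S with
  | zero =>
    refine (hz S h).congr (by omega) ?_
    rw [List.replicate_zero, List.nil_append, update_comm hab.symm, update_eq_self]
  | succ i ih =>
    refine Runs.congr (Runs.loop_none ((runs_pop_cons (x := Γ'.bit false)
      (l := List.replicate i (.bit false) ++ z) h).bind (runs_push temp Γ'.blank _))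
      (ih (by simp [hab.symm]))) (by omega) ?_
    ext1 j
    by_cases hs : j = a <;> by_cases hs' : j = temp <;>
      simp_all [List.replicate_succ']

theorem runs_decr_ones (hab : temp ≠ a) (i : ℕ) (h : S temp = List.replicate i .blank) :
    Runs (.loop <| (Prog.pop temp).bind fun
        | none => .ret (some .blank)
        | some _ => .push a (.bit true)) S (2 * i + 2) (some .blank)
      (update (update S temp []) a (List.replicate i (.bit true) ++ S a)) := by
  induction i generalizing S with
  | zero =>
    refine Runs.congr (Runs.loop_some ((runs_pop_nil h).bind (runs_ret _ _))) (by omega) ?_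
    rw [List.replicate_zero, List.nil_append, ← (show S temp = [] from h), update_eq_self,
      update_eq_self]
  | succ i ih =>
    refine Runs.congr (Runs.loop_none ((runs_pop_cons (x := Γ'.blank)
      (l := List.replicate i .blank) h).bind (runs_push a (Γ'.bit true) _))
      (ih (by simp [hab]))) (by omega) ?_
    ext1 j
    by_cases hs : j = a <;> by_cases hs' : j = temp <;>
      simp_all [List.replicate_succ']

/-- The bound on the time of `decr` for a word of length `l`. -/
def decrTime (l : ℕ) : ℕ := 4 * l + 10

theorem exists_runs_decr (hab : temp ≠ a) (hS : S temp = []) {w : List Bool} {x : List Γ'}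
    (h : S a = w.map .bit ++ .comma :: x) (hw : 0 < ofBits w) :
    ∃ v, v.length = w.length ∧ ofBits v + 1 = ofBits w ∧
      Runs (decr temp a) S (decrTime w.length) (some .blank)
        (update S a (v.map .bit ++ .comma :: x)) := by
  obtain ⟨i, v, rfl⟩ | hv := eq_replicate_false w
  swap
  · rw [hv, ofBits_replicate_false] at hw
    omega
  refine ⟨List.replicate i true ++ false :: v, by simp, ofBits_replicate_true i v, ?_⟩
  have h1 := runs_decr_zeros hab i (z := .bit true :: (v.map .bit ++ .comma :: x)) (S := S)
    (t := 3) (r := some (.bit true)) (y := .bit false :: (v.map .bit ++ .comma :: x))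
    (by simpa using h) (fun T hT => by
      refine Runs.congr (Runs.loop_some ((runs_pop_cons hT).bind
        ((runs_push a _ _).seq (runs_ret _ _)))) le_rfl ?_
      simp)
  refine (h1.bind (runs_decr_ones hab i (by simp [hS]))).congr ?_ ?_
  · simp [decrTime]
    omega
  · ext1 j
    by_cases hs : j = a <;> by_cases hs' : j = temp <;> simp_all [hab.symm]

theorem runs_decr_zero (hab : temp ≠ a) (hS : S temp = []) {w : List Bool} {x : List Γ'}
    (h : S a = w.map .bit ++ .comma :: x) (hw : ofBits w = 0) :
    Runs (decr temp a) S (decrTime w.length) none (update S a x) := by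
  obtain ⟨i, v, rfl⟩ | hv := eq_replicate_false w
  · rw [← ofBits_replicate_true] at hw
    omega
  have h1 := runs_decr_zeros hab w.length (z := .comma :: x) (S := S)
    (t := 2) (r := some (.bit false)) (y := x)
    (by rw [h]; congr 1; conv_lhs => rw [hv]
        rw [List.map_replicate]) (fun T hT => by
      refine Runs.loop_some ((runs_pop_cons hT).bind (t' := 1) ?_)
      exact runs_ret (some (Γ'.bit false)) _)
  refine (h1.bind ((runs_clear (x := List.replicate w.length Γ'.blank) (by simp [hS])).seq
    (runs_ret none _))).congr ?_ ?_
  · simp [decrTime]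
    omega
  · rw [update_idem, update_comm hab.symm, ← hS, update_eq_self]

/-- The time is linear in the value, hence exponential in the length of the word. It is harmless
because the conversion is only used for `n` and for tokens, whose values are at most the length of
the input. -/
theorem runs_unary (hat : temp ≠ a) (hbt : temp ≠ b) (hab : a ≠ b) (hS : S temp = [])
    {w : List Bool} {x : List Γ'} (h : S a = w.map .bit ++ .comma :: x) :
    Runs (unary temp a b) S ((ofBits w + 1) * (decrTime w.length + 1)) (some .blank)
      (update (update S a x) b (List.replicate (ofBits w) .blank ++ S b)) := by
  induction hn : ofBits w generalizing w S with
  | zero =>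
    refine Runs.congr (Runs.loop_some ((runs_decr_zero hat hS h hn).bind (runs_ret _ _)))
      (by omega) ?_
    simp [hab.symm]
  | succ n ih =>
    obtain ⟨v, h1, h2, h3⟩ := exists_runs_decr hat hS h (by omega)
    refine Runs.congr (Runs.loop_none (h3.bind (runs_push b Γ'.blank _))
      (ih (w := v) (by simp [hbt, hat, hS]) (by simp [hab]) (by omega))) ?_ ?_
    · rw [h1]
      ring_nf
      omega
    · ext1 j
      by_cases hs : j = a <;> by_cases hs' : j = b <;>
        simp_all [List.replicate_succ', hab.symm]

end StackProgram

namespace StarPath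

open Computability StackProgram StackProgram.Prog Function

/-! ### The program -/

/-- The stacks: the input, the blocks of the tokens on the leaves and on the path, with auxiliary
store, the largest misplaced token in unary, with an auxiliary stack, an auxiliary stack for
arithmetic, the number of swaps in unary, and the bound in binary. -/
inductive Stack
  | input | leaves | leavesAux | path | pathAux | counter | counterAux | temp | swaps | bound
  deriving DecidableEq

instance : Fintype Stack :=
  Fintype.ofList [.input, .leaves, .leavesAux, .path, .pathAux, .counter, .counterAux, .temp,
    .swaps, .bound] fun x => by cases x <;> decide

/-- The stacks with the given contents. -/
def store (i l l' p p' c c' t s b : List Γ') : Stack → List Γ'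
  | .input => i
  | .leaves => l
  | .leavesAux => l'
  | .path => p
  | .pathAux => p'
  | .counter => c
  | .counterAux => c'
  | .temp => t
  | .swaps => s
  | .bound => b

/-- As simplification rules these keep the contents of all ten stacks explicit while a program is
executed symbolically. -/
theorem update_store (i l l' p p' c c' t s b x : List Γ') :
    update (store i l l' p p' c c' t s b) .input x = store x l l' p p' c c' t s b ∧
    update (store i l l' p p' c c' t s b) .leaves x = store i x l' p p' c c' t s b ∧
    update (store i l l' p p' c c' t s b) .leavesAux x = store i l x p p' c c' t s b ∧
    update (store i l l' p p' c c' t s b) .path x = store i l l' x p' c c' t s b ∧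
    update (store i l l' p p' c c' t s b) .pathAux x = store i l l' p x c c' t s b ∧
    update (store i l l' p p' c c' t s b) .counter x = store i l l' p p' x c' t s b ∧
    update (store i l l' p p' c c' t s b) .counterAux x = store i l l' p p' c x t s b ∧
    update (store i l l' p p' c c' t s b) .temp x = store i l l' p p' c c' x s b ∧
    update (store i l l' p p' c c' t s b) .swaps x = store i l l' p p' c c' t x b ∧
    update (store i l l' p p' c c' t s b) .bound x = store i l l' p p' c c' t s x := by
  refine ⟨?_, ?_, ?_, ?_, ?_, ?_, ?_, ?_, ?_, ?_⟩ <;> (funext j; cases j <;> rfl)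

/-- The block of an integer: the sign is `bra` for the integers `z ≥ 0`, which have the number `z`,
and `ket` for the integers `z < 0`, which have the number `-z - 1`. -/
def intBlock (z : ℤ) : Γ' × ℕ := if 0 ≤ z then (.bra, z.toNat) else (.ket, (-z - 1).toNat)

/-- Count one swap. -/
def countSwap : Prog Stack Γ' := .push .swaps .blank

/-- Read an integer, after its sign. -/
def readInt (a : Stack) : Option Γ' → Prog Stack Γ'
  | some (.bit true) => (decr .temp .input).seq <| (Prog.push a .ket).seq <|
      (unary .temp .input a).seq (.push a .ket)
  | some (.bit false) => (Prog.push a .bra).seq <| (unary .temp .input a).seq (.push a .bra)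
  | _ => .ret (some .blank)

/-- Read a list of integers. -/
def readList (a : Stack) : Prog Stack Γ' :=
  (Prog.pop .input).seq <| .loop <| (Prog.pop .input).bind (readInt a)

/-- Move the negative token on the vertex `0` to its goal vertex, where the block of the sign
`comma` marks its arrival. -/
def goHome : Prog Stack Γ' :=
  (Prog.pop .path).seq <| .seq
    (.loop <| (Prog.pop .path).bind fun
      | some .blank => moveBlock .leaves .leavesAux
      | _ => .ret (some .blank)) <|
  (moveBlock .leaves .path).seq <| (Prog.push .leaves .comma).seq <|
    (Prog.push .leaves .comma).seq <| moveAll .leavesAux .leaves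

/-- While the token on the vertex `0` is negative, move it to its goal vertex. -/
def goHomeLoop : Prog Stack Γ' :=
  .loop <| (Prog.pop .path).bind fun
    | some .ket => (Prog.push .path .ket).seq (goHome.seq countSwap)
    | some x => (Prog.push .path x).seq (.ret (some x))
    | none => .ret (some .blank)

/-- Move a block, and test whether it is the block of the number on the stack `counter`. -/
def moveTest (a b : Stack) : Prog Stack Γ' :=
  (Prog.pop a).bind fun
    | some .bra => (Prog.push b .bra).seq <| .seq
        (.loop <| (Prog.pop a).bind fun
          | some .blank => (Prog.push b .blank).seq
              ((Prog.pop .counter).seq (.push .counterAux .blank))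
          | _ => (Prog.push b .bra).seq (.ret (some .blank))) <|
        (Prog.pop .counter).bind fun
          | none => (moveAll .counterAux .counter).seq (.ret (some .blank))
          | some _ => (Prog.push .counter .blank).seq <|
              (moveAll .counterAux .counter).seq (.ret none)
    | some x => (Prog.push a x).seq (moveBlock a b)
    | none => .ret none

/-- Move blocks up to the block of the number on the stack `counter`, or all blocks. -/
def find (a b : Stack) : Prog Stack Γ' :=
  .loop <| (Prog.pop a).bind fun
    | none => .ret (some .comma)
    | some x => (Prog.push a x).seq (moveTest a b)

/-- Move the largest misplaced token to its goal vertex. -/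
def moveLargest : Prog Stack Γ' :=
  (find .path .pathAux).bind fun
    | some .blank => (dropBlock .pathAux).seq <| .seq
        (.loop <| (Prog.pop .path).bind fun
          | none => .ret (some .blank)
          | some x => (Prog.push .path x).seq <| (moveBlock .path .pathAux).seq countSwap)
        (moveAll .pathAux .path)
    | _ => (moveAll .pathAux .path).seq <| (find .leaves .leavesAux).seq <|
        (dropBlock .leavesAux).seq <| (moveBlock .path .leavesAux).seq <|
        (moveAll .leavesAux .leaves).seq <| countSwap.seq <| .seq
        (.loop <| (Prog.pop .counter).bind fun
          | none => .ret (some .blank)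
          | some _ => (Prog.push .counterAux .blank).seq countSwap)
        (moveAll .counterAux .counter)

/-- Move all tokens on the path to their goal vertices. -/
def solvePath : Prog Stack Γ' :=
  .loop <| (goHomeLoop.seq moveLargest).seq <| (Prog.pop .counter).bind fun
    | some _ => .ret none
    | none => .ret (some .blank)

/-- Move blocks up to the first one with the sign `ket`, or all blocks. -/
def scan : Prog Stack Γ' :=
  .loop <| (Prog.pop .leaves).bind fun
    | none => .ret (some .blank)
    | some .ket => (Prog.push .leaves .ket).seq (.ret (some .ket))
    | some x => (Prog.push .leaves x).seq (moveBlock .leaves .leavesAux)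

/-- Solve the orbit whose leaf has just been emptied, and drop the token `0`; no swaps are counted
if this leaf had its own token. -/
def solveOrbit : Prog Stack Γ' :=
  goHome.seq <| (Prog.pop .path).bind fun
    | some .bra => (Prog.push .path .bra).seq (dropBlock .path)
    | _ => (Prog.push .path .ket).seq <| countSwap.seq <| countSwap.seq <|
        goHomeLoop.seq (dropBlock .path)

/-- Move all tokens on the leaves to their goal vertices. -/
def solveLeaves : Prog Stack Γ' :=
  .loop <| scan.bind fun
    | some .ket => (moveBlock .leaves .path).seq <| (Prog.push .leaves .bra).seq <|
        (Prog.push .leaves .bra).seq <| (moveAll .leavesAux .leaves).seq solveOrbit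
    | _ => .ret (some .blank)

/-- Test whether the number of swaps is at most the bound. -/
def compareBound : Prog Stack Γ' :=
  .loop <| (Prog.pop .swaps).bind fun
    | none => .ret (some (.bit true))
    | some _ => (decr .temp .bound).bind fun
        | some _ => .ret none
        | none => .ret (some (.bit false))

/-- Empty all stacks. -/
def clearAll : Prog Stack Γ' :=
  (clear .input).seq <| (clear .leaves).seq <| (clear .leavesAux).seq <| (clear .path).seq <|
    (clear .pathAux).seq <| (clear .counter).seq <| (clear .counterAux).seq <|
    (clear .temp).seq <| (clear .swaps).seq <| clear .bound

/-- Read an instance. -/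
def readInstance : Prog Stack Γ' :=
  (moveWord .input .temp).seq <| (clear .temp).seq <| (unary .temp .input .counter).seq <|
    (moveWord .input .temp).seq <| (Prog.push .bound .comma).seq <|
    (moveAll .temp .bound).seq <| (readList .leavesAux).seq <|
    (moveAll .leavesAux .leaves).seq <| (readList .pathAux).seq (moveAll .pathAux .path)

/-- Decide whether an instance has a solution of the given length. -/
def decideInstance : Prog Stack Γ' :=
  readInstance.seq <| solvePath.seq <| solveLeaves.seq <| compareBound.bind fun r =>
    clearAll.seq (.ret r)

/-- The blocks of a list of tokens. -/
def blocks (l : List (Γ' × ℕ)) : List Γ' := l.flatMap block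

/-- The sign at both ends makes a block a palindrome. Moving a stack letter by letter therefore
reverses the order of the blocks only. -/
theorem reverse_block (x : Γ' × ℕ) : (block x).reverse = block x := by
  simp [block]

theorem blocks_cons (x : Γ' × ℕ) (l : List (Γ' × ℕ)) : blocks (x :: l) = block x ++ blocks l :=
  List.flatMap_cons

theorem blocks_append (l l' : List (Γ' × ℕ)) : blocks (l ++ l') = blocks l ++ blocks l' :=
  List.flatMap_append

theorem reverse_blocks (l : List (Γ' × ℕ)) : (blocks l).reverse = blocks l.reverse := by
  induction l with
  | nil => rfl
  | cons x l ih =>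
    rw [blocks_cons, List.reverse_append, ih, reverse_block, List.reverse_cons, blocks_append]
    simp [blocks]

theorem length_block (x : Γ' × ℕ) : (block x).length = x.2 + 2 := by
  simp [block]

theorem length_blocks_le {B : ℕ} {l : List (Γ' × ℕ)} (h : ∀ x ∈ l, x.2 ≤ B) :
    (blocks l).length ≤ l.length * (B + 2) := by
  induction l with
  | nil => simp [blocks]
  | cons x l ih =>
    rw [blocks_cons, List.length_append, length_block, List.length_cons, add_mul]
    have h1 := h x (List.mem_cons_self ..)
    have h2 := ih fun y hy => h y (List.mem_cons_of_mem _ hy)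
    omega

theorem intBlock_ne_blank (z : ℤ) : (intBlock z).1 ≠ .blank := by
  unfold intBlock; split_ifs <;> simp

theorem block_eq_cons (s : Γ') (n : ℕ) (x : List Γ') :
    block (s, n) ++ x = s :: (List.replicate n .blank ++ s :: x) := by
  simp [block]

/-! ### Reading an instance -/

variable {i l l' p p' c c' s b : List Γ'}

/-- A bound on the time for reading an integer. -/
def readTime (B : ℕ) : ℕ := (B + 3) * (decrTime B + 1)

theorem decrTime_mono {a b : ℕ} (h : a ≤ b) : decrTime a ≤ decrTime b := by
  unfold decrTime; omega

/-- The bound `B` limits the values, for their unary form, as well as the lengths of their binary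
words. A negative number is decremented first, since its block stores the index of its goal leaf.
The list comes out reversed, and a later `moveAll` restores its order. -/
theorem runs_readList {a : Stack} (ha : a ≠ .input) (ha' : a ≠ .temp) {zs : List ℤ} {x : List Γ'}
    {B : ℕ} (hB : ∀ z ∈ zs, z.natAbs ≤ B ∧ (encodeNat z.natAbs).length ≤ B)
    {S : Stack → List Γ'} (hS : S .temp = [])
    (h : S .input = .bra :: (zs.flatMap encodeIntWord ++ .ket :: x)) :
    Runs (readList a) S (zs.length * readTime B + 3) (some .blank)
      (update (update S .input x) a (blocks (zs.map intBlock).reverse ++ S a)) := by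
  have key : ∀ (S : Stack → List Γ'), S .temp = [] →
      S .input = zs.flatMap encodeIntWord ++ .ket :: x →
      Runs (.loop <| (Prog.pop .input).bind (readInt a)) S (zs.length * readTime B + 2) (some .blank)
      (update (update S .input x) a (blocks (zs.map intBlock).reverse ++ S a)) := by
    clear h
    induction zs with
    | nil =>
      intro S hS h
      refine Runs.congr (Runs.loop_some ((runs_pop_cons h).bind (runs_ret (some Γ'.blank) _)))
        (by simp) ?_
      simp [blocks, ha]
    | cons z zs ih =>
      intro S hS h
      obtain ⟨hz, hzs⟩ := List.forall_mem_cons.1 hB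
      specialize ih hzs
      rw [List.flatMap_cons, encodeIntWord, encodeNatWord] at h
      simp only [List.cons_append, List.append_assoc, List.nil_append] at h
      have hw : ofBits (encodeNat z.natAbs) = z.natAbs := ofBits_encodeNat _
      have hd : decrTime (encodeNat z.natAbs).length ≤ decrTime B := decrTime_mono hz.2
      by_cases hneg : z < 0
      · rw [decide_eq_true hneg] at h
        obtain ⟨v, h1, h2, h3⟩ := exists_runs_decr (temp := Stack.temp) (a := Stack.input)
          (by decide) (S := update S .input ((encodeNat z.natAbs).map .bit ++
            .comma :: (zs.flatMap encodeIntWord ++ .ket :: x))) (by simpa using hS)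
          (update_self ..) (by rw [hw]; omega)
        have h4 := runs_unary (temp := Stack.temp) (a := Stack.input) (b := a) (by decide) ha'.symm
          ha.symm (S := update (update S .input (v.map .bit ++
            .comma :: (zs.flatMap encodeIntWord ++ .ket :: x))) a (.ket :: S a))
          (by simpa [ha'.symm] using hS) (w := v)
          (x := zs.flatMap encodeIntWord ++ .ket :: x) (by simp [ha.symm])
        have h5 := runs_push a Γ'.ket (update S .input (v.map .bit ++
            .comma :: (zs.flatMap encodeIntWord ++ .ket :: x)))
        rw [update_of_ne ha] at h5
        rw [update_idem] at h3
        have h6 := ih (update (update S .input (zs.flatMap encodeIntWord ++ .ket :: x)) a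
          (block (.ket, ofBits v) ++ S a)) (by simpa [ha'.symm] using hS) (by simp [ha.symm])
        have h7 := (runs_pop_cons h).bind (f := readInt a) (h3.seq (h5.seq (h4.seq (runs_push a _ _))))
        refine Runs.congr (Runs.loop_none (h7.congr le_rfl ?_) h6) ?_ ?_
        · ext1 j
          by_cases hs : j = a <;> by_cases hs' : j = .input <;> simp_all [block]
        · have : (ofBits v + 1) * (decrTime v.length + 1) ≤ (B + 1) * (decrTime B + 1) := by
            rw [h1]
            exact Nat.mul_le_mul (by omega) (by omega)
          have h8 : readTime B = (B + 1) * (decrTime B + 1) + 2 * (decrTime B + 1) := by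
            unfold readTime; ring
          have h9 : 10 ≤ decrTime B := by unfold decrTime; omega
          have h10 : (zs.length + 1) * readTime B = zs.length * readTime B + readTime B := by ring
          rw [List.length_cons]
          omega
        · have : intBlock z = (.ket, ofBits v) := by
            rw [intBlock, if_neg (by omega)]
            congr 1
            omega
          ext1 j
          by_cases hs : j = a <;> by_cases hs' : j = .input <;>
            simp_all [blocks]
      · rw [decide_eq_false hneg] at h
        have h4 := runs_unary (temp := Stack.temp) (a := Stack.input) (b := a) (by decide) ha'.symm
          ha.symm (S := update (update S .input ((encodeNat z.natAbs).map .bit ++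
            .comma :: (zs.flatMap encodeIntWord ++ .ket :: x))) a (.bra :: S a))
          (by simpa [ha'.symm] using hS) (w := encodeNat z.natAbs)
          (x := zs.flatMap encodeIntWord ++ .ket :: x) (by simp [ha.symm])
        have h5 := runs_push a Γ'.bra (update S .input ((encodeNat z.natAbs).map .bit ++
            .comma :: (zs.flatMap encodeIntWord ++ .ket :: x)))
        rw [update_of_ne ha] at h5
        have h6 := ih (update (update S .input (zs.flatMap encodeIntWord ++ .ket :: x)) a
          (block (.bra, z.natAbs) ++ S a)) (by simpa [ha'.symm] using hS) (by simp [ha.symm])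
        have h7 := (runs_pop_cons h).bind (f := readInt a) (h5.seq (h4.seq (runs_push a _ _)))
        rw [hw] at h7
        refine Runs.congr (Runs.loop_none (h7.congr le_rfl ?_) h6) ?_ ?_
        · ext1 j
          by_cases hs : j = a <;> by_cases hs' : j = .input <;> simp_all [block]
        · have : (z.natAbs + 1) * (decrTime (encodeNat z.natAbs).length + 1) ≤
              (B + 1) * (decrTime B + 1) := Nat.mul_le_mul (by omega) (by omega)
          have h8 : readTime B = (B + 1) * (decrTime B + 1) + 2 * (decrTime B + 1) := by
            unfold readTime; ring
          have h9 : 10 ≤ decrTime B := by unfold decrTime; omega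
          have h10 : (zs.length + 1) * readTime B = zs.length * readTime B + readTime B := by ring
          rw [List.length_cons]
          omega
        · have : intBlock z = (.bra, z.natAbs) := by
            rw [intBlock, if_pos (by omega)]
            congr 1
            omega
          ext1 j
          by_cases hs : j = a <;> by_cases hs' : j = .input <;>
            simp_all [blocks]
  refine ((runs_pop_cons h).seq (key _ (by simpa using hS) (by simp))).congr (by omega) ?_
  simp [ha]

end StarPath

namespace StarPath

open Computability StackProgram StackProgram.Prog Function

/-! ### The running times of the parts of the program -/

/-- All blocks of the list have signs that are not blank, and the numbers in them and their number
are less than `M - 2`. -/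
def Small (M : ℕ) (l : List (Γ' × ℕ)) : Prop :=
  l.length + 3 ≤ M ∧ ∀ x ∈ l, x.1 ≠ .blank ∧ x.2 + 3 ≤ M

variable {M k : ℕ} {i p p' c c' t s b x x' : List Γ'} {y : Γ' × ℕ} {l l₁ l₂ : List (Γ' × ℕ)}

/-- There are at most `M - 3` blocks of at most `M - 1` letters each. The left side is the time to
move them all. -/
theorem Small.length_blocks (h : Small M l) : 2 * (blocks l).length + 2 ≤ 2 * M ^ 2 := by
  have h1 := length_blocks_le (B := M - 2) (l := l) fun x hx => by have := (h.2 x hx).2; omega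
  have h2 := h.1
  obtain ⟨N, rfl⟩ := Nat.exists_eq_add_of_le h2
  have h3 : l.length + 3 + N - 2 + 2 = l.length + 3 + N := by omega
  rw [h3] at h1
  nlinarith

theorem Small.of_perm {l' : List (Γ' × ℕ)} (h : Small M l) (hl : l'.Perm l) : Small M l' :=
  ⟨by rw [hl.length_eq]; exact h.1, fun x hx => h.2 x (hl.subset hx)⟩

theorem Small.of_sublist {l' : List (Γ' × ℕ)} (h : Small M l) (hl : l'.Sublist l) : Small M l' :=
  ⟨by have := h.1; have := hl.length_le; omega, fun x hx => h.2 x (hl.subset hx)⟩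

/-- The unary number of the token on the vertex `0` is the loop counter: each blank lets one leaf
block pass, until the closing sign stops the loop in front of the goal leaf. -/
theorem runs_goHome_loop (hl : ∀ x ∈ l, x.1 ≠ .blank ∧ x.2 + 3 ≤ M) :
    Runs (κ := Stack) (A := Γ') (.loop <| (Prog.pop .path).bind fun
      | some .blank => moveBlock .leaves .leavesAux
      | _ => .ret (some .blank))
      (store i (blocks l ++ x) x' (List.replicate l.length .blank ++ .ket :: p) p' c c' t s b)
      (l.length * (2 * M + 1) + 2) (some .blank)
      (store i x (blocks l.reverse ++ x') p p' c c' t s b) := by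
  induction l generalizing x' with
  | nil =>
    refine Runs.congr (Runs.loop_some ((runs_pop_cons (k := Stack.path) (x := Γ'.ket) (l := p) rfl).bind
      (runs_ret (some Γ'.blank) _))) (by simp) ?_
    simp [update_store, blocks]
  | cons y l ih =>
    obtain ⟨hy, hl⟩ := List.forall_mem_cons.1 hl
    refine Runs.congr (Runs.loop_none ((runs_pop_cons (k := Stack.path) (x := Γ'.blank)
      (l := List.replicate l.length .blank ++ .ket :: p) rfl).bind ?_) (ih hl
      (x' := block y ++ x'))) (t := 1 + 2 * M + (l.length * (2 * M + 1) + 2)) ?_ ?_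
    · rw [blocks_cons, List.append_assoc]
      refine (runs_moveBlock (a := Stack.leaves) (b := Stack.leavesAux) (by decide) hy.1
        (x := blocks l ++ x) rfl).congr (by omega) ?_
      simp only [update_store, store]
    · rw [List.length_cons]
      ring_nf
      omega
    · simp [blocks]

theorem runs_goHome (hs : Small M (l₁ ++ y :: l₂)) :
    Runs goHome (store i (blocks (l₁ ++ y :: l₂)) [] (block (.ket, l₁.length) ++ p) p' c c' t s b)
      (8 * M ^ 2) (some .blank)
      (store i (blocks (l₁ ++ (.comma, 0) :: l₂)) [] (block y ++ p) p' c c' t s b) := by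
  have hy := hs.2 y (by simp)
  have h1 : ∀ x ∈ l₁, x.1 ≠ .blank ∧ x.2 + 3 ≤ M := fun x hx => hs.2 x (by simp [hx])
  have h2 : Small M l₁.reverse := hs.of_sublist
    (l' := l₁) (by simp) |>.of_perm (List.reverse_perm _)
  apply Runs.congr
  case h =>
    unfold goHome
    rw [block_eq_cons, blocks_append, blocks_cons]
    apply Runs.seq
    · exact runs_pop_cons (by rfl)
    simp only [update_store]
    apply Runs.seq
    · exact runs_goHome_loop h1
    apply Runs.seq
    · exact runs_moveBlock (by decide) hy.1 (by rfl)
    simp only [update_store]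
    apply Runs.seq
    · exact runs_push _ _ _
    simp only [update_store]
    apply Runs.seq
    · exact runs_push _ _ _
    simp only [update_store]
    exact runs_moveAll (by decide) (by rfl)
  case ht =>
    have h3 := h2.length_blocks
    have h4 := hs.1
    simp only [List.append_nil, List.length_append, List.length_cons, store] at h3 h4 ⊢
    have h5 : l₁.length * (2 * M + 1) ≤ M * (2 * M + 1) := Nat.mul_le_mul_right _ (by omega)
    nlinarith
  case hS =>
    simp only [update_store, store, List.append_nil]
    rw [reverse_blocks, List.reverse_reverse, blocks_append, blocks_cons]
    rfl

/-- Each blank of the block is matched with one from `counter`; `d` is the surplus that stays there,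
and `e` is what has been transferred before. -/
theorem runs_moveTest_loop {a a' : Stack} (haa : a ≠ a') (ha : a ≠ .counter)
    (ha' : a ≠ .counterAux) (hb : a' ≠ .counter) (hb' : a' ≠ .counterAux) {n d e : ℕ}
    {S : Stack → List Γ'} (h : S a = List.replicate n .blank ++ .bra :: x)
    (hc : S .counter = List.replicate (n + d) .blank)
    (hc' : S .counterAux = List.replicate e .blank) :
    Runs (κ := Stack) (A := Γ') (.loop <| (Prog.pop a).bind fun
      | some .blank => (Prog.push a' .blank).seq
          ((Prog.pop .counter).seq (.push .counterAux .blank))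
      | _ => (Prog.push a' .bra).seq (.ret (some .blank))) S (4 * n + 3) (some .blank)
      (update (update (update (update S a x) a' (.bra :: (List.replicate n .blank ++ S a')))
        .counter (List.replicate d .blank)) .counterAux (List.replicate (e + n) .blank)) := by
  induction n generalizing S e with
  | zero =>
    refine Runs.congr (Runs.loop_some ((runs_pop_cons h).bind
      ((runs_push a' Γ'.bra _).seq (runs_ret (some Γ'.blank) _)))) le_rfl ?_
    ext1 j
    by_cases h1 : j = a <;> by_cases h2 : j = a' <;> by_cases h3 : j = .counter <;>
      by_cases h4 : j = .counterAux <;> simp_all [haa.symm, ha.symm]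
  | succ n ih =>
    refine Runs.congr (Runs.loop_none ((runs_pop_cons (x := Γ'.blank)
      (l := List.replicate n Γ'.blank ++ .bra :: x) h).bind
      ((runs_push a' Γ'.blank _).seq ((runs_pop_cons (x := Γ'.blank)
        (l := List.replicate (n + d) Γ'.blank) ?_).seq (runs_push _ _ _))))
      (ih (e := e + 1) ?_ ?_ ?_)) (by omega) ?_
    · rw [update_of_ne hb.symm, update_of_ne ha.symm, hc, Nat.add_right_comm, List.replicate_succ]
    · simp [ha, ha', haa]
    · simp
    · simp [hb'.symm, ha'.symm, hc', List.replicate_succ]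
    · have : e + 1 + n = e + (n + 1) := by omega
      ext1 j
      by_cases h1 : j = a <;> by_cases h2 : j = a' <;> by_cases h3 : j = .counter <;>
        by_cases h4 : j = .counterAux <;>
        simp_all [haa.symm, hb'.symm, ha'.symm, hb.symm, List.replicate_succ']

/-- By `hyk` the counter is never exhausted too early, so it is empty at the end exactly in case of
equality. A blocks with another sign needs no comparison. -/
theorem runs_moveTest {a a' : Stack} (haa : a ≠ a') (ha : a ≠ .counter)
    (ha' : a ≠ .counterAux) (hb : a' ≠ .counter) (hb' : a' ≠ .counterAux)
    {S : Stack → List Γ'} (h : S a = block y ++ x) (hy : y.1 ≠ .blank) (hyM : y.2 + 3 ≤ M)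
    (hyk : y.1 = .bra → y.2 ≤ k) (hk : k + 3 ≤ M)
    (hc : S .counter = List.replicate k .blank) (hc' : S .counterAux = []) :
    Runs (moveTest a a') S (6 * M) (if y = (.bra, k) then some .blank else none)
      (update (update S a x) a' (block y ++ S a')) := by
  obtain ⟨z, n⟩ := y
  rw [block_eq_cons] at h
  by_cases hz : z = .bra
  · subst hz
    obtain ⟨d, rfl⟩ := Nat.exists_eq_add_of_le (hyk rfl)
    have hl := runs_moveTest_loop haa ha ha' hb hb' (n := n) (d := d) (e := 0) (x := x)
      (S := update (update S a (List.replicate n .blank ++ .bra :: x)) a' (.bra :: S a'))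
      (by simp [haa]) (by simp [hb.symm, ha.symm, hc]) (by simp [hb'.symm, ha'.symm, hc'])
    have hp := runs_push a' Γ'.bra (update S a (List.replicate n .blank ++ .bra :: x))
    rw [update_of_ne haa.symm] at hp
    obtain _ | d := d
    · rw [if_pos (by simp)]
      refine Runs.congr ((runs_pop_cons h).bind (hp.seq (hl.seq ((runs_pop_nil (by simp)).bind
        ((runs_moveAll (x := List.replicate n .blank) (by decide) (by simp)).seq
        (runs_ret _ _)))))) ?_ ?_
      · simp only [List.length_replicate]
        simp only at hyM
        omega
      · ext1 j
        by_cases h1 : j = a <;> by_cases h2 : j = a' <;> by_cases h3 : j = .counter <;>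
          by_cases h4 : j = .counterAux <;> simp_all [block]
    · rw [if_neg (by simp)]
      refine Runs.congr ((runs_pop_cons h).bind (hp.seq (hl.seq ((runs_pop_cons (x := Γ'.blank)
        (l := List.replicate d .blank) (by simp [List.replicate_succ])).bind
        ((runs_push _ _ _).seq
        ((runs_moveAll (x := List.replicate n .blank) (by decide) (by simp)).seq
        (runs_ret _ _))))))) ?_ ?_
      · simp only [List.length_replicate]
        simp only at hyM
        omega
      · ext1 j
        by_cases h1 : j = a <;> by_cases h2 : j = a' <;> by_cases h3 : j = .counter <;>
          by_cases h4 : j = .counterAux <;> simp_all [block, List.replicate_succ]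
        rw [← List.replicate_succ, List.replicate_append_replicate]
  · rw [if_neg (by simp [hz])]
    have hp := runs_push a z (update S a (List.replicate n .blank ++ z :: x))
    rw [update_self, update_idem, ← h, update_eq_self] at hp
    have hm := hp.seq (runs_moveBlock haa hy (h.trans (block_eq_cons _ _ _).symm))
    refine Runs.congr ((runs_pop_cons h).bind (t' := 2 * M + 1) (r' := none)
      (S'' := update (update S a x) a' (block (z, n) ++ S a')) ?_) (by omega) rfl
    have := hm.mono (show _ ≤ 2 * M + 1 by simp only at hyM ⊢; omega)
    cases z <;> first | exact (hz rfl).elim | exact this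

end StarPath

/-! ### Moving the largest misplaced token on the stacks. -/

namespace StarPath

open Computability StackProgram StackProgram.Prog Function

variable {M k : ℕ} {i p p' c c' t s b x x' : List Γ'} {y : Γ' × ℕ} {l l' l₁ l₂ : List (Γ' × ℕ)}

section Find

variable {a a' : Stack} (haa : a ≠ a') (ha : a ≠ .counter) (ha' : a ≠ .counterAux)
  (hb : a' ≠ .counter) (hb' : a' ≠ .counterAux) {S : Stack → List Γ'} (hk : k + 3 ≤ M)
  (hc : S .counter = List.replicate k .blank) (hc' : S .counterAux = [])

include haa ha ha' hb hb' hk hc hc'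

theorem runs_find_body (h : S a = block y ++ x) (hy : y.1 ≠ .blank) (hyM : y.2 + 3 ≤ M)
    (hyk : y.1 = .bra → y.2 ≤ k) :
    Runs ((Prog.pop a).bind fun
      | none => .ret (some .comma)
      | some x => (Prog.push a x).seq (moveTest a a')) S (7 * M)
      (if y = (.bra, k) then some .blank else none)
      (update (update S a x) a' (block y ++ S a')) := by
  have hp := runs_push a y.1 (update S a (List.replicate y.2 .blank ++ y.1 :: x))
  have h' : S a = y.1 :: (List.replicate y.2 .blank ++ y.1 :: x) := by
    rw [h, ← block_eq_cons]
  rw [update_self, update_idem, ← h', update_eq_self] at hp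
  exact ((runs_pop_cons h').bind (hp.seq
    (runs_moveTest haa ha ha' hb hb' h hy hyM hyk hk hc hc'))).mono (by omega)

theorem runs_find_of_mem (h : S a = blocks (l₁ ++ (.bra, k) :: l₂))
    (hl : ∀ x ∈ l₁, x.1 ≠ .blank ∧ x.2 + 3 ≤ M) (hlk : ∀ x ∈ l₁, x.1 = .bra → x.2 < k) :
    Runs (find a a') S ((l₁.length + 1) * (7 * M)) (some .blank)
      (update (update S a (blocks l₂)) a' (blocks ((.bra, k) :: l₁.reverse) ++ S a')) := by
  induction l₁ generalizing S with
  | nil =>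
    have h1 := runs_find_body haa ha ha' hb hb' hk hc hc' (y := (.bra, k)) (x := blocks l₂)
      (by rw [h]; rfl) (by simp) hk (by simp)
    rw [if_pos rfl] at h1
    refine h1.loop_some.congr (by simp) ?_
    simp [blocks]
  | cons z l₁ ih =>
    obtain ⟨hz, hl⟩ := List.forall_mem_cons.1 hl
    obtain ⟨hzk, hlk⟩ := List.forall_mem_cons.1 hlk
    have h1 := runs_find_body haa ha ha' hb hb' hk hc hc' (y := z)
      (x := blocks (l₁ ++ (.bra, k) :: l₂)) (by rw [h]; rfl) hz.1 hz.2 fun e => (hzk e).le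
    rw [if_neg fun e => (hzk (by rw [e])).ne (by rw [e])] at h1
    refine (h1.loop_none (ih (S := update (update S a (blocks (l₁ ++ (.bra, k) :: l₂))) a'
      (block z ++ S a')) ?_ ?_ ?_ hl hlk)).congr ?_ ?_
    · simp [hb.symm, ha.symm, hc]
    · simp [hb'.symm, ha'.symm, hc']
    · simp [haa]
    · rw [List.length_cons]
      ring_nf
      omega
    · ext1 j
      by_cases h2 : j = a <;> by_cases h3 : j = a' <;> simp_all [blocks]

theorem runs_find_of_notMem (h : S a = blocks l)
    (hl : ∀ x ∈ l, x.1 ≠ .blank ∧ x.2 + 3 ≤ M) (hlk : ∀ x ∈ l, x.1 = .bra → x.2 < k) :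
    Runs (find a a') S (l.length * (7 * M) + 2) (some .comma)
      (update (update S a []) a' (blocks l.reverse ++ S a')) := by
  induction l generalizing S with
  | nil =>
    refine Runs.congr (Runs.loop_some ((runs_pop_nil h).bind (runs_ret _ _))) (by simp) ?_
    have h : S a = [] := h
    rw [← h, update_eq_self]
    simp [blocks]
  | cons z l₁ ih =>
    obtain ⟨hz, hl⟩ := List.forall_mem_cons.1 hl
    obtain ⟨hzk, hlk⟩ := List.forall_mem_cons.1 hlk
    have h1 := runs_find_body haa ha ha' hb hb' hk hc hc' (y := z)
      (x := blocks l₁) (by rw [h]; rfl) hz.1 hz.2 fun e => (hzk e).le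
    rw [if_neg fun e => (hzk (by rw [e])).ne (by rw [e])] at h1
    refine (h1.loop_none (ih (S := update (update S a (blocks l₁)) a'
      (block z ++ S a')) ?_ ?_ ?_ hl hlk)).congr ?_ ?_
    · simp [hb.symm, ha.symm, hc]
    · simp [hb'.symm, ha'.symm, hc']
    · simp [haa]
    · rw [List.length_cons]
      ring_nf
      omega
    · ext1 j
      by_cases h2 : j = a <;> by_cases h3 : j = a' <;> simp_all [blocks]

end Find

/-- The blocks that remain on the stack stand for the vertices over which the token has still to
move, with one swap for each. -/
theorem runs_countBlocks (hl : ∀ x ∈ l, x.1 ≠ .blank ∧ x.2 + 3 ≤ M) :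
    Runs (κ := Stack) (A := Γ') (.loop <| (Prog.pop .path).bind fun
      | none => .ret (some .blank)
      | some x => (Prog.push .path x).seq <| (moveBlock .path .pathAux).seq countSwap)
      (store i x x' (blocks l) p' c c' t s b) (l.length * (2 * M + 3) + 2) (some .blank)
      (store i x x' [] (blocks l.reverse ++ p') c c' t
        (List.replicate l.length .blank ++ s) b) := by
  induction l generalizing p' s with
  | nil =>
    exact (Runs.loop_some ((runs_pop_nil rfl).bind (runs_ret _ _))).congr (by simp) rfl
  | cons y l ih =>
    obtain ⟨hy, hl⟩ := List.forall_mem_cons.1 hl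
    apply Runs.congr
    case h =>
      apply Runs.loop_none
      · rw [blocks_cons]
        apply Runs.bind
        · exact runs_pop_cons (x := y.1) (l := List.replicate y.2 .blank ++ y.1 :: blocks l)
            (block_eq_cons y.1 y.2 _)
        simp only [update_store]
        apply Runs.seq
        · exact runs_push _ _ _
        simp only [update_store]
        apply Runs.seq
        · exact runs_moveBlock (by decide) hy.1 (block_eq_cons y.1 y.2 _).symm
        simp only [update_store]
        exact runs_push _ _ _
      simp only [update_store]
      exact ih hl
    case ht =>
      rw [List.length_cons]
      ring_nf
      omega
    case hS =>
      simp [store, blocks, List.replicate_succ']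

theorem runs_countCounter :
    Runs (κ := Stack) (A := Γ') (.loop <| (Prog.pop .counter).bind fun
      | none => .ret (some .blank)
      | some _ => (Prog.push .counterAux .blank).seq countSwap)
      (store i x x' p p' (List.replicate k .blank) c' t s b) (3 * k + 2) (some .blank)
      (store i x x' p p' [] (List.replicate k .blank ++ c') t
        (List.replicate k .blank ++ s) b) := by
  induction k generalizing c' s with
  | zero =>
    exact (Runs.loop_some ((runs_pop_nil rfl).bind (runs_ret _ _))).congr (by simp) rfl
  | succ k ih =>
    apply Runs.congr
    case h =>
      apply Runs.loop_none
      · apply Runs.bind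
        · exact runs_pop_cons (x := Γ'.blank) (l := List.replicate k .blank) rfl
        simp only [update_store]
        apply Runs.seq
        · exact runs_push _ _ _
        simp only [update_store]
        exact runs_push _ _ _
      simp only [update_store]
      exact ih
    case ht => omega
    case hS => simp [store, List.replicate_succ']

/-- The walk of the token `k` shifts all tokens behind it by one vertex to the left, and so does the
deletion of its block. The vertex `k`, now solved, is no longer represented. -/
theorem runs_moveLargest_path (hs : Small M (l₁ ++ (.bra, k) :: l₂))
    (hlk : ∀ x ∈ l₁, x.1 = .bra → x.2 < k) :
    Runs moveLargest (store i x [] (blocks (l₁ ++ (.bra, k) :: l₂)) []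
      (List.replicate k .blank) [] t s b) (30 * M ^ 2) (some .blank)
      (store i x [] (blocks (l₁ ++ l₂)) [] (List.replicate k .blank) [] t
        (List.replicate l₂.length .blank ++ s) b) := by
  have h1 : ∀ x ∈ l₁, x.1 ≠ .blank ∧ x.2 + 3 ≤ M := fun x hx => hs.2 x (by simp [hx])
  have h2 : ∀ x ∈ l₂, x.1 ≠ .blank ∧ x.2 + 3 ≤ M := fun x hx => hs.2 x (by simp [hx])
  have hk : k + 3 ≤ M := (hs.2 (.bra, k) (by simp)).2
  have h3 : Small M (l₂.reverse ++ l₁.reverse) := (hs.of_sublist (l' := l₁ ++ l₂) (by simp)).of_perm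
    (((List.reverse_perm _).append (List.reverse_perm _)).trans List.perm_append_comm)
  apply Runs.congr
  case h =>
    unfold moveLargest
    apply Runs.bind
    · exact runs_find_of_mem (by decide) (by decide) (by decide) (by decide) (by decide) hk rfl rfl
        rfl h1 hlk
    simp only [update_store]
    apply Runs.seq
    · exact runs_dropBlock (y := (.bra, k)) (x := blocks l₁.reverse) (by simp)
        (by simp only [store, blocks_cons, List.append_nil])
    simp only [update_store]
    apply Runs.seq
    · exact runs_countBlocks h2
    exact runs_moveAll (x := blocks (l₂.reverse ++ l₁.reverse)) (by decide)
      (by simp only [store, blocks_append])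
  case ht =>
    have h4 := h3.length_blocks
    have h5 := hs.1
    simp only [List.length_append, List.length_cons] at h5
    have h6 : (l₁.length + 1) * (7 * M) ≤ M * (7 * M) := Nat.mul_le_mul_right _ (by omega)
    have h7 : l₂.length * (2 * M + 3) ≤ M * (2 * M + 3) := Nat.mul_le_mul_right _ (by omega)
    simp only
    nlinarith
  case hS =>
    simp only [update_store, store, List.append_nil]
    rw [reverse_blocks]
    simp

/-- The token from the vertex `0` takes the place of `k` on the leaf, and its removal from the path
shifts all others to the left. One swap leads to the vertex `0` and `k` more along the path. -/
theorem runs_moveLargest_leaf (hs : Small M (l₁ ++ (.bra, k) :: l₂)) (hs' : Small M (y :: l))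
    (hlk : ∀ x ∈ l₁, x.1 = .bra → x.2 < k) (hlk' : ∀ x ∈ y :: l, x.1 = .bra → x.2 < k) :
    Runs moveLargest (store i (blocks (l₁ ++ (.bra, k) :: l₂)) [] (blocks (y :: l)) []
      (List.replicate k .blank) [] t s b) (40 * M ^ 2) (some .blank)
      (store i (blocks (l₁ ++ y :: l₂)) [] (blocks l) [] (List.replicate k .blank) [] t
        (List.replicate (k + 1) .blank ++ s) b) := by
  have h1 : ∀ x ∈ l₁, x.1 ≠ .blank ∧ x.2 + 3 ≤ M := fun x hx => hs.2 x (by simp [hx])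
  have hk : k + 3 ≤ M := (hs.2 (.bra, k) (by simp)).2
  have hy := hs'.2 y (by simp)
  have h3 : Small M (y :: l₁.reverse) := by
    refine ⟨?_, fun x hx => ?_⟩
    · have := hs.1
      simp only [List.length_append, List.length_cons, List.length_reverse] at this ⊢
      omega
    · obtain rfl | hx := List.mem_cons.1 hx
      · exact hy
      · exact h1 x (List.mem_reverse.1 hx)
  apply Runs.congr
  case h =>
    unfold moveLargest
    apply Runs.bind
    · exact runs_find_of_notMem (by decide) (by decide) (by decide) (by decide) (by decide) hk rfl
        rfl rfl hs'.2 hlk'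
    simp only [update_store]
    apply Runs.seq
    · exact runs_moveAll (x := blocks (y :: l).reverse) (by decide)
        (by simp only [store, List.append_nil])
    simp only [update_store]
    rw [reverse_blocks, List.reverse_reverse]
    apply Runs.seq
    · exact runs_find_of_mem (by decide) (by decide) (by decide) (by decide) (by decide) hk rfl rfl
        rfl h1 hlk
    simp only [update_store]
    apply Runs.seq
    · exact runs_dropBlock (y := (.bra, k)) (x := blocks l₁.reverse) (by simp)
        (by simp only [store, blocks_cons, List.append_nil])
    simp only [update_store]
    apply Runs.seq
    · exact runs_moveBlock (y := y) (x := blocks l) (by decide) hy.1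
        (by simp only [store, blocks_cons, List.append_nil])
    simp only [update_store]
    apply Runs.seq
    · exact runs_moveAll (x := blocks (y :: l₁.reverse)) (by decide)
        (by simp only [store, blocks_cons])
    simp only [update_store]
    apply Runs.seq
    · exact runs_push _ _ _
    simp only [update_store]
    apply Runs.seq
    · exact runs_countCounter
    exact runs_moveAll (x := List.replicate k Γ'.blank) (by decide)
      (by simp only [store, List.append_nil])
  case ht =>
    have h4 := h3.length_blocks
    have h4' := (hs'.of_perm (List.reverse_perm _)).length_blocks
    have h5 := hs.1
    have h5' := hs'.1
    simp only [List.length_append, List.length_cons] at h5 h5'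
    have h6 : (l₁.length + 1) * (7 * M) ≤ M * (7 * M) := Nat.mul_le_mul_right _ (by omega)
    have h7 : (l.length + 1) * (7 * M) ≤ M * (7 * M) := Nat.mul_le_mul_right _ (by omega)
    simp only [List.length_cons, List.length_replicate]
    nlinarith
  case hS =>
    simp only [update_store, store, List.append_nil]
    rw [reverse_blocks]
    simp [blocks, List.replicate_succ']

end StarPath

/-! ### The configuration represented by the stacks. -/

namespace StarPath

open Computability StackProgram StackProgram.Prog Function TokenSwapping

variable {m n : ℕ} {g : Equiv.Perm (Vtx m n)} {k : ℤ} {l p : List (Γ' × ℕ)}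

/-- The tokens above `k` are at their goal vertices, `p` contains the blocks of the tokens on the
vertices `0, …, k`, and `l` those of the tokens on the leaves, where the sign `comma` may mark
tokens that are at their goal vertices. -/
structure Represents (g : Equiv.Perm (Vtx m n)) (k : ℤ) (l p : List (Γ' × ℕ)) : Prop where
  solved : SolvedAbove g k
  le : k ≤ n
  length_leaves : l.length = m
  length_path : (p.length : ℤ) = k + 1
  leaves : ∀ q : Fin m, l[(q : ℕ)]? = some (intBlock (leafTokens g q)) ∨
    (l[(q : ℕ)]? = some (.comma, 0) ∧ g (leaf q) = leaf q)
  path : ∀ q : Fin (n + 1), (q : ℕ) < p.length →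
    p[(q : ℕ)]? = some (intBlock (g (pathVtx q)).1)

theorem intBlock_eq_bra {z : ℤ} {k : ℕ} : intBlock z = (.bra, k) ↔ z = k := by
  unfold intBlock
  split_ifs <;> simp <;> omega

theorem intBlock_eq_ket {z : ℤ} {k : ℕ} : intBlock z = (.ket, k) ↔ z = -(k + 1) := by
  unfold intBlock
  split_ifs <;> simp <;> omega

theorem intBlock_snd_le (v : Vtx m n) : (intBlock v.1).2 ≤ m + n := by
  have h1 := v.2.1
  have h2 := v.2.2
  unfold intBlock
  split_ifs <;> simp only <;> omega

theorem Represents.mem_leaves (h : Represents g k l p) {x : Γ' × ℕ} (hx : x ∈ l) :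
    x = (.comma, 0) ∨ ∃ q : Fin m, x = intBlock (g (leaf q)).1 := by
  obtain ⟨q, hq, rfl⟩ := List.mem_iff_getElem.1 hx
  have hqm : q < m := by rw [← h.length_leaves]; exact hq
  obtain h1 | h1 := h.leaves ⟨q, hqm⟩
  · rw [List.getElem?_eq_getElem hq, Option.some.injEq] at h1
    exact Or.inr ⟨_, h1⟩
  · rw [List.getElem?_eq_getElem hq, Option.some.injEq] at h1
    exact Or.inl h1.1

theorem Represents.length_path_le (h : Represents g k l p) : p.length ≤ n + 1 := by
  have h1 := h.length_path
  have h2 := h.le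
  omega

theorem Represents.mem_path (h : Represents g k l p) {x : Γ' × ℕ} (hx : x ∈ p) :
    ∃ q : Fin (n + 1), (q : ℕ) < p.length ∧ x = intBlock (g (pathVtx q)).1 := by
  obtain ⟨q, hq, rfl⟩ := List.mem_iff_getElem.1 hx
  have hqn := h.length_path_le
  have h1 := h.path ⟨q, by omega⟩ hq
  rw [List.getElem?_eq_getElem hq, Option.some.injEq] at h1
  exact ⟨_, hq, h1⟩

theorem Represents.small_leaves (h : Represents g k l p) : Small (m + n + 4) l := by
  refine ⟨by rw [h.length_leaves]; omega, fun x hx => ?_⟩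
  obtain rfl | ⟨q, rfl⟩ := h.mem_leaves hx
  · exact ⟨by simp, by simp⟩
  · have := intBlock_snd_le (g (leaf q))
    exact ⟨intBlock_ne_blank _, by omega⟩

theorem Represents.small_path (h : Represents g k l p) : Small (m + n + 4) p := by
  refine ⟨by have := h.length_path_le; omega, fun x hx => ?_⟩
  obtain ⟨q, -, rfl⟩ := h.mem_path hx
  have := intBlock_snd_le (g (pathVtx q))
  exact ⟨intBlock_ne_blank _, by omega⟩

/-- The number of negative tokens in a list of blocks. -/
def negCount (l : List (Γ' × ℕ)) : ℕ := l.countP fun x => x.1 = .ket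

/-- A token on a leaf that is not at its goal vertex is not marked. -/
theorem Represents.exists_split (h : Represents g k l p) (q : Fin m)
    (hq : g (leaf q) ≠ leaf q) :
    ∃ l₁ l₂, l = l₁ ++ intBlock (leafTokens g q) :: l₂ ∧ l₁.length = q := by
  have h1 : l[(q : ℕ)]? = some (intBlock (leafTokens g q)) :=
    (h.leaves q).resolve_right fun h => hq h.2
  obtain ⟨hq, h2⟩ := List.getElem?_eq_some_iff.1 h1
  refine ⟨l.take q, l.drop (q + 1), ?_, by simp; omega⟩
  rw [← h2, List.getElem_cons_drop, List.take_append_drop]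

theorem getElem?_replace {α : Type*} (l₁ l₂ : List α) (x y : α) (j : ℕ) :
    (l₁ ++ y :: l₂)[j]? = if j = l₁.length then some y else (l₁ ++ x :: l₂)[j]? := by
  rcases lt_trichotomy j l₁.length with hj | rfl | hj
  · rw [if_neg hj.ne, List.getElem?_append_left hj, List.getElem?_append_left hj]
  · simp
  · rw [if_neg hj.ne', List.getElem?_append_right hj.le, List.getElem?_append_right hj.le]
    obtain ⟨d, hd⟩ := Nat.exists_eq_add_of_lt hj
    rw [show j - l₁.length = d + 1 by omega]
    simp

theorem pathVtx_eq_origin_iff {q : Fin (n + 1)} : (pathVtx q : Vtx m n) = origin m n ↔ q = 0 := by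
  rw [← pathVtx_zero]
  exact pathVtx_injective.eq_iff

theorem Represents.head (h : Represents g k l p) {y : Γ' × ℕ} {p₂ : List (Γ' × ℕ)}
    (hp : p = y :: p₂) : y = intBlock (g (origin m n)).1 := by
  have := h.path 0 (by simp [hp])
  rw [hp] at this
  simp only [Fin.val_zero, List.getElem?_cons_zero, Option.some.injEq] at this
  rw [this, pathVtx_zero]

/-- The mark replaces the block of the token that has arrived. It is allowed because this leaf is
correct from now on, and it prevents later scans from taking the leaf for an unsolved one. -/
theorem Represents.goHome {t : ℕ} {p₂ : List (Γ' × ℕ)} (h : Represents g k l ((.ket, t) :: p₂)) :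
    ∃ (q : Fin m) (l₁ l₂ : List (Γ' × ℕ)), (q : ℕ) = t ∧ g (origin m n) = leaf q ∧
      l = l₁ ++ intBlock (leafTokens g q) :: l₂ ∧ l₁.length = t ∧
      Represents (leafSwap g q) k (l₁ ++ (.comma, 0) :: l₂)
        (intBlock (leafTokens g q) :: p₂) := by
  have h0 := intBlock_eq_ket.1 (h.head rfl).symm
  obtain ⟨q, hq⟩ := exists_leaf_of_neg (v := g (origin m n)) (by omega)
  have hqt : (q : ℕ) = t := by
    rw [hq] at h0
    simp only [leaf] at h0
    omega
  have hne : g (leaf q) ≠ leaf q := fun e => leaf_ne_origin q (g.injective (e.trans hq.symm))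
  obtain ⟨l₁, l₂, h1, h2⟩ := h.exists_split q hne
  have hk := h.length_path
  simp only [List.length_cons, Nat.cast_add, Nat.cast_one] at hk
  refine ⟨q, l₁, l₂, hqt, hq, h1, h2.trans hqt, ?_⟩
  constructor
  · intro v hv
    refine leafSwap_fixed hq (h.solved v hv) ?_
    rintro rfl
    simp only [origin] at hv
    omega
  · exact h.le
  · rw [← h.length_leaves, h1]
    simp
  · simpa using h.length_path
  · intro r
    rw [getElem?_replace _ _ (intBlock (leafTokens g q)), ← h1, h2]
    by_cases hrq : r = q
    · subst hrq
      right
      rw [if_pos rfl, leafSwap_leaf, hq]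
      exact ⟨rfl, rfl⟩
    · rw [if_neg fun e => hrq (Fin.ext e), leafTokens_leafSwap, Function.update_of_ne hrq]
      refine (h.leaves r).imp_right fun h => ⟨h.1, ?_⟩
      exact leafSwap_fixed hq h.2 (leaf_ne_origin r)
  · intro r hr
    by_cases hr0 : r = 0
    · subst hr0
      simp [pathVtx_zero, leafSwap_origin, leafTokens]
    · have h3 := h.path r (by simpa using hr)
      obtain ⟨j, hj⟩ : ∃ j, (r : ℕ) = j + 1 :=
        Nat.exists_eq_succ_of_ne_zero fun e => hr0 (Fin.ext e)
      rw [hj, List.getElem?_cons_succ] at h3 ⊢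
      rw [h3, leafSwap_of_ne _ _ fun e => hr0 (pathVtx_eq_origin_iff.1 e)]
      rintro e
      exact leaf_ne_pathVtx _ _ e.symm

end StarPath

/-! ### Simulating the moves of the tokens on the path. -/

namespace StarPath

open Computability StackProgram StackProgram.Prog Function TokenSwapping

theorem sixteen_le_sq (m n : ℕ) : 16 ≤ (m + n + 4) ^ 2 :=
  Nat.pow_le_pow_left (show 4 ≤ m + n + 4 by omega) 2

variable {m n k : ℕ} {g : Equiv.Perm (Vtx m n)} {l p : List (Γ' × ℕ)} {i c c' t s b p' : List Γ'}

/-- The token that goes home turns into a mark and the token `y` merely changes its place, so the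
number of unmarked negative tokens measures the progress of the while loop. -/
theorem negCount_goHome (l₁ l₂ p₂ : List (Γ' × ℕ)) (y : Γ' × ℕ) (v : ℕ) :
    negCount (l₁ ++ (.comma, 0) :: l₂ ++ y :: p₂) + 1 =
      negCount (l₁ ++ y :: l₂ ++ (.ket, v) :: p₂) := by
  simp only [negCount, List.countP_append, List.countP_cons]
  simp
  omega

theorem runs_goHomeLoop_step (hs : Small (m + n + 4) l) {v : ℕ} {l₁ l₂ p₂ : List (Γ' × ℕ)}
    {y : Γ' × ℕ} (hl : l = l₁ ++ y :: l₂) (hv : l₁.length = v) :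
    Runs (κ := Stack) (A := Γ') ((Prog.pop .path).bind fun
      | some .ket => (Prog.push .path .ket).seq (goHome.seq countSwap)
      | some x => (Prog.push .path x).seq (.ret (some x))
      | none => .ret (some .blank))
      (store i (blocks l) [] (blocks ((.ket, v) :: p₂)) p' c c' t s b)
      (9 * (m + n + 4) ^ 2) none
      (store i (blocks (l₁ ++ (.comma, 0) :: l₂)) [] (blocks (y :: p₂)) p' c c' t
        (.blank :: s) b) := by
  subst hl hv
  apply Runs.congr
  case h =>
    apply Runs.bind
    · exact runs_pop_cons (x := Γ'.ket)
        (l := List.replicate l₁.length .blank ++ .ket :: blocks p₂) (block_eq_cons _ _ _)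
    simp only [update_store]
    apply Runs.seq
    · exact runs_push _ _ _
    simp only [update_store]
    apply Runs.seq
    · simp only [store]
      rw [← block_eq_cons]
      exact runs_goHome hs
    exact runs_push _ _ _
  case ht =>
    have := sixteen_le_sq m n
    omega
  case hS => simp only [update_store, store, blocks_cons]

/-- The counted swaps are compared with the loss of Ψ instead of with a run of the algorithm. Added
up over the whole program, this yields Ψ(f) at once. -/
theorem Represents.exists_runs_goHomeLoop (h : Represents g k l p) :
    ∃ (g' : Equiv.Perm (Vtx m n)) (l' p₁ : List (Γ' × ℕ)) (j : ℕ),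
      Runs goHomeLoop (store i (blocks l) [] (blocks p) p' c c' t s b)
        ((negCount (l ++ p) + 1) * (9 * (m + n + 4) ^ 2)) (some .bra)
        (store i (blocks l') [] (blocks p₁) p' c c' t (List.replicate j .blank ++ s) b) ∧
      Represents g' k l' p₁ ∧ 0 ≤ (g' (origin m n)).1 ∧ psiFun g' + j = psiFun g ∧
      negCount (l' ++ p₁) ≤ negCount (l ++ p) := by
  induction hN : negCount (l ++ p) generalizing g l p s with
  | zero | succ N ih =>
    obtain _ | ⟨y, p₂⟩ := p
    · have := h.length_path
      simp only [List.length_nil] at this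
      omega
    have hy := h.head rfl
    by_cases h0 : 0 ≤ (g (origin m n)).1
    · refine ⟨g, l, y :: p₂, 0, ?_, h, h0, by simp, hN.le⟩
      rw [intBlock, if_pos h0] at hy
      subst hy
      apply Runs.congr
      case h =>
        apply Runs.loop_some
        apply Runs.bind
        · exact runs_pop_cons (x := Γ'.bra)
            (l := List.replicate _ .blank ++ .bra :: blocks p₂) (block_eq_cons _ _ _)
        simp only [update_store]
        apply Runs.seq
        · exact runs_push _ _ _
        exact runs_ret _ _
      case ht =>
        have := sixteen_le_sq m n
        rw [add_mul]
        omega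
      case hS =>
        simp only [update_store, store, List.replicate_zero, List.nil_append]
        rw [blocks_cons, block_eq_cons]
    · obtain ⟨v, rfl⟩ : ∃ v, y = (.ket, v) := by
        rw [intBlock, if_neg h0] at hy
        exact ⟨_, hy⟩
      obtain ⟨q, l₁, l₂, h1, h2, h3, h4, h5⟩ := h.goHome
      have hc := negCount_goHome l₁ l₂ p₂ (intBlock (leafTokens g q)) v
      rw [← h3, hN] at hc
      -- For `negCount` zero, `hc` is contradictory; in the other case the induction hypothesis
      -- applies to the remaining rounds.
      first
      | omega
      | obtain ⟨g', l', p₁, j, h6, h7, h8, h9, h10⟩ := ih (s := .blank :: s) h5 (by omega)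
        refine ⟨g', l', p₁, j + 1, ?_, h7, h8, ?_, by omega⟩
        · refine ((runs_goHomeLoop_step h.small_leaves h3 h4).loop_none h6).congr ?_ ?_
          · ring_nf
            omega
          · simp [List.replicate_succ']
        · rw [psiFun_home g q h2] at h9
          push_cast
          omega

/-- The largest misplaced token is on the path or on a leaf; the blocks of smaller tokens do not
match it. -/
theorem SolvedAbove.intBlock_lt (hg : SolvedAbove g k) {u v : Vtx m n} (hu : (g u).1 = k)
    (huv : v ≠ u) (hv : v.1 ≤ k) (hb : (intBlock (g v).1).1 = .bra) :
    (intBlock (g v).1).2 < k := by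
  have h1 := hg.lt_of_apply hu huv hv
  unfold intBlock at hb ⊢
  split_ifs at hb ⊢ with h2
  simp only
  omega

/-- The new configuration is the result of the walk from `exists_path_max`. The clauses on leaf and
path tokens confirm the new blocks, and the length of the walk is the number of counted swaps. -/
theorem Represents.exists_runs_moveLargest (h : Represents g k l p)
    (h0 : 0 ≤ (g (origin m n)).1) :
    ∃ (g' : Equiv.Perm (Vtx m n)) (l' p₁ : List (Γ' × ℕ)) (j : ℕ),
      Runs moveLargest (store i (blocks l) [] (blocks p) [] (List.replicate k .blank) [] t s b)
        (40 * (m + n + 4) ^ 2) (some .blank)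
        (store i (blocks l') [] (blocks p₁) [] (List.replicate k .blank) [] t
          (List.replicate j .blank ++ s) b) ∧
      Represents g' (k - 1) l' p₁ ∧ psiFun g' + j = psiFun g := by
  have hkn : k ≤ n := by exact_mod_cast h.le
  have hpl : p.length = k + 1 := by exact_mod_cast h.length_path
  set K : Vtx m n := pathVtx ⟨k, by omega⟩ with hK
  have hK1 : K.1 = k := rfl
  obtain ⟨w, -, hw1, hw2, hw3, hw4, hw5, hw6, hw7⟩ :=
    exists_path_max (f := g) (k := K) (by omega) (by rw [hK1]; exact h.solved) h0
  have hpsi := hw1.psiFun_eq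
  have hgu : (g (g.symm K)).1 = k := by rw [g.apply_symm_apply, hK1]
  rw [hK1] at hw2
  by_cases hu : 0 ≤ (g.symm K).1
  · have huk : (g.symm K).1 ≤ k := by
      by_contra hc
      have := h.solved _ (not_le.1 hc)
      rw [this] at hgu
      omega
    obtain ⟨u, hu'⟩ := exists_pathVtx_of_nonneg hu
    have hu1 : (g.symm K).1 = u := by rw [hu']; rfl
    have hup : (u : ℕ) < p.length := by omega
    have hpu : p[(u : ℕ)] = (.bra, k) := by
      have := h.path u hup
      rw [List.getElem?_eq_getElem hup, Option.some.injEq] at this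
      rw [this, ← hu', intBlock_eq_bra, hgu]
    have hp : p = p.take u ++ (.bra, k) :: p.drop (u + 1) := by
      rw [← hpu, List.getElem_cons_drop, List.take_append_drop]
    refine ⟨applySwaps g w.edges, l, p.take u ++ p.drop (u + 1), (p.drop (u + 1)).length,
      Runs.mono ?_ (show 30 * (m + n + 4) ^ 2 ≤ _ by omega), ?_, ?_⟩
    rotate_left
    · constructor
      · exact hw2
      · omega
      · exact h.length_leaves
      · simp; omega
      · intro q
        have hq : g.symm K ≠ leaf q := by
          rw [hu']; exact (leaf_ne_pathVtx _ _).symm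
        rw [hw3 q hq]
        refine (h.leaves q).imp_right fun h => ⟨h.1, ?_⟩
        have := hw3 q hq
        exact Subtype.ext (this.trans (congrArg Subtype.val h.2))
      · intro q hq
        simp only [List.length_append, List.length_take, List.length_drop] at hq
        have hqk : (q : ℕ) < k := by omega
        rw [List.getElem?_append, List.length_take, min_eq_left hup.le]
        split_ifs with hqu
        · rw [List.getElem?_take, if_pos hqu, h.path q (by omega), hw5 (pathVtx q)
            (pathVtx_nonneg q) (by rw [hK1]; simpa [pathVtx] using hqk)
            (by rw [hu1]; simpa [pathVtx] using hqu)]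
        · rw [List.getElem?_drop, show (u : ℕ) + 1 + (q - u) = q + 1 by omega]
          have h1 := h.path ⟨q + 1, by omega⟩ (by simp only; omega)
          rw [h1, hw6 (pathVtx q) (pathVtx ⟨q + 1, by omega⟩)
            (pathVtx_nonneg q) (by rw [hK1]; simpa [pathVtx] using hqk)
            (by rw [hu1]; simpa [pathVtx] using hqu) (by simp [pathVtx])]
    · rw [if_pos hu] at hw7
      rw [hpsi, List.length_drop, hpl]
      omega
    · have := runs_moveLargest_path (l₁ := p.take u) (l₂ := p.drop (u + 1)) (k := k) (i := i)
        (x := blocks l) (t := t) (s := s) (b := b) (by rw [← hp]; exact h.small_path) ?_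
      · rwa [← hp] at this
      · intro x hx hxb
        obtain ⟨q, hq, rfl⟩ := List.mem_iff_getElem.1 hx
        simp only [List.length_take] at hq
        have h1 := h.path ⟨q, by omega⟩ (by simp only; omega)
        rw [List.getElem?_eq_getElem (by simp only; omega), Option.some.injEq] at h1
        rw [List.getElem_take] at hxb ⊢
        simp only at h1
        rw [h1] at hxb ⊢
        refine h.solved.intBlock_lt hgu ?_ ?_ hxb
        · rw [hu']
          intro e
          have := congrArg Fin.val (pathVtx_injective e)
          simp only at this
          omega
        · simp only [pathVtx]
          omega
  · obtain ⟨u, hu'⟩ := exists_leaf_of_neg (not_le.1 hu)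
    have hgu' : g (leaf u) = K := by rw [← hu', g.apply_symm_apply]
    obtain ⟨l₁, l₂, hl, hlu⟩ := h.exists_split u (by
      rw [hgu']; exact (leaf_ne_pathVtx _ _).symm)
    have hlk : intBlock (leafTokens g u) = (.bra, k) := by
      rw [intBlock_eq_bra, leafTokens, hgu', hK1]
    rw [hlk] at hl
    obtain _ | ⟨y, p₂⟩ := p
    · simp at hpl
    have hy := h.head rfl
    simp only [List.length_cons, Nat.add_right_cancel_iff] at hpl
    have hlt : ∀ x ∈ y :: p₂, x.1 = .bra → x.2 < k := by
      intro x hx hxb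
      obtain ⟨q, hq, rfl⟩ := h.mem_path hx
      refine h.solved.intBlock_lt hgu ?_ ?_ hxb
      · rw [hu']; exact (leaf_ne_pathVtx _ _).symm
      · simp only [List.length_cons] at hq
        simp only [pathVtx]
        omega
    have hlt' : ∀ x ∈ l₁, x.1 = .bra → x.2 < k := by
      intro x hx hxb
      obtain ⟨q, hq, rfl⟩ := List.mem_iff_getElem.1 hx
      have hqm : q < m := by have := u.2; omega
      have h1 : l[q]? = some l₁[q] := by
        rw [hl, List.getElem?_append_left hq, List.getElem?_eq_getElem hq]
      obtain h2 | h2 := h.leaves ⟨q, hqm⟩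
      · simp only [h1, Option.some.injEq] at h2
        rw [h2] at hxb ⊢
        refine h.solved.intBlock_lt hgu ?_ ?_ hxb
        · rw [hu']
          intro e
          have := congrArg Fin.val (leaf_injective e)
          simp only at this
          omega
        · have := leaf_neg (n := n) ⟨q, hqm⟩
          omega
      · simp only [h1, Option.some.injEq] at h2
        rw [h2.1] at hxb
        simp at hxb
    refine ⟨applySwaps g w.edges, l₁ ++ y :: l₂, p₂, k + 1, ?_, ?_, ?_⟩
    rotate_left
    · constructor
      · exact hw2
      · omega
      · rw [← h.length_leaves, hl]
        simp
      · rw [hpl]; ring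
      · intro q
        rw [getElem?_replace _ _ (.bra, k), ← hl, hlu]
        by_cases hqu : q = u
        · subst hqu
          left
          rw [if_pos rfl, hw4 q hu', ← hy]
        · have hq : g.symm K ≠ leaf q := by
            rw [hu']; exact fun e => hqu (leaf_injective e).symm
          rw [if_neg fun e => hqu (Fin.ext e), hw3 q hq]
          refine (h.leaves q).imp_right fun h => ⟨h.1, ?_⟩
          have := hw3 q hq
          exact Subtype.ext (this.trans (congrArg Subtype.val h.2))
      · intro q hq
        have h1 := h.path ⟨q + 1, by omega⟩ (by simpa using hq)
        rw [List.getElem?_cons_succ] at h1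
        rw [h1, hw6 (pathVtx q) (pathVtx ⟨q + 1, by omega⟩)
            (pathVtx_nonneg q) (by rw [hK1]; simp only [pathVtx]; omega)
            (by have := pathVtx_nonneg (m := m) q; omega) (by simp [pathVtx])]
    · rw [if_neg hu] at hw7
      rw [hpsi]
      push_cast
      omega
    · have := runs_moveLargest_leaf (i := i) (t := t) (s := s) (b := b) (l₁ := l₁) (l₂ := l₂)
        (by rw [← hl]; exact h.small_leaves) h.small_path hlt' hlt
      rwa [← hl] at this

theorem Represents.negCount_le (h : Represents g k l p) : negCount (l ++ p) + 1 ≤ m + n + 4 := by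
  have h1 : negCount (l ++ p) ≤ (l ++ p).length := List.countP_le_length
  have h2 := h.length_path_le
  rw [List.length_append, h.length_leaves] at h1
  omega

/-- The two steps that are deducted from the bound pay for the test of the counter at the end of
each round. -/
theorem Represents.exists_runs_solvePath_body (h : Represents g k l p) :
    ∃ (g' : Equiv.Perm (Vtx m n)) (l' p' : List (Γ' × ℕ)) (j : ℕ),
      Runs (goHomeLoop.seq moveLargest)
        (store i (blocks l) [] (blocks p) [] (List.replicate k .blank) [] t s b)
        (20 * (m + n + 4) ^ 3 - 2) (some .blank)
        (store i (blocks l') [] (blocks p') [] (List.replicate k .blank) [] t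
          (List.replicate j .blank ++ s) b) ∧
      Represents g' (k - 1) l' p' ∧ psiFun g' + j = psiFun g := by
  obtain ⟨g₁, l₁, p₁, j₁, h1, h2, h3, h4, -⟩ := h.exists_runs_goHomeLoop (i := i) (p' := [])
    (c := List.replicate k .blank) (c' := []) (t := t) (s := s) (b := b)
  obtain ⟨g₂, l₂, p₂, j₂, h5, h6, h7⟩ := h2.exists_runs_moveLargest h3 (i := i)
    (t := t) (s := List.replicate j₁ .blank ++ s) (b := b)
  refine ⟨g₂, l₂, p₂, j₂ + j₁, (h1.seq h5).congr ?_ (by rw [List.replicate_add, List.append_assoc]), h6, by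
    push_cast; omega⟩
  have hM : (negCount (l ++ p) + 1) * (9 * (m + n + 4) ^ 2) ≤
      (m + n + 4) * (9 * (m + n + 4) ^ 2) := Nat.mul_le_mul_right _ h.negCount_le
  have hM₁ : (m + n + 4) * (9 * (m + n + 4) ^ 2) = 9 * (m + n + 4) ^ 3 := by ring
  have hM₂ : 4 * (m + n + 4) ^ 2 ≤ (m + n + 4) ^ 3 := by
    rw [pow_succ _ 2, mul_comm]
    exact Nat.mul_le_mul_left _ (by omega)
  have hM₃ := sixteen_le_sq m n
  omega

/-- In the round for `k` the counter holds `k` blanks, so the first failing `pop` comes after the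
round for the vertex `0`. -/
theorem Represents.exists_runs_solvePath (h : Represents g k l p) :
    ∃ (g' : Equiv.Perm (Vtx m n)) (l' : List (Γ' × ℕ)) (j : ℕ),
      Runs solvePath (store i (blocks l) [] (blocks p) [] (List.replicate k .blank) [] t s b)
        ((k + 1) * (20 * (m + n + 4) ^ 3)) (some .blank)
        (store i (blocks l') [] [] [] [] [] t (List.replicate j .blank ++ s) b) ∧
      Represents g' (-1) l' [] ∧ psiFun g' + j = psiFun g := by
  induction k generalizing g l p s with
  | zero =>
    obtain ⟨g', l', p', j, h1, h2, h3⟩ := h.exists_runs_solvePath_body (i := i) (t := t) (s := s)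
      (b := b)
    have hp : p' = [] := by
      have := h2.length_path
      simpa using this
    subst hp
    refine ⟨g', l', j, ?_, by simpa using h2, h3⟩
    apply Runs.congr
    case h =>
      apply Runs.loop_some
      apply Runs.seq
      · exact h1
      · apply Runs.bind
        · exact runs_pop_nil (by rfl)
        · exact runs_ret _ _
    case ht =>
      have := sixteen_le_sq m n
      have : (m + n + 4) ^ 2 ≤ (m + n + 4) ^ 3 := Nat.pow_le_pow_right (by omega) (by omega)
      omega
    case hS => rfl
  | succ k ih =>
    obtain ⟨g₁, l₁, p₁, j₁, h1, h2, h3⟩ := h.exists_runs_solvePath_body (i := i) (t := t) (s := s)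
      (b := b)
    obtain ⟨g', l', j, h4, h5, h6⟩ := ih (g := g₁) (s := List.replicate j₁ .blank ++ s)
      (by simpa using h2)
    refine ⟨g', l', j + j₁, ?_, h5, by push_cast; omega⟩
    apply Runs.congr
    case h =>
      apply Runs.loop_none
      · apply Runs.seq
        · exact h1
        · apply Runs.bind
          · exact runs_pop_cons (x := Γ'.blank) (l := List.replicate k .blank) rfl
          · exact runs_ret _ _
      simp only [update_store]
      exact h4
    case ht =>
      have := sixteen_le_sq m n
      have : (m + n + 4) ^ 2 ≤ (m + n + 4) ^ 3 := Nat.pow_le_pow_right (by omega) (by omega)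
      have h7 : (k + 1 + 1) * (20 * (m + n + 4) ^ 3) =
        (k + 1) * (20 * (m + n + 4) ^ 3) + 20 * (m + n + 4) ^ 3 := by ring
      rw [h7]
      omega
    case hS => rw [List.replicate_add, List.append_assoc]

end StarPath

/-! ### Scanning and opening the leaves. -/

namespace StarPath

open Computability StackProgram StackProgram.Prog Function TokenSwapping

variable {m n M : ℕ} {g : Equiv.Perm (Vtx m n)} {l l₁ l₂ p : List (Γ' × ℕ)}
  {i c c' t s b p' x x' : List Γ'}

theorem runs_scan_step {y : Γ' × ℕ} (hy : y.1 ≠ .blank ∧ y.2 + 3 ≤ M) (hket : y.1 ≠ .ket) :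
    Runs (κ := Stack) (A := Γ') ((Prog.pop .leaves).bind fun
      | none => .ret (some .blank)
      | some .ket => (Prog.push .leaves .ket).seq (.ret (some .ket))
      | some x => (Prog.push .leaves x).seq (moveBlock .leaves .leavesAux))
      (store i (block y ++ x) x' [] p' c c' t s b) (2 * M + 2) none
      (store i x (block y ++ x') [] p' c c' t s b) := by
  obtain ⟨z, v⟩ := y
  have key : Runs ((Prog.push .leaves z).seq (moveBlock .leaves .leavesAux))
      (store i (List.replicate v .blank ++ z :: x) x' [] p' c c' t s b) (2 * M + 1) none
      (store i x (block (z, v) ++ x') [] p' c c' t s b) := by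
    apply Runs.congr
    case h =>
      apply Runs.seq
      · exact runs_push _ _ _
      simp only [update_store]
      exact runs_moveBlock (y := (z, v)) (x := x) (by decide) hy.1 (block_eq_cons z v x).symm
    case ht =>
      simp only at hy ⊢
      omega
    case hS => simp only [update_store, store]
  have hp := runs_pop_cons (S := store i (block (z, v) ++ x) x' [] p' c c' t s b) (k := .leaves)
    (x := z) (l := List.replicate v Γ'.blank ++ z :: x) (block_eq_cons z v x)
  simp only [update_store] at hp
  refine Runs.congr (hp.bind (t' := 2 * M + 1) (r' := none)
    (S'' := store i x (block (z, v) ++ x') [] p' c c' t s b) ?_) (by omega) rfl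
  cases z <;> first | exact (hket rfl).elim | exact (hy.1 rfl).elim | exact key

theorem runs_scan_of_notMem (hl : ∀ x ∈ l, x.1 ≠ .blank ∧ x.2 + 3 ≤ M)
    (hk : ∀ x ∈ l, x.1 ≠ .ket) :
    Runs scan (store i (blocks l) x' [] p' c c' t s b) (l.length * (2 * M + 2) + 2) (some .blank)
      (store i [] (blocks l.reverse ++ x') [] p' c c' t s b) := by
  induction l generalizing x' with
  | nil => exact (Runs.loop_some ((runs_pop_nil rfl).bind (runs_ret _ _))).congr (by simp) rfl
  | cons y l ih =>
    obtain ⟨hy, hl⟩ := List.forall_mem_cons.1 hl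
    obtain ⟨hyk, hk⟩ := List.forall_mem_cons.1 hk
    rw [blocks_cons]
    refine ((runs_scan_step hy hyk).loop_none (ih hl hk)).congr ?_ ?_
    · rw [List.length_cons]
      ring_nf
      omega
    · simp [blocks]

theorem runs_scan_of_mem {v : ℕ} (hl : ∀ x ∈ l₁, x.1 ≠ .blank ∧ x.2 + 3 ≤ M)
    (hk : ∀ x ∈ l₁, x.1 ≠ .ket) :
    Runs scan (store i (blocks (l₁ ++ (.ket, v) :: l₂)) x' [] p' c c' t s b)
      (l₁.length * (2 * M + 2) + 3) (some .ket)
      (store i (blocks ((.ket, v) :: l₂)) (blocks l₁.reverse ++ x') [] p' c c' t s b) := by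
  induction l₁ generalizing x' with
  | nil =>
    apply Runs.congr
    case h =>
      apply Runs.loop_some
      apply Runs.bind
      · exact runs_pop_cons (x := Γ'.ket) (l := List.replicate v .blank ++ .ket :: blocks l₂)
          (block_eq_cons _ _ _)
      apply Runs.seq
      · exact runs_push _ _ _
      · exact runs_ret _ _
    case ht => omega
    case hS =>
      simp only [update_store, store]
      rw [← block_eq_cons]
      rfl
  | cons y l ih =>
    obtain ⟨hy, hl⟩ := List.forall_mem_cons.1 hl
    obtain ⟨hyk, hk⟩ := List.forall_mem_cons.1 hk
    rw [List.cons_append, blocks_cons]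
    refine ((runs_scan_step hy hyk).loop_none (ih hl hk)).congr ?_ ?_
    · rw [List.length_cons]
      ring_nf
      omega
    · simp [blocks]

theorem exists_first_neg (l : List (Γ' × ℕ)) :
    (∀ x ∈ l, x.1 ≠ .ket) ∨
      ∃ l₁ v l₂, l = l₁ ++ (.ket, v) :: l₂ ∧ ∀ x ∈ l₁, x.1 ≠ .ket := by
  induction l with
  | nil => simp
  | cons y l ih =>
    by_cases hy : y.1 = .ket
    · exact Or.inr ⟨[], y.2, l, by rw [← hy]; rfl, by simp⟩
    · obtain h | ⟨l₁, v, l₂, rfl, h⟩ := ih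
      · exact Or.inl (List.forall_mem_cons.2 ⟨hy, h⟩)
      · exact Or.inr ⟨y :: l₁, v, l₂, rfl, List.forall_mem_cons.2 ⟨hy, h⟩⟩

theorem SolvedAbove.leaf_lt (hg : SolvedAbove g (-1)) (q : Fin m) : (g (leaf q)).1 < 0 := by
  have := hg.le_of_apply (v := leaf q) (by have := leaf_neg (n := n) q; omega)
  omega

/-- With the path solved, every unmarked leaf shows a negative token. If the scan finds none, all
leaves are marked and hence correct. -/
theorem Represents.eq_one (h : Represents g (-1) l []) (hl : ∀ x ∈ l, x.1 ≠ .ket) : g = 1 := by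
  refine eq_one_of_solved (fun v hv => h.solved v (by omega)) fun q => (h.leaves q).elim (fun hq => ?_) And.right
  have h1 := hl _ (List.mem_of_getElem? hq)
  have h2 := h.solved.leaf_lt q
  rw [leafTokens, intBlock, if_neg (by omega)] at h1
  exact (h1 rfl).elim

theorem Represents.drop (h : Represents g 0 l p) (h0 : 0 ≤ (g (origin m n)).1) :
    Represents g (-1) l [] :=
  ⟨solved_of_origin h.solved h0, by omega, h.length_leaves, by simp, h.leaves, by simp⟩

/-- The token `0` is implicit as long as the path stack is empty; here it is written to the leaf in
exchange for the token that is taken out. -/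
theorem Represents.exists_extract {v : ℕ} (h : Represents g (-1) (l₁ ++ (.ket, v) :: l₂) []) :
    ∃ q : Fin m, (q : ℕ) = l₁.length ∧ (g (leaf q)).1 = -(v + 1) ∧
      Represents (leafSwap g q) 0 (l₁ ++ (.bra, 0) :: l₂) [(.ket, v)] := by
  have hm : l₁.length < m := by
    rw [← h.length_leaves]
    simp
  have h1 : intBlock (leafTokens g ⟨l₁.length, hm⟩) = (.ket, v) := by
    obtain h1 | h1 := h.leaves ⟨l₁.length, hm⟩
    · simpa using h1.symm
    · simp at h1
  have hq := intBlock_eq_ket.1 h1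
  have h0 : g (origin m n) = origin m n := h.solved _ (by simp [origin])
  refine ⟨⟨l₁.length, hm⟩, rfl, hq, ?_⟩
  constructor
  · intro w hw
    rw [leafSwap_of_ne, h.solved w (by omega)]
    · rintro rfl
      simp [origin] at hw
    · rintro rfl
      have := leaf_neg (n := n) ⟨l₁.length, hm⟩
      omega
  · omega
  · rw [← h.length_leaves]
    simp
  · simp
  · intro r
    rw [getElem?_replace _ _ (.ket, v)]
    by_cases hr : r = ⟨l₁.length, hm⟩
    · subst hr
      left
      rw [if_pos rfl, leafTokens, leafSwap_leaf, h0]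
      rfl
    · rw [if_neg fun e => hr (Fin.ext e), leafTokens, leafSwap_of_ne _ _ (leaf_ne_origin r)
        fun e => hr (leaf_injective e)]
      exact h.leaves r
  · intro r hr
    obtain rfl : r = 0 := by
      simp only [List.length_singleton] at hr
      exact Fin.ext (by simpa using hr)
    rw [pathVtx_zero, leafSwap_origin]
    simpa [leafTokens] using h1.symm

end StarPath

/-! ### Solving the leaves one orbit at a time. -/

namespace StarPath

open Computability StackProgram StackProgram.Prog Function TokenSwapping

variable {m n M : ℕ} {g : Equiv.Perm (Vtx m n)} {l l₁ l₂ p : List (Γ' × ℕ)}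
  {i c c' t s b p' x x' : List Γ'}

/-- The body of the loop `solveLeaves`, after `scan`. -/
theorem runs_extract (h₁ : ∀ x ∈ l₁, x.1 ≠ .blank ∧ x.2 + 3 ≤ M) (hM : l₁.length + 3 ≤ M) {v : ℕ}
    (hv : v + 3 ≤ M) {q : Prog Stack Γ'} {T : ℕ} {r : Option Γ'} {S' : Stack → List Γ'}
    (hq : Runs q (store i (blocks (l₁ ++ (.bra, 0) :: l₂)) [] (blocks [(.ket, v)]) p' c c' t s b)
      T r S') :
    Runs ((moveBlock .leaves .path).seq <| (Prog.push .leaves .bra).seq <|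
        (Prog.push .leaves .bra).seq <| (moveAll .leavesAux .leaves).seq q)
      (store i (blocks ((.ket, v) :: l₂)) (blocks l₁.reverse) [] p' c c' t s b)
      (2 * M ^ 2 + 2 * M + 2 + T) r S' := by
  have h2 : Small M l₁.reverse := ⟨by simpa using hM, fun x hx => h₁ x (List.mem_reverse.1 hx)⟩
  apply Runs.congr
  case h =>
    apply Runs.seq
    · exact runs_moveBlock (y := (.ket, v)) (x := blocks l₂) (by decide) (by simp)
        (by simp only [store, blocks_cons])
    simp only [update_store]
    apply Runs.seq
    · exact runs_push _ _ _
    simp only [update_store]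
    apply Runs.seq
    · exact runs_push _ _ _
    simp only [update_store]
    apply Runs.seq
    · exact runs_moveAll (x := blocks l₁.reverse) (by decide) rfl
    simp only [update_store, store]
    rw [reverse_blocks, List.reverse_reverse]
    have hl : blocks l₁ ++ .bra :: .bra :: blocks l₂ = blocks (l₁ ++ (.bra, 0) :: l₂) := by
      rw [blocks_append]
      rfl
    rw [hl]
    exact hq
  case ht =>
    have := h2.length_blocks
    simp only at *
    omega
  case hS => rfl

theorem negCount_bra (l₁ l₂ : List (Γ' × ℕ)) (v w : ℕ) :
    negCount ((l₁ ++ (.bra, w) :: l₂) ++ [(.ket, v)]) = negCount (l₁ ++ (.ket, v) :: l₂) := by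
  simp [negCount, List.countP_append]

theorem Represents.eq_singleton (h : Represents g 0 l p) (h0 : 0 ≤ (g (origin m n)).1) :
    ∃ v, v ≤ m + n ∧ p = [(.bra, v)] := by
  obtain _ | ⟨y, _ | ⟨z, p⟩⟩ := p
  · simpa using h.length_path
  · have := h.head rfl
    rw [this]
    refine ⟨_, intBlock_snd_le (g (origin m n)), ?_⟩
    rw [intBlock, if_pos h0]
  · have := h.length_path
    simp only [List.length_cons] at this
    omega

theorem negCount_append_bra (l : List (Γ' × ℕ)) (v : ℕ) :
    negCount (l ++ [(.bra, v)]) = negCount l := by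
  simp [negCount, List.countP_append]

/-- The program does not know in advance whether the token found by the scan is on its own leaf. If
it is, going home undoes the extraction: nothing is counted and the leaf becomes marked. If it is
not, the leaf lies on a negative cycle, and the extraction and the first move home lower Ψ by one
each, which accounts for the two swaps counted afterwards. Either way the number of unmarked
negative tokens decreases, so the scans come to an end. -/
theorem Represents.exists_runs_solveOrbit {v : ℕ}
    (h : Represents g (-1) (l₁ ++ (.ket, v) :: l₂) []) :
    ∃ (g' : Equiv.Perm (Vtx m n)) (l' : List (Γ' × ℕ)) (j : ℕ),
      Runs solveOrbit (store i (blocks (l₁ ++ (.bra, 0) :: l₂)) [] (blocks [(.ket, v)])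
          p' c c' t s b) (13 * (m + n + 4) ^ 3) none
        (store i (blocks l') [] [] p' c c' t (List.replicate j .blank ++ s) b) ∧
      Represents g' (-1) l' [] ∧ psiFun g' + j = psiFun g ∧
      negCount l' < negCount (l₁ ++ (.ket, v) :: l₂) := by
  obtain ⟨q, hq, hqv, h1⟩ := h.exists_extract
  obtain ⟨q', l₃, l₄, hq', h0, hl, hl₃, h2⟩ := h1.goHome
  have hneg := negCount_goHome l₃ l₄ [] (intBlock (leafTokens (leafSwap g q) q')) v
  rw [← hl, negCount_bra] at hneg
  have hM₂ : 4 * (m + n + 4) ^ 2 ≤ (m + n + 4) ^ 3 := by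
    rw [pow_succ _ 2, mul_comm]
    exact Nat.mul_le_mul_left _ (by omega)
  have hM₃ := sixteen_le_sq m n
  have hM₄ : m + n + 4 ≤ (m + n + 4) ^ 2 := Nat.le_self_pow (by omega) _
  have hrun : Runs StarPath.goHome (store i (blocks (l₁ ++ (.bra, 0) :: l₂)) [] (blocks [(.ket, v)])
      p' c c' t s b) (8 * (m + n + 4) ^ 2) (some .blank)
      (store i (blocks (l₃ ++ (.comma, 0) :: l₄)) []
        (blocks [intBlock (leafTokens (leafSwap g q) q')]) p' c c' t s b) := by
    have := runs_goHome (i := i) (p := []) (p' := p') (c := c) (c' := c') (t := t) (s := s) (b := b)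
      (show Small (m + n + 4) (l₃ ++ intBlock (leafTokens (leafSwap g q) q') :: l₄) by
        rw [← hl]; exact h1.small_leaves)
    rw [hl₃, ← hl] at this
    exact this
  rw [leafSwap_origin] at h0
  by_cases hqq : q' = q
  · subst hqq
    rw [leafSwap_leafSwap] at h2
    have hz : intBlock (leafTokens (leafSwap g q') q') = (.bra, 0) := by
      rw [intBlock_eq_bra, leafTokens, leafSwap_leaf, h.solved _ (by simp [origin])]
      rfl
    rw [hz] at h2 hrun hneg
    refine ⟨g, l₃ ++ (.comma, 0) :: l₄, 0, ?_, h2.drop ?_, by simp, ?_⟩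
    · apply Runs.congr
      case h =>
        apply Runs.seq
        · exact hrun
        apply Runs.bind
        · exact runs_pop_cons (x := Γ'.bra) (l := [.bra]) rfl
        simp only [update_store]
        apply Runs.seq
        · exact runs_push _ _ _
        simp only [update_store]
        exact runs_dropBlock (y := (.bra, 0)) (x := []) (by simp) rfl
      case ht =>
        simp only
        omega
      case hS => simp only [update_store, List.replicate_zero, List.nil_append]
    · rw [h.solved _ (by simp [origin])]
      exact le_rfl
    · rw [negCount_append_bra] at hneg
      omega
  · have hcycle : NegCycle g q := negCycle_of_solved h.solved (by
      rw [h0]; exact fun e => hqq (leaf_injective e))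
    have hψ := psiFun_extract g q hcycle
    have hψ' := psiFun_home (leafSwap g q) q' (by rw [leafSwap_origin, h0])
    obtain ⟨w, hw⟩ : ∃ w, intBlock (leafTokens (leafSwap g q) q') = (.ket, w) := by
      rw [leafTokens, leafSwap_of_ne _ _ (leaf_ne_origin q') fun e => hqq (leaf_injective e),
        intBlock, if_neg (not_le.2 (h.solved.leaf_lt q'))]
      exact ⟨_, rfl⟩
    rw [hw] at h2 hrun hneg
    obtain ⟨g', l', p₁, j, h3, h4, h5, h6, h7⟩ := h2.exists_runs_goHomeLoop (k := 0) (i := i)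
      (p' := p') (c := c) (c' := c') (t := t) (s := .blank :: .blank :: s) (b := b)
    obtain ⟨u, hu, rfl⟩ := Represents.eq_singleton h4 h5
    refine ⟨g', l', j + 2, ?_, Represents.drop h4 h5, by push_cast; omega, ?_⟩
    · apply Runs.congr
      case h =>
        apply Runs.seq
        · exact hrun
        apply Runs.bind
        · exact runs_pop_cons (x := Γ'.ket) (l := List.replicate w .blank ++ [.ket])
            (by simp [store, blocks, block])
        simp only [update_store]
        apply Runs.seq
        · exact runs_push _ _ _
        simp only [update_store, store]
        apply Runs.seq
        · exact runs_push _ _ _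
        simp only [update_store, store]
        apply Runs.seq
        · exact runs_push _ _ _
        simp only [update_store, store]
        apply Runs.seq
        · have hb : Γ'.ket :: (List.replicate w .blank ++ [.ket]) = blocks [(.ket, w)] := by
            simp [blocks, block]
          rw [hb]
          exact h3
        exact runs_dropBlock (y := (.bra, u)) (x := []) (by simp) (by simp [store, blocks])
      case ht =>
        have hN : (negCount (l₃ ++ (.comma, 0) :: l₄ ++ [(.ket, w)]) + 1) *
            (9 * (m + n + 4) ^ 2) ≤ (m + n + 4) * (9 * (m + n + 4) ^ 2) :=
          Nat.mul_le_mul_right _ (h2.negCount_le (k := 0))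
        have hN' : (m + n + 4) * (9 * (m + n + 4) ^ 2) = 9 * (m + n + 4) ^ 3 := by ring
        simp only
        omega
      case hS =>
        simp only [update_store, List.replicate_add, List.append_assoc]
        rfl
    · rw [negCount_append_bra] at h7
      omega

theorem Represents.exists_runs_solveLeaves (h : Represents g (-1) l []) :
    ∃ (l' : List (Γ' × ℕ)) (j : ℕ),
      Runs solveLeaves (store i (blocks l) [] [] p' c c' t s b)
        ((negCount l + 1) * (20 * (m + n + 4) ^ 3)) (some .blank)
        (store i [] (blocks l') [] p' c c' t (List.replicate j .blank ++ s) b) ∧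
      (j : ℤ) = psiFun g := by
  have hM₂ : 4 * (m + n + 4) ^ 2 ≤ (m + n + 4) ^ 3 := by
    rw [pow_succ _ 2, mul_comm]
    exact Nat.mul_le_mul_left _ (by omega)
  have hM₃ := sixteen_le_sq m n
  have hM₄ : 4 * (m + n + 4) ≤ (m + n + 4) ^ 2 := by
    rw [pow_two]
    exact Nat.mul_le_mul_right _ (by omega)
  induction hN : negCount l using Nat.strong_induction_on generalizing g l s with
  | _ N ih =>
    obtain hl | ⟨l₁, v, l₂, rfl, hl⟩ := exists_first_neg l
    · have h1 := h.eq_one hl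
      refine ⟨l.reverse, 0, ?_, by rw [h1, psiFun_one]; rfl⟩
      apply Runs.congr
      case h =>
        apply Runs.loop_some
        apply Runs.bind
        · exact runs_scan_of_notMem h.small_leaves.2 hl
        · exact runs_ret _ _
      case ht =>
        have h2 : l.length * (2 * (m + n + 4) + 2) ≤ (m + n + 4) * (2 * (m + n + 4) + 2) :=
          Nat.mul_le_mul_right _ (by have := h.length_leaves; omega)
        have h3 : (m + n + 4) * (2 * (m + n + 4) + 2) = 2 * (m + n + 4) ^ 2 + 2 * (m + n + 4) := by
          ring
        rw [add_mul]
        omega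
      case hS => simp only [List.append_nil, List.replicate_zero, List.nil_append]
    · obtain ⟨g', l', j, h1, h2, h3, h4⟩ := h.exists_runs_solveOrbit (i := i) (p' := p') (c := c)
        (c' := c') (t := t) (s := s) (b := b)
      obtain ⟨l'', j', h5, h6⟩ := ih _ (hN ▸ h4) h2 (s := List.replicate j .blank ++ s) rfl
      have hlen := h.length_leaves
      have hs := h.small_leaves
      simp only [List.length_append, List.length_cons] at hlen
      refine ⟨l'', j' + j, ?_, by push_cast; omega⟩
      apply Runs.congr
      case h =>
        apply Runs.loop_none
        · apply Runs.bind
          · exact runs_scan_of_mem (fun x hx => hs.2 x (by simp [hx])) hl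
          rw [List.append_nil]
          exact runs_extract (fun x hx => hs.2 x (by simp [hx])) (M := m + n + 4) (by omega)
            (hs.2 (.ket, v) (by simp)).2 h1
        exact h5
      case ht =>
        have h7 : l₁.length * (2 * (m + n + 4) + 2) ≤ (m + n + 4) * (2 * (m + n + 4) + 2) :=
          Nat.mul_le_mul_right _ (by omega)
        have h8 : (m + n + 4) * (2 * (m + n + 4) + 2) = 2 * (m + n + 4) ^ 2 + 2 * (m + n + 4) := by
          ring
        have h9 : (negCount l' + 1) * (20 * (m + n + 4) ^ 3) ≤ N * (20 * (m + n + 4) ^ 3) :=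
          Nat.mul_le_mul_right _ (by omega)
        rw [add_mul N]
        omega
      case hS => rw [List.replicate_add, List.append_assoc]

end StarPath

/-! ### The complete decision program. -/

namespace StarPath

open Computability StackProgram StackProgram.Prog Function TokenSwapping

/-- The stacks that are left are of no interest, as all of them are cleared next. The bound is
decremented in binary, which keeps its size out of the running time. -/
theorem exists_runs_compareBound (j : ℕ) {w : List Bool} {x : List Γ'} {S : Stack → List Γ'}
    (ht : S .temp = []) (hs : S .swaps = List.replicate j .blank)
    (hb : S .bound = w.map .bit ++ .comma :: x) :
    ∃ S', Runs compareBound S ((j + 1) * (decrTime w.length + 2))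
      (some (.bit (decide (j ≤ ofBits w)))) S' := by
  induction j generalizing w S with
  | zero =>
    refine ⟨_, (Runs.loop_some ((runs_pop_nil hs).bind (runs_ret _ _))).mono ?_⟩
    omega
  | succ j ih =>
    rw [List.replicate_succ] at hs
    obtain hw | hw := Nat.eq_zero_or_pos (ofBits w)
    · have h1 := runs_decr_zero (temp := Stack.temp) (a := Stack.bound) (by decide)
        (S := update S .swaps (List.replicate j .blank)) (by simpa using ht) (by simpa using hb) hw
      rw [hw]
      have h2 : Runs ((decr Stack.temp .bound).bind fun
          | some _ => .ret none
          | none => .ret (some (.bit false))) _ _ (some (.bit false)) _ := h1.bind (runs_ret _ _)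
      refine ⟨_, (Runs.loop_some ((runs_pop_cons hs).bind h2)).mono ?_⟩
      rw [add_mul]
      omega
    · obtain ⟨v, h1, h2, h3⟩ := exists_runs_decr (temp := Stack.temp) (a := Stack.bound) (by decide)
        (S := update S .swaps (List.replicate j .blank)) (by simpa using ht) (by simpa using hb) hw
      obtain ⟨S', h4⟩ := ih (w := v) (S := update (update S .swaps (List.replicate j .blank)) .bound
        (v.map .bit ++ .comma :: x)) (by simpa using ht) (by simp) (by simp)
      rw [h1] at h4
      rw [← h2]
      simp only [Nat.add_le_add_iff_right]
      have h5 : Runs ((decr Stack.temp .bound).bind fun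
          | some _ => .ret none
          | none => .ret (some (.bit false))) _ _ none _ := h3.bind (runs_ret _ _)
      refine ⟨S', (Runs.loop_none ((runs_pop_cons hs).bind h5) h4).mono ?_⟩
      rw [add_mul (j + 1)]
      omega

theorem runs_clearAll {S : Stack → List Γ'} {T : ℕ} (h : ∀ a, (S a).length ≤ T) :
    Runs clearAll S (20 * T + 20) (some .blank) fun _ => [] := by
  obtain ⟨i, l, l', p, p', c, c', t, s, b, rfl⟩ :
      ∃ i l l' p p' c c' t s b, S = store i l l' p p' c c' t s b :=
    ⟨_, _, _, _, _, _, _, _, _, _, by funext j; cases j <;> rfl⟩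
  have h1 := fun (T) (a : Stack) (S : Stack → List Γ') (h : (S a).length ≤ T) =>
    (runs_clear (rfl : S a = S a)).mono (t' := 2 * T + 2) (by omega)
  have h1 := h1 T
  apply Runs.congr
  case h =>
    apply Runs.seq
    · exact h1 .input _ (h _)
    simp only [update_store]
    apply Runs.seq
    · exact h1 .leaves _ (h .leaves)
    simp only [update_store]
    apply Runs.seq
    · exact h1 .leavesAux _ (h .leavesAux)
    simp only [update_store]
    apply Runs.seq
    · exact h1 .path _ (h .path)
    simp only [update_store]
    apply Runs.seq
    · exact h1 .pathAux _ (h .pathAux)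
    simp only [update_store]
    apply Runs.seq
    · exact h1 .counter _ (h .counter)
    simp only [update_store]
    apply Runs.seq
    · exact h1 .counterAux _ (h .counterAux)
    simp only [update_store]
    apply Runs.seq
    · exact h1 .temp _ (h .temp)
    simp only [update_store]
    apply Runs.seq
    · exact h1 .swaps _ (h .swaps)
    simp only [update_store]
    exact h1 .bound _ (h .bound)
  case ht => omega
  case hS =>
    simp only [update_store]
    funext j
    cases j <;> rfl

theorem length_flatMap_encodeIntWord (zs : List ℤ) :
    2 * zs.length ≤ (zs.flatMap encodeIntWord).length := by
  induction zs with
  | nil => simp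
  | cons z zs ih =>
    rw [List.flatMap_cons, List.length_append, List.length_cons, encodeIntWord, encodeNatWord]
    simp only [List.length_cons, List.length_append, List.length_map, List.length_nil]
    omega

theorem length_encodeNat_le {zs : List ℤ} {z : ℤ} (hz : z ∈ zs) :
    (encodeNat z.natAbs).length ≤ (zs.flatMap encodeIntWord).length := by
  obtain ⟨l₁, l₂, rfl⟩ := List.append_of_mem hz
  rw [List.flatMap_append, List.flatMap_cons, encodeIntWord, encodeNatWord]
  simp only [List.length_cons, List.length_append, List.length_map, List.length_nil]
  omega

/-- The blocks of the tokens on the leaves. -/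
def leafBlocks (x : Instance) : List (Γ' × ℕ) := (List.ofFn (leafTokens x.f)).map intBlock

/-- The blocks of the tokens on the path. -/
def pathBlocks (x : Instance) : List (Γ' × ℕ) := (pathTokens x.f).map intBlock

theorem represents_blocks (x : Instance) : Represents x.f x.n (leafBlocks x) (pathBlocks x) where
  solved := fun v hv => absurd hv (not_lt.2 v.2.2)
  le := le_rfl
  length_leaves := by simp [leafBlocks]
  length_path := by simp [pathBlocks, pathTokens]
  leaves := fun q => Or.inl (by simp [leafBlocks])
  path := fun q _ => by 
    rw [pathBlocks, pathTokens, List.map_ofFn, List.getElem?_ofFn, dif_pos q.2]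
    rfl

/-- Although `m` and `n` are written in binary, the input contains one word for each vertex. So the
size of the graph, and with it every token, is bounded by the length of the input, and unary blocks
are affordable. -/
theorem length_blocks_instance (x : Instance) : x.m + x.n + 1 ≤ x.encode.length := by
  have h1 := length_flatMap_encodeIntWord (List.ofFn (leafTokens x.f))
  have h2 := length_flatMap_encodeIntWord (pathTokens x.f)
  rw [List.length_ofFn] at h1
  rw [pathTokens, List.length_ofFn] at h2
  rw [Instance.encode]
  simp only [List.length_append, pathTokens]
  omega

theorem runs_readInstance (x : Instance) :
    Runs readInstance (store x.encode [] [] [] [] [] [] [] [] [])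
      (20 * (x.encode.length + 4) ^ 3) (some .blank)
      (store [] (blocks (leafBlocks x)) [] (blocks (pathBlocks x)) []
        (List.replicate x.n .blank) [] [] [] ((encodeNat x.k).map .bit ++ [.comma])) := by
  have hmn := length_blocks_instance x
  have hx : x.encode = (encodeNat x.m).map .bit ++ .comma :: ((encodeNat x.n).map .bit ++ .comma ::
      ((encodeNat x.k).map .bit ++ .comma ::
        (.bra :: ((List.ofFn (leafTokens x.f)).flatMap encodeIntWord ++ .ket ::
          (.bra :: ((pathTokens x.f).flatMap encodeIntWord ++ .ket :: [])))))) := by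
    simp [Instance.encode, encodeNatWord]
  have hlen := congrArg List.length hx
  simp only [List.length_append, List.length_cons, List.length_map, List.length_nil] at hlen
  have hleaf : ∀ z ∈ List.ofFn (leafTokens x.f), z.natAbs ≤ x.encode.length ∧
      (encodeNat z.natAbs).length ≤ x.encode.length := by
    intro z hz
    have h1 := length_encodeNat_le hz
    obtain ⟨q, rfl⟩ := List.mem_ofFn.1 hz
    have h2 := (x.f (leaf q)).2.1
    have h3 := (x.f (leaf q)).2.2
    simp only [leafTokens] at h1 ⊢
    omega
  have hpath : ∀ z ∈ pathTokens x.f, z.natAbs ≤ x.encode.length ∧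
      (encodeNat z.natAbs).length ≤ x.encode.length := by
    intro z hz
    have h1 := length_encodeNat_le hz
    obtain ⟨q, rfl⟩ := List.mem_ofFn.1 hz
    have h2 := (x.f (pathVtx q)).2.1
    have h3 := (x.f (pathVtx q)).2.2
    omega
  have hR := represents_blocks x
  have hl := length_blocks_le (B := x.encode.length + 2) (l := leafBlocks x)
    fun y hy => by have := (hR.small_leaves.2 y hy).2; omega
  have hp := length_blocks_le (B := x.encode.length + 2) (l := pathBlocks x)
    fun y hy => by have := (hR.small_path.2 y hy).2; omega
  have hlm := hR.length_leaves
  have hpm : (pathBlocks x).length = x.n + 1 := by exact_mod_cast hR.length_path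
  rw [hlm] at hl
  rw [hpm] at hp
  generalize hN : x.encode.length = N at *
  rw [hx]
  apply Runs.congr
  case h =>
    apply Runs.seq
    -- The number `m` is thrown away: the brackets delimit the list of the leaf tokens.
    · exact runs_moveWord (a := Stack.input) (b := .temp) (w := encodeNat x.m) (by decide) (by rfl)
    simp only [update_store, store, List.append_nil]
    apply Runs.seq
    · exact runs_clear (a := Stack.temp) (by rfl)
    simp only [update_store]
    apply Runs.seq
    · exact runs_unary (temp := Stack.temp) (a := Stack.input) (b := .counter) (w := encodeNat x.n)
        (by decide) (by decide) (by decide) (by rfl) (by rfl)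
    simp only [update_store, store, List.append_nil]
    apply Runs.seq
    -- Moving a word reverses it, so the bound goes through `temp`; its comma is put below it
    -- beforehand.
    · exact runs_moveWord (a := Stack.input) (b := .temp) (w := encodeNat x.k) (by decide) (by rfl)
    simp only [update_store, store, List.append_nil]
    apply Runs.seq
    · exact runs_push _ _ _
    simp only [update_store, store]
    apply Runs.seq
    · exact runs_moveAll (a := Stack.temp) (b := .bound) (by decide) (by rfl)
    simp only [update_store, store, List.reverse_reverse]
    apply Runs.seq
    · exact runs_readList (by decide) (by decide) hleaf (by rfl) (by rfl)
    simp only [update_store, store, List.append_nil]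
    apply Runs.seq
    · exact runs_moveAll (a := Stack.leavesAux) (b := .leaves) (by decide) (by rfl)
    simp only [update_store, store, List.append_nil, reverse_blocks, List.reverse_reverse]
    apply Runs.seq
    · exact runs_readList (by decide) (by decide) hpath (by rfl) (by rfl)
    simp only [update_store, store, List.append_nil]
    exact runs_moveAll (a := Stack.pathAux) (b := .path) (by decide) (by rfl)
  case hS =>
    simp only [update_store, store, List.append_nil, reverse_blocks, List.reverse_reverse,
      ofBits_encodeNat]
    rfl
  case ht =>
    have hl' : (blocks ((List.ofFn (leafTokens x.f)).map intBlock)).length ≤ x.m * (N + 4) := hl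
    have hp' : (blocks ((pathTokens x.f).map intBlock)).length ≤ (x.n + 1) * (N + 4) := hp
    have hpn : (pathTokens x.f).length = x.n + 1 := List.length_ofFn
    simp only [store, ← reverse_blocks, List.length_reverse, List.length_map, List.length_ofFn,
      ofBits_encodeNat, hpn]
    have h1 : readTime N ≤ (N + 4) * (4 * (N + 4)) := Nat.mul_le_mul (by omega) (by
      unfold decrTime; omega)
    have h2 : (x.m + (x.n + 1)) * readTime N ≤ (N + 4) * ((N + 4) * (4 * (N + 4))) :=
      Nat.mul_le_mul (by omega) h1
    have h3 : (x.n + 1) * (decrTime (encodeNat x.n).length + 1) ≤ (N + 4) * (4 * (N + 4)) :=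
      Nat.mul_le_mul (by omega) (by unfold decrTime; omega)
    have h4 : (x.m + (x.n + 1)) * (N + 4) ≤ (N + 4) * (N + 4) := Nat.mul_le_mul_right _ (by omega)
    have h5 : 4 * (N + 4) ≤ (N + 4) * (N + 4) := Nat.mul_le_mul_right _ (by omega)
    have h6 : 4 * ((N + 4) * (N + 4)) ≤ (N + 4) ^ 3 := by
      rw [pow_succ', pow_two]
      exact Nat.mul_le_mul_right _ (by omega)
    have h7 : (N + 4) * ((N + 4) * (4 * (N + 4))) = 4 * (N + 4) ^ 3 := by ring
    have h8 : (N + 4) * (4 * (N + 4)) = 4 * ((N + 4) * (N + 4)) := by ring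
    rw [add_mul] at h2 h4
    omega

theorem store_input (i : List Γ') :
    store i [] [] [] [] [] [] [] [] [] = update (fun _ => []) .input i := by
  funext j
  cases j <;> rfl

/-- A bound on the time for deciding an instance whose code has length `N`. -/
theorem exists_runs_decideInstance (x : Instance) :
    ∃ r, Runs decideInstance (update (fun _ => []) .input x.encode)
      (10000 * (x.encode.length + 4) ^ 5) r (fun _ => []) ∧
        decide (r = some (.bit true)) = x.answer := by
  have h1 := runs_readInstance x
  obtain ⟨g, l, j, h2, h3, h4⟩ := (represents_blocks x).exists_runs_solvePath (i := [])
    (t := []) (s := []) (b := (encodeNat x.k).map .bit ++ [.comma])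
  obtain ⟨l', j', h5, h6⟩ := h3.exists_runs_solveLeaves (i := []) (p' := []) (c := []) (c' := [])
    (t := []) (s := List.replicate j .blank ++ []) (b := (encodeNat x.k).map .bit ++ [.comma])
  obtain ⟨S, h7⟩ := exists_runs_compareBound (j' + j) (w := encodeNat x.k) (x := [])
    (S := store [] [] (blocks l') [] [] [] [] [] (List.replicate j' .blank ++
      (List.replicate j .blank ++ [])) ((encodeNat x.k).map .bit ++ [.comma])) rfl
    (by rw [List.append_nil, ← List.replicate_add]; rfl) rfl
  have h8 := h1.seq (h2.seq (h5.seq h7))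
  generalize hT : x.encode.length = N at *
  set T := 20 * (N + 4) ^ 3 + ((x.n + 1) * (20 * (x.m + x.n + 4) ^ 3) +
      ((negCount l + 1) * (20 * (x.m + x.n + 4) ^ 3) +
        (j' + j + 1) * (decrTime (encodeNat x.k).length + 2))) with hT'
  -- The stacks left by the comparison are unknown, but the time spent so far bounds their lengths
  -- and thus the time to clear them.
  have h9 : ∀ a, (S a).length ≤ N + T := by
    intro a
    have := h8.length_le a
    have h0 : (store x.encode [] [] [] [] [] [] [] [] [] a).length ≤ N := by
      cases a <;> simp [store, hT]
    omega
  have h10 := h1.seq (h2.seq (h5.seq (h7.bind (f := fun r => clearAll.seq (.ret r))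
    ((runs_clearAll h9).seq (runs_ret _ _)))))
  rw [store_input] at h10
  refine ⟨_, h10.mono ?_, ?_⟩
  · have hj := (h1.seq (h2.seq h5)).length_le .swaps
    simp only [store, List.length_append, List.length_replicate, List.length_nil] at hj
    have hmn := length_blocks_instance x
    have hk : (encodeNat x.k).length ≤ N := by
      rw [← hT, Instance.encode, encodeNatWord, encodeNatWord, encodeNatWord]
      simp only [List.length_append, List.length_map]
      omega
    have hneg : negCount l + 1 ≤ N + 4 := by
      have h := h3.length_leaves
      have : negCount l ≤ l.length := List.countP_le_length
      omega
    have hM : (x.m + x.n + 4) ^ 3 ≤ (N + 4) ^ 3 := Nat.pow_le_pow_left (by omega) 3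
    have hA : (x.n + 1) * (20 * (x.m + x.n + 4) ^ 3) ≤ (N + 4) * (20 * (N + 4) ^ 3) :=
      Nat.mul_le_mul (by omega) (by omega)
    have hB : (negCount l + 1) * (20 * (x.m + x.n + 4) ^ 3) ≤ (N + 4) * (20 * (N + 4) ^ 3) :=
      Nat.mul_le_mul hneg (by omega)
    have hpow : ∀ d, 4 * (N + 4) ^ d ≤ (N + 4) ^ (d + 1) := fun d => by
      rw [pow_succ']
      exact Nat.mul_le_mul_right _ (by omega)
    have h11 := hpow 0
    have h12 := hpow 1
    have h13 := hpow 2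
    have h14 := hpow 3
    have h15 := hpow 4
    have hr : (N + 4) * (20 * (N + 4) ^ 3) = 20 * (N + 4) ^ 4 := by ring
    simp only [Nat.reduceAdd, pow_zero, pow_one] at h11 h12 h13 h14 h15
    -- With `X = N + 4`, reading takes `20 * X ^ 3 ≤ 5 * X ^ 4` steps and each solving phase at most
    -- `20 * X ^ 4`, so there are at most `45 * X ^ 4` swaps; one more `X ^ 4` covers the added one.
    have hD : (j' + j + 1) * (decrTime (encodeNat x.k).length + 2) ≤
        (46 * (N + 4) ^ 4) * (4 * (N + 4)) :=
      Nat.mul_le_mul (by omega) (by unfold decrTime; omega)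
    have hD' : (46 * (N + 4) ^ 4) * (4 * (N + 4)) = 184 * (N + 4) ^ 5 := by ring
    omega
  · have hts := ts_eq_psiFun x.f
    have : ts (graph x.m x.n) x.f = j' + j := by omega
    simp [Instance.answer, this, ofBits_encodeNat]

theorem nonempty_computableInPolyTime :
    Nonempty (Turing.TM2ComputableInPolyTime Instance.encode encodeBool Instance.answer) := by
  refine Prog.nonempty_computableInPolyTime decideInstance .input (.bit true) _ _
    (Polynomial.C 10000 * (Polynomial.X + Polynomial.C 4) ^ 5) fun x => ?_
  obtain ⟨r, ⟨t, ht, h1⟩, h2⟩ := exists_runs_decideInstance x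
  exact ⟨t, by simpa using ht, r, h1, h2⟩

end StarPath

theorem mainTheorem9 :
    -- Token Swapping on star-path graphs is decided by a Turing machine in polynomial time
    Nonempty (Turing.TM2ComputableInPolyTime StarPath.Instance.encode
        Computability.encodeBool StarPath.Instance.answer) ∧
    ∀ (m n : ℕ) (f : Equiv.Perm (StarPath.Vtx m n)),
      -- the exact value of the optimum
      (TokenSwapping.ts (StarPath.graph m n) f : ℤ) = StarPath.psiFun f ∧
      -- every swap changes the evaluation function by exactly one
      (∀ e ∈ (StarPath.graph m n).edgeSet,
        |StarPath.psiFun (TokenSwapping.applySwap f e) - StarPath.psiFun f| = 1) ∧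
      -- the algorithm terminates
      (∃ es, StarPath.AlgorithmRun f es) ∧
      -- its output is an optimal solution, and each of its swaps lowers the evaluation by one
      (∀ es, StarPath.AlgorithmRun f es →
        es ∈ TokenSwapping.solutions (StarPath.graph m n) f ∧
        es.length = TokenSwapping.ts (StarPath.graph m n) f ∧
        ∀ i < es.length,
          StarPath.psiFun (TokenSwapping.applySwaps f (es.take (i + 1))) =
            StarPath.psiFun (TokenSwapping.applySwaps f (es.take i)) - 1) := by
  refine ⟨StarPath.nonempty_computableInPolyTime, fun m n f =>
    ⟨StarPath.ts_eq_psiFun f, fun e he => StarPath.abs_psiFun_applySwap_sub f he,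
      StarPath.exists_algorithmRun f, fun es h => ⟨⟨h.spec.1.edge, h.spec.2⟩, h.length_eq,
        h.spec.1.take⟩⟩⟩
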